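/- Let $E$ be a Hilbert $C^*$-module over a $C^*$-algebra $B$, let $\mathcal L(E)$ be the $C^*$-algebra of bounded adjointable operators on $E$, and write $[S,T]=ST+TS$ for the anticommutator of two self-adjoint regular operators in $E$, with domain $$\mathcal F(S,T)=\{x\in \mathcal D(S)\cap\mathcal D(T) : Sx\in\mathcal D(T),\ Tx\in\mathcal D(S)\}.$$ A pair $(S,T)$ of self-adjoint regular operators in $E$ is called *weakly anticommuting* if 1. there are constants $C_0,C_1,C_2>0$ with $\langle [S,T]x,[S,T]x\rangle\le C_0\langle x,x\rangle+C_1\langle Sx,Sx\rangle+C_2\langle Tx,Tx\rangle$ in $B$ for all $x\in\mathcal F(S,T)$, and 2. there are a core $\mathcal E\subset\mathcal D(T)$ for $T$ and $\lambda_0>0$ such that $(S+\lambda)^{-1}(\mathcal E)\subset\mathcal F(S,T)$ for all $\lambda\in i\mathbb R$ with $|\lambda|\ge\lambda_0$. **Proposition.** Let $(S,T)$ be a weakly anticommuting pair in $E$. Then $D:=S+T$ with domain $\mathcal D(S)\cap\mathcal D(T)$ is self-adjoint and regular, so that $|D|$ and $(1+\mu^2D^2)^{-1}$ are defined by functional calculus.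 The set $\mathcal D(S)\cap\mathcal D(T)$ is contained in $\mathcal D(|D|)$ and in the domain of the closure $\overline{[S,T]}$, and there is a constant $C>0$ such that (a) for all $x\in\mathcal D(S)\cap\mathcal D(T)$, $$\langle\overline{[S,T]}\,x,x\rangle\le C\big(\langle x,x\rangle+\langle |D|x,x\rangle\big)\quad\text{in } B;$$ (b) for all $\mu>0$ the operators $(1+\mu^2D^2)^{-1}[S,T](1+\mu^2D^2)^{-1}$ and $(1+|D|)(1+\mu^2D^2)^{-2}$ are everywhere defined, bounded and adjointable, and $$\pm(1+\mu^2D^2)^{-1}[S,T](1+\mu^2D^2)^{-1}\le C\,(1+|D|)(1+\mu^2D^2)^{-2}\quad\text{in }\mathcal L(E).$$ Moreover, for every $\varepsilon>0$ there is $r>0$ such that the rescaled pair $(rS,rT)$ is weakly anticommuting and (a) and (b) hold for $(rS,rT)$ and $rD$ in place of $(S,T)$ and $D$ with a constant $C$ satisfying $0<C<\varepsilon$. -/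

import Mathlib

/-!
Hilbert C⋆-modules are Mathlib's `CStarModule A E`, with `E` complete for the norm of the module.
There `⟪x, a • y⟫ = a * ⟪x, y⟫`; a right Hilbert module over `B` is the case `A = Bᵐᵒᵖ`, and the
order and the C⋆-norm of `Bᵐᵒᵖ` are those of `B`. The inner product is conjugate-linear in the
first variable.

Unbounded operators are Mathlib's partially defined linear maps `E →ₗ.[ℂ] E`, with
`(P + Q).domain = P.domain ⊓ Q.domain`.
-/

namespace HilbertModule

noncomputable section

section Algebraic

variable {E : Type*} [AddCommGroup E] [Module ℂ E]

/-- The composition `P ∘ Q` of two unbounded operators, with its maximal domain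
`{x ∈ dom Q | Q x ∈ dom P}`. -/
def pcomp (P Q : E →ₗ.[ℂ] E) : E →ₗ.[ℂ] E where
  domain :=
    { carrier := {x | ∃ h : x ∈ Q.domain, Q ⟨x, h⟩ ∈ P.domain}
      zero_mem' := ⟨Q.domain.zero_mem, by
        have h : Q ⟨0, Q.domain.zero_mem⟩ = 0 := Q.map_zero
        rw [h]; exact P.domain.zero_mem⟩
      add_mem' := by
        rintro x y ⟨hx, hx'⟩ ⟨hy, hy'⟩
        refine ⟨Q.domain.add_mem hx hy, ?_⟩
        have h : Q ⟨x + y, Q.domain.add_mem hx hy⟩ = Q ⟨x, hx⟩ + Q ⟨y, hy⟩ :=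
          Q.map_add ⟨x, hx⟩ ⟨y, hy⟩
        rw [h]; exact P.domain.add_mem hx' hy'
      smul_mem' := by
        rintro c x ⟨hx, hx'⟩
        refine ⟨Q.domain.smul_mem c hx, ?_⟩
        have h : Q ⟨c • x, Q.domain.smul_mem c hx⟩ = c • Q ⟨x, hx⟩ := Q.map_smul c ⟨x, hx⟩
        rw [h]; exact P.domain.smul_mem c hx' }
  toFun :=
    { toFun := fun x => P ⟨Q ⟨x, x.2.choose⟩, x.2.choose_spec⟩
      map_add' := by
        intro x y
        rw [← P.map_add]
        congr 1
        apply Subtype.ext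
        exact Q.map_add ⟨x, x.2.choose⟩ ⟨y, y.2.choose⟩
      map_smul' := by
        intro c x
        rw [RingHom.id_apply, ← P.map_smul]
        congr 1
        apply Subtype.ext
        exact Q.map_smul c ⟨x, x.2.choose⟩ }

/-- The anticommutator `[S, T] = S T + T S`. Its domain is
`ℱ(S, T) = {x ∈ dom S ∩ dom T | S x ∈ dom T, T x ∈ dom S}`. -/
def anticomm (S T : E →ₗ.[ℂ] E) : E →ₗ.[ℂ] E := pcomp S T + pcomp T S

/-- `1 + P` on the domain of `P`. -/
def onePlus (P : E →ₗ.[ℂ] E) : E →ₗ.[ℂ] E := (LinearMap.id : E →ₗ[ℂ] E) +ᵥ P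

/-- `1 + μ² D²` on `dom (D²) = {x ∈ dom D | D x ∈ dom D}`. -/
def onePlusSq (μ : ℝ) (D : E →ₗ.[ℂ] E) : E →ₗ.[ℂ] E := onePlus (((μ ^ 2 : ℝ) : ℂ) • pcomp D D)

end Algebraic

section Module

variable (A : Type*) {E : Type*} [NonUnitalCStarAlgebra A] [PartialOrder A] [StarOrderedRing A]
  [SMul A E] [NormedAddCommGroup E] [NormedSpace ℂ E] [CStarModule A E]

/-- `S` is a self-adjoint regular operator: it is densely defined, it equals its adjoint (`y` lies
in the domain of the adjoint, with value `z`, iff `⟪y, S x⟫ = ⟪z, x⟫` for all `x ∈ dom S`), and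
`1 + S⋆ S = 1 + S²` has dense range. Being an adjoint, `S` is closed and `A`-linear and its domain
is an `A`-submodule. -/
structure IsSelfAdjointRegular (S : E →ₗ.[ℂ] E) : Prop where
  dense_domain : Dense (S.domain : Set E)
  eq_adjoint : ∀ y z : E, (y, z) ∈ S.graph ↔ ∀ x : S.domain, inner A y (S x) = inner A z (x : E)
  dense_range : Dense (Set.range (onePlusSq 1 S))

/-- `(S, T)` is a weakly anticommuting pair of self-adjoint regular operators. As `S + λ` is
bijective for imaginary `λ = i t ≠ 0`, the condition `resolvent_core` says that
`(S + λ)⁻¹ 𝓔 ⊆ ℱ(S, T)` for `|λ| ≥ t₀`. -/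
structure WeaklyAnticommuting (S T : E →ₗ.[ℂ] E) : Prop where
  left : IsSelfAdjointRegular A S
  right : IsSelfAdjointRegular A T
  form_bound : ∃ C₀ C₁ C₂ : ℝ, 0 < C₀ ∧ 0 < C₁ ∧ 0 < C₂ ∧
    ∀ (x : E) (hx : x ∈ (anticomm S T).domain) (hS : x ∈ S.domain) (hT : x ∈ T.domain),
      inner A (anticomm S T ⟨x, hx⟩) (anticomm S T ⟨x, hx⟩) ≤
        C₀ • inner A x x + C₁ • inner A (S ⟨x, hS⟩) (S ⟨x, hS⟩)
          + C₂ • inner A (T ⟨x, hT⟩) (T ⟨x, hT⟩)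
  resolvent_core : ∃ 𝓔 : Submodule ℂ E, T.HasCore 𝓔 ∧ ∃ t₀ : ℝ, 0 < t₀ ∧
    ∀ t : ℝ, t₀ ≤ |t| → ∀ x : S.domain,
      S x + ((t : ℂ) * Complex.I) • (x : E) ∈ 𝓔 → (x : E) ∈ (anticomm S T).domain

variable (E)

/-- The bounded adjointable operators on `E`, as a subalgebra of the bounded operators. -/
def adjointableSubalgebra : Subalgebra ℂ (E →L[ℂ] E) where
  carrier := {T | ∃ T' : E →L[ℂ] E, ∀ x y, inner A (T x) y = inner A x (T' y)}
  mul_mem' := by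
    rintro a b ⟨a', ha⟩ ⟨b', hb⟩
    exact ⟨b' * a', fun x y => by simp [ha, hb]⟩
  add_mem' := by
    rintro a b ⟨a', ha⟩ ⟨b', hb⟩
    exact ⟨a' + b', fun x y => by simp [ha, hb]⟩
  algebraMap_mem' := by
    intro r
    refine ⟨algebraMap ℂ _ (star r), fun x y => ?_⟩
    simp [Algebra.algebraMap_eq_smul_one]

/-- The algebra `𝓛(E)` of bounded adjointable operators on `E`, with the operator norm. -/
def Adjointable : Type _ := ↥(adjointableSubalgebra A E)

instance : NormedRing (Adjointable A E) := inferInstanceAs (NormedRing (adjointableSubalgebra A E))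

instance : NormedAlgebra ℂ (Adjointable A E) :=
  inferInstanceAs (NormedAlgebra ℂ (adjointableSubalgebra A E))

variable {E}

theorem eq_of_inner_left {y z : E} (h : ∀ x : E, inner A x y = inner A x z) : y = z := by
  rw [← sub_eq_zero, ← CStarModule.inner_self (A := A), CStarModule.inner_sub_right, h, sub_self]

variable {A}

/-- The adjoint of a bounded adjointable operator. -/
instance : Star (Adjointable A E) where
  star T := ⟨T.2.choose, T.1, fun x y => by
    rw [← CStarModule.star_inner y, ← T.2.choose_spec, CStarModule.star_inner]⟩

theorem inner_star_right (T : Adjointable A E) (x y : E) :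
    inner A x ((star T).1 y) = inner A (T.1 x) y := (T.2.choose_spec x y).symm

theorem eq_star {T S : Adjointable A E}
    (h : ∀ x y, inner A x (S.1 y) = inner A (T.1 x) y) : S = star T := by
  apply Subtype.ext
  ext y
  apply eq_of_inner_left A
  intro x
  rw [h, inner_star_right]

theorem inner_star_left (T : Adjointable A E) (x y : E) :
    inner A ((star T).1 x) y = inner A x (T.1 y) := by
  rw [← CStarModule.star_inner y, inner_star_right, CStarModule.star_inner]

instance : StarRing (Adjointable A E) where
  star_involutive T := (eq_star fun x y => by rw [inner_star_left]).symm
  star_mul S T := (eq_star fun x y => by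
    change inner A x ((star T).1 ((star S).1 y)) = inner A (S.1 (T.1 x)) y
    rw [inner_star_right, inner_star_right]).symm
  star_add S T := (eq_star fun x y => by
    change inner A x ((star S).1 y + (star T).1 y) = inner A (S.1 x + T.1 x) y
    rw [CStarModule.inner_add_right, CStarModule.inner_add_left, inner_star_right,
      inner_star_right]).symm

instance : StarModule ℂ (Adjointable A E) where
  star_smul c T := (eq_star fun x y => by
    change inner A x (star c • (star T).1 y) = inner A (c • T.1 x) y
    rw [CStarModule.inner_smul_right_complex, CStarModule.inner_smul_left_complex,
      inner_star_right]).symm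

theorem norm_sq_le (T : Adjointable A E) (x : E) :
    ‖T.1 x‖ ^ 2 ≤ ‖star T * T‖ * ‖x‖ ^ 2 := by
  rw [CStarModule.norm_sq_eq A, ← inner_star_right]
  calc ‖inner A x ((star T * T).1 x)‖ ≤ ‖x‖ * ‖(star T * T).1 x‖ := CStarModule.norm_inner_le E
    _ ≤ ‖x‖ * (‖star T * T‖ * ‖x‖) := by
      gcongr
      exact (star T * T).1.le_opNorm x
    _ = ‖star T * T‖ * ‖x‖ ^ 2 := by ring

instance : CStarRing (Adjointable A E) where
  norm_mul_self_le T := by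
    have h : ‖T‖ ≤ √‖star T * T‖ := by
      refine T.1.opNorm_le_bound (Real.sqrt_nonneg _) fun x => ?_
      have := Real.sqrt_le_sqrt (norm_sq_le T x)
      rwa [Real.sqrt_sq (norm_nonneg _), Real.sqrt_mul (norm_nonneg (star T * T)),
        Real.sqrt_sq (norm_nonneg _)] at this
    calc ‖T‖ * ‖T‖ ≤ √‖star T * T‖ * √‖star T * T‖ := by gcongr
      _ = ‖star T * T‖ := Real.mul_self_sqrt (norm_nonneg _)

instance [CompleteSpace E] : CompleteSpace (Adjointable A E) := by
  refine Metric.complete_of_cauchySeq_tendsto fun u hu => ?_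
  have hu₁ : CauchySeq fun n => (u n).1 := hu.map uniformContinuous_subtype_val
  have hiso : Isometry (star : Adjointable A E → Adjointable A E) := by
    refine Isometry.of_dist_eq fun a b => ?_
    rw [dist_eq_norm, dist_eq_norm, ← star_sub, norm_star]
  have hu₂ : CauchySeq fun n => (star (u n)).1 :=
    (hu.map hiso.uniformContinuous).map uniformContinuous_subtype_val
  obtain ⟨T, hT⟩ := cauchySeq_tendsto_of_complete hu₁
  obtain ⟨T', hT'⟩ := cauchySeq_tendsto_of_complete hu₂
  have key : ∀ x y, inner A (T x) y = inner A x (T' y) := by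
    intro x y
    have h₁ : Filter.Tendsto (fun n => inner A ((u n).1 x) y) Filter.atTop
        (nhds (inner A (T x) y)) :=
      ((CStarModule.continuous_inner (A := A) (E := E)).comp
        (continuous_id.prodMk continuous_const)).continuousAt.tendsto.comp
        (((ContinuousLinearMap.apply ℂ E x).continuous.tendsto T).comp hT)
    have h₂ : Filter.Tendsto (fun n => inner A x ((star (u n)).1 y)) Filter.atTop
        (nhds (inner A x (T' y))) :=
      ((CStarModule.continuous_inner (A := A) (E := E)).comp
        (continuous_const.prodMk continuous_id)).continuousAt.tendsto.comp
        (((ContinuousLinearMap.apply ℂ E y).continuous.tendsto T').comp hT')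
    simp only [inner_star_right] at h₂
    exact tendsto_nhds_unique h₁ h₂
  exact ⟨⟨T, T', key⟩, tendsto_subtype_rng.mpr hT⟩

variable [CompleteSpace E]

/-- `𝓛(E)` is a unital C⋆-algebra. -/
instance : CStarAlgebra (Adjointable A E) where

/-- The usual order of the C⋆-algebra `𝓛(E)`: `L ≤ M` iff `M - L` is a positive element. -/
instance : PartialOrder (Adjointable A E) := CStarAlgebra.spectralOrder _

instance : StarOrderedRing (Adjointable A E) := CStarAlgebra.spectralOrderedRing _

/-- A bounded adjointable operator as an unbounded operator with domain `E`. -/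
def ofBdd (L : Adjointable A E) : E →ₗ.[ℂ] E := LinearMap.toPMap (L.1 : E →ₗ[ℂ] E) ⊤

/-- The bounded adjointable operator `R` is a two-sided inverse of the unbounded operator `P`. -/
def IsBddInverse (P : E →ₗ.[ℂ] E) (R : Adjointable A E) : Prop :=
  pcomp P (ofBdd R) = ofBdd (1 : Adjointable A E) ∧ ∀ x : P.domain, R.1 (P x) = x

variable (A)

open scoped Classical in
/-- The inverse in `𝓛(E)` of an unbounded operator (`0` if there is none). -/
def bddInv (P : E →ₗ.[ℂ] E) : Adjointable A E :=
  if h : ∃ R : Adjointable A E, IsBddInverse P R then h.choose else 0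

/-- `(1 + μ² D²)⁻¹`. -/
def resolventSq (μ : ℝ) (D : E →ₗ.[ℂ] E) : Adjointable A E := bddInv A (onePlusSq μ D)

/-- `(1 + D²)^(-1/2)`, by the continuous functional calculus in `𝓛(E)`. -/
def sqrtResolvent (D : E →ₗ.[ℂ] E) : Adjointable A E := cfc Real.sqrt (resolventSq A 1 D)

open scoped Classical in
/-- The bounded transform `D (1 + D²)^(-1/2)` of a self-adjoint regular operator `D`. -/
def boundedTransform (D : E →ₗ.[ℂ] E) : Adjointable A E :=
  if h : ∃ F : Adjointable A E, ofBdd F = pcomp D (ofBdd (sqrtResolvent A D)) then h.choose else 0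

/-- The absolute value `|D|` of a self-adjoint regular operator `D`, by functional calculus:
with the bounded transform `F = D (1 + D²)^(-1/2)`, it is `|F| ∘ ((1 + D²)^(-1/2))⁻¹` on the range
of `(1 + D²)^(-1/2)`. -/
def absOp (D : E →ₗ.[ℂ] E) : E →ₗ.[ℂ] E :=
  pcomp (ofBdd (cfc (fun t : ℝ => |t|) (boundedTransform A D))) (ofBdd (sqrtResolvent A D)).inverse

/-- The form estimate `⟨[S,T]‾ x, x⟩ ≤ C (⟨x, x⟩ + ⟨|S + T| x, x⟩)` for all `x ∈ dom S ∩ dom T`,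
where `[S,T]‾` is the closure of the anticommutator; `dom S ∩ dom T` is contained in the domains
of `[S,T]‾` and of `|S + T|`. -/
def FormEstimate (S T : E →ₗ.[ℂ] E) (C : ℝ) : Prop :=
  ∀ x : E, x ∈ S.domain → x ∈ T.domain →
    ∃ (hK : x ∈ (anticomm S T).closure.domain) (hD : x ∈ (absOp A (S + T)).domain),
      inner A ((anticomm S T).closure ⟨x, hK⟩) x ≤
        C • (inner A x x + inner A (absOp A (S + T) ⟨x, hD⟩) x)

/-- With `D = S + T` and `R = (1 + μ² D²)⁻¹`, the operators `R [S,T] R` and `(1 + |D|) R²` are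
everywhere defined, bounded and adjointable, and `± R [S,T] R ≤ C (1 + |D|) R²` in `𝓛(E)`. -/
def OperatorEstimate (S T : E →ₗ.[ℂ] E) (C μ : ℝ) : Prop :=
  IsBddInverse (onePlusSq μ (S + T)) (resolventSq A μ (S + T)) ∧
  ∃ L M : Adjointable A E,
    ofBdd L = pcomp (ofBdd (resolventSq A μ (S + T)))
      (pcomp (anticomm S T) (ofBdd (resolventSq A μ (S + T)))) ∧
    ofBdd M = pcomp (onePlus (absOp A (S + T))) (ofBdd (resolventSq A μ (S + T) ^ 2)) ∧
    L ≤ (C : ℂ) • M ∧ -L ≤ (C : ℂ) • M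

end Module

end

end HilbertModule

namespace HilbertModule

set_option linter.unusedSectionVars false

noncomputable section

open Filter Topology

/-! ### Unbounded operators through their graphs -/

section Graphs

variable {E : Type*} [AddCommGroup E] [Module ℂ E]

/-! Write `D = S + T`, `K = [S, T]`, and let `κ` be a common constant for the form bound. On `ℱ(S,
T)` symmetry gives `⟨x, Kx⟩ = ⟨Sx, Tx⟩ + ⟨Tx, Sx⟩`, and absorbing `K` by the form bound yields `⟨Sx,
Sx⟩ + ⟨Tx, Tx⟩ ≤ 2⟨(S ± T)x, (S ± T)x⟩ + (κ + 1)⟨x, x⟩`. The operators `iτ(S + iτ)⁻¹`, `τ → ∞`,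
approximate each vector of `dom S ∩ dom T` in both graph norms by vectors of `ℱ(S, T)` whose
anticommutators converge (`AnticommPair.exists_seq`). So the inequality holds on `dom S ∩ dom T`,
the operators `S ± T` are closed there, and the closure of `K` is defined there.

For a densely defined symmetric operator, self-adjointness and regularity follow once `D + it` is
onto for one `t` of each sign (`IsSymm.isSelfAdjointRegular`). The range is closed, so density is
the issue. Orthogonal complements do not detect density in Hilbert modules. Instead, Hahn–Banach
produces a positive functional on `A` that keeps some vector away from the range, and localizing at
it gives a Hilbert space with a nonzero `ξ` orthogonal to the range (`dense_of_approximate_bound`).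
Let `R = (1 + S²/n²)⁻¹`. Moving `T` past two resolvents of `S` restores the sign, so `T` commutes
with `R` up to an error of order `√κ/n` relative to the resolvent of `T`. Heuristically `(D - im)Rξ`
is then almost zero, and its imaginary part gives `2m‖Rξ‖² ≤ 144√κ‖ξ‖²`, which is impossible for `m
≥ 144√κ` once `Rξ` is close to `ξ`. `AnticommPair.dense_range_add` makes this rigorous with bounded
adjointable operators only.

For the estimates put `r = (1 + D²)^(-1/2)`, `F = Dr`, `f = |F|`, so that `r² + f² = 1`. Then `B`,
the closure of `K` composed with `r`, has norm at most `c = √(κ(κ + 2))`, the operator `rB` is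
self-adjoint, and `(rB)² ≤ c²r²`. Operator monotonicity of the square root gives `±rB ≤ cr`, and `r
+ f ≥ 1` gives `r ≤ r² + rf` (`AnticommPair.exists_form`). Evaluation on vectors is (a). Conjugation
by `N` with `(1 + μ²D²)⁻¹ = rN` is (b), where `dom D² ⊆ ℱ(S, T)` (`AnticommPair.exists_anticomm`)
replaces the closure by `K` itself. Scaling the pair by `ρ` with `0 < ρ ≤ 1` replaces `κ` by `ρ²κ`,
so the constant can be made arbitrarily small. -/

theorem exists_mem_graph {P : E →ₗ.[ℂ] E} {x : E} (hx : x ∈ P.domain) : ∃ y, (x, y) ∈ P.graph :=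
  LinearPMap.mem_domain_iff.1 hx

theorem graph_unique {P : E →ₗ.[ℂ] E} {x y z : E} (h : (x, y) ∈ P.graph)
    (h' : (x, z) ∈ P.graph) : y = z :=
  P.mem_graph_snd_inj h h' rfl

theorem apply_eq_of_mem_graph {P : E →ₗ.[ℂ] E} {x y : E} (h : (x, y) ∈ P.graph)
    (hx : x ∈ P.domain) : P ⟨x, hx⟩ = y :=
  graph_unique (P.mem_graph ⟨x, hx⟩) h

theorem mem_graph_pcomp {P Q : E →ₗ.[ℂ] E} {x z : E} :
    (x, z) ∈ (pcomp P Q).graph ↔ ∃ y, (x, y) ∈ Q.graph ∧ (y, z) ∈ P.graph := by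
  constructor
  · intro h
    obtain ⟨hQ, hP⟩ := LinearPMap.mem_domain_of_mem_graph h
    refine ⟨Q ⟨x, hQ⟩, Q.mem_graph ⟨x, hQ⟩, ?_⟩
    rw [← apply_eq_of_mem_graph h ⟨hQ, hP⟩]
    exact P.mem_graph ⟨Q ⟨x, hQ⟩, hP⟩
  · rintro ⟨y, hy, hz⟩
    have hQ := LinearPMap.mem_domain_of_mem_graph hy
    have hyQ := apply_eq_of_mem_graph hy hQ
    subst hyQ
    have hP := LinearPMap.mem_domain_of_mem_graph hz
    have h := (pcomp P Q).mem_graph ⟨x, hQ, hP⟩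
    rwa [show (pcomp P Q) ⟨x, hQ, hP⟩ = z from apply_eq_of_mem_graph hz hP] at h

theorem mem_graph_add {P Q : E →ₗ.[ℂ] E} {x z : E} :
    (x, z) ∈ (P + Q).graph ↔ ∃ a b, (x, a) ∈ P.graph ∧ (x, b) ∈ Q.graph ∧ z = a + b := by
  constructor
  · intro h
    obtain ⟨hP, hQ⟩ := LinearPMap.mem_domain_of_mem_graph h
    exact ⟨P ⟨x, hP⟩, Q ⟨x, hQ⟩, P.mem_graph ⟨x, hP⟩, Q.mem_graph ⟨x, hQ⟩,
      (apply_eq_of_mem_graph h ⟨hP, hQ⟩).symm⟩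
  · rintro ⟨a, b, ha, hb, rfl⟩
    have hP := LinearPMap.mem_domain_of_mem_graph ha
    have hQ := LinearPMap.mem_domain_of_mem_graph hb
    rw [← apply_eq_of_mem_graph ha hP, ← apply_eq_of_mem_graph hb hQ]
    exact (P + Q).mem_graph ⟨x, hP, hQ⟩

theorem mem_graph_smul {P : E →ₗ.[ℂ] E} {c : ℂ} {x z : E} :
    (x, z) ∈ (c • P).graph ↔ ∃ a, (x, a) ∈ P.graph ∧ z = c • a := by
  constructor
  · intro h
    have hx : x ∈ (c • P).domain := LinearPMap.mem_domain_of_mem_graph h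
    exact ⟨P ⟨x, hx⟩, P.mem_graph ⟨x, hx⟩, (apply_eq_of_mem_graph h hx).symm⟩
  · rintro ⟨a, ha, rfl⟩
    have hx := LinearPMap.mem_domain_of_mem_graph ha
    rw [← apply_eq_of_mem_graph ha hx]
    exact (c • P).mem_graph ⟨x, hx⟩

theorem mem_graph_onePlus {P : E →ₗ.[ℂ] E} {x z : E} :
    (x, z) ∈ (onePlus P).graph ↔ ∃ a, (x, a) ∈ P.graph ∧ z = x + a := by
  constructor
  · intro h
    have hx : x ∈ (onePlus P).domain := LinearPMap.mem_domain_of_mem_graph h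
    exact ⟨P ⟨x, hx⟩, P.mem_graph ⟨x, hx⟩, (apply_eq_of_mem_graph h hx).symm⟩
  · rintro ⟨a, ha, rfl⟩
    have hx := LinearPMap.mem_domain_of_mem_graph ha
    rw [← apply_eq_of_mem_graph ha hx]
    exact (onePlus P).mem_graph ⟨x, hx⟩

theorem mem_graph_onePlusSq {P : E →ₗ.[ℂ] E} {μ : ℝ} {x z : E} :
    (x, z) ∈ (onePlusSq μ P).graph ↔
      ∃ a b, (x, a) ∈ P.graph ∧ (a, b) ∈ P.graph ∧ z = x + ((μ ^ 2 : ℝ) : ℂ) • b := by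
  rw [onePlusSq, mem_graph_onePlus]
  constructor
  · rintro ⟨c, hc, rfl⟩
    obtain ⟨b, hb, rfl⟩ := mem_graph_smul.1 hc
    obtain ⟨a, ha, hb⟩ := mem_graph_pcomp.1 hb
    exact ⟨a, b, ha, hb, rfl⟩
  · rintro ⟨a, b, ha, hb, rfl⟩
    exact ⟨_, mem_graph_smul.2 ⟨b, mem_graph_pcomp.2 ⟨a, ha, hb⟩, rfl⟩, rfl⟩

/-- The anticommutator as a relation: `x ∈ ℱ(S, T)` with `S x = s`, `T x = t`, `[S, T] x = k`. -/
def Anticomm (S T : E →ₗ.[ℂ] E) (x s t k : E) : Prop :=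
  (x, s) ∈ S.graph ∧ (x, t) ∈ T.graph ∧
    ∃ st ts, (t, st) ∈ S.graph ∧ (s, ts) ∈ T.graph ∧ k = st + ts

theorem mem_graph_anticomm {S T : E →ₗ.[ℂ] E} {x k : E} :
    (x, k) ∈ (anticomm S T).graph ↔ ∃ s t, Anticomm S T x s t k := by
  rw [anticomm, mem_graph_add]
  constructor
  · rintro ⟨a, b, ha, hb, rfl⟩
    obtain ⟨t, ht, hst⟩ := mem_graph_pcomp.1 ha
    obtain ⟨s, hs, hts⟩ := mem_graph_pcomp.1 hb
    exact ⟨s, t, hs, ht, a, b, hst, hts, rfl⟩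
  · rintro ⟨s, t, hs, ht, st, ts, hst, hts, rfl⟩
    exact ⟨st, ts, mem_graph_pcomp.2 ⟨t, ht, hst⟩, mem_graph_pcomp.2 ⟨s, hs, hts⟩, rfl⟩

theorem graph_add {P : E →ₗ.[ℂ] E} {x y x' y' : E} (h : (x, y) ∈ P.graph)
    (h' : (x', y') ∈ P.graph) : (x + x', y + y') ∈ P.graph :=
  P.graph.add_mem h h'

theorem graph_sub {P : E →ₗ.[ℂ] E} {x y x' y' : E} (h : (x, y) ∈ P.graph)
    (h' : (x', y') ∈ P.graph) : (x - x', y - y') ∈ P.graph :=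
  P.graph.sub_mem h h'

theorem graph_smul {P : E →ₗ.[ℂ] E} {x y : E} (c : ℂ) (h : (x, y) ∈ P.graph) :
    (c • x, c • y) ∈ P.graph :=
  P.graph.smul_mem c h

theorem Anticomm.sub {S T : E →ₗ.[ℂ] E} {x s t k x' s' t' k' : E} (h : Anticomm S T x s t k)
    (h' : Anticomm S T x' s' t' k') : Anticomm S T (x - x') (s - s') (t - t') (k - k') := by
  obtain ⟨hs, ht, st, ts, hst, hts, rfl⟩ := h
  obtain ⟨hs', ht', st', ts', hst', hts', rfl⟩ := h'
  exact ⟨graph_sub hs hs', graph_sub ht ht', st - st', ts - ts', graph_sub hst hst',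
    graph_sub hts hts', by abel⟩

theorem Anticomm.smul {S T : E →ₗ.[ℂ] E} {x s t k : E} (c : ℂ) (h : Anticomm S T x s t k) :
    Anticomm S T (c • x) (c • s) (c • t) (c • k) := by
  obtain ⟨hs, ht, st, ts, hst, hts, rfl⟩ := h
  exact ⟨graph_smul c hs, graph_smul c ht, c • st, c • ts, graph_smul c hst, graph_smul c hts,
    smul_add c st ts⟩

end Graphs

/-! ### Inequalities for the inner product and bounded adjointable operators -/

section Module

variable {A E : Type*} [NonUnitalCStarAlgebra A] [PartialOrder A] [StarOrderedRing A]
  [SMul A E] [NormedAddCommGroup E] [NormedSpace ℂ E] [CStarModule A E]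

theorem mem_graph_ofBdd {L : Adjointable A E} {x y : E} :
    (x, y) ∈ (ofBdd L).graph ↔ y = L.1 x := by
  constructor
  · intro h
    exact (apply_eq_of_mem_graph h (show x ∈ (⊤ : Submodule ℂ E) from trivial)).symm
  · rintro rfl
    exact (ofBdd L).mem_graph ⟨x, trivial⟩

theorem ofBdd_eq_iff {L : Adjointable A E} {P : E →ₗ.[ℂ] E} :
    ofBdd L = P ↔ ∀ x, (x, L.1 x) ∈ P.graph := by
  constructor
  · rintro rfl x
    exact mem_graph_ofBdd.2 rfl
  · intro h
    apply LinearPMap.eq_of_le_of_domain_eq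
    · apply LinearPMap.le_of_le_graph
      rintro ⟨x, y⟩ hxy
      rw [mem_graph_ofBdd.1 hxy]
      exact h x
    · refine (eq_top_iff.2 fun x _ => ?_).symm
      exact LinearPMap.mem_domain_of_mem_graph (h x)

variable (A) in
theorem eq_of_inner_right {y z : E} (h : ∀ x : E, inner A y x = inner A z x) : y = z :=
  eq_of_inner_left A fun x => by
    rw [← CStarModule.star_inner y, ← CStarModule.star_inner z, h]

variable (A) in
theorem norm_le_norm_of_inner_le {x y : E} (h : inner A x x ≤ inner A y y) : ‖x‖ ≤ ‖y‖ := by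
  rw [← sq_le_sq₀ (norm_nonneg _) (norm_nonneg _), CStarModule.norm_sq_eq A,
    CStarModule.norm_sq_eq A]
  exact CStarAlgebra.norm_le_norm_of_nonneg_of_le CStarModule.inner_self_nonneg h

variable (A) in
theorem norm_sq_le_of_inner_le {x : E} {a : A} (h : inner A x x ≤ a) : ‖x‖ ^ 2 ≤ ‖a‖ := by
  rw [CStarModule.norm_sq_eq A]
  exact CStarAlgebra.norm_le_norm_of_nonneg_of_le CStarModule.inner_self_nonneg h

/-- Young's inequality in `A`: expand `0 ≤ a⁻¹⟨ax - y, ax - y⟩`. -/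
theorem inner_add_inner_le (x y : E) {a : ℝ} (ha : 0 < a) :
    inner A x y + inner A y x ≤ a • inner A x x + a⁻¹ • inner A y y := by
  have h : (0 : A) ≤ a⁻¹ • inner A (a • x - y) (a • x - y) :=
    smul_nonneg (inv_nonneg.2 ha.le) CStarModule.inner_self_nonneg
  rw [← sub_nonneg]
  convert h using 1
  simp only [CStarModule.inner_sub_left, CStarModule.inner_sub_right,
    CStarModule.inner_smul_left_real, CStarModule.inner_smul_right_real, smul_sub, smul_smul]
  rw [inv_mul_cancel₀ ha.ne', inv_mul_cancel_left₀ ha.ne', one_smul, one_smul]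
  abel

theorem neg_inner_add_inner_le (x y : E) {a : ℝ} (ha : 0 < a) :
    -(inner A x y + inner A y x) ≤ a • inner A x x + a⁻¹ • inner A y y := by
  have h := inner_add_inner_le (A := A) (-x) y ha
  simp only [CStarModule.inner_neg_left, CStarModule.inner_neg_right, neg_neg] at h
  rwa [neg_add]

namespace Adjointable

@[simp] theorem one_apply (x : E) : (1 : Adjointable A E).1 x = x := rfl
@[simp] theorem mul_apply (L M : Adjointable A E) (x : E) : (L * M).1 x = L.1 (M.1 x) := rfl
@[simp] theorem add_apply (L M : Adjointable A E) (x : E) : (L + M).1 x = L.1 x + M.1 x := rfl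
@[simp] theorem sub_apply (L M : Adjointable A E) (x : E) : (L - M).1 x = L.1 x - M.1 x := rfl
@[simp] theorem neg_apply (L : Adjointable A E) (x : E) : (-L).1 x = -L.1 x := rfl
@[simp] theorem smul_apply (c : ℂ) (L : Adjointable A E) (x : E) :
    (c • L).1 x = c • L.1 x := rfl

theorem ext {L M : Adjointable A E} (h : ∀ x, L.1 x = M.1 x) : L = M :=
  Subtype.ext (ContinuousLinearMap.ext h)

theorem ext_on_dense {L M : Adjointable A E} {s : Set E} (hs : Dense s)
    (h : ∀ x ∈ s, L.1 x = M.1 x) : L = M :=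
  Subtype.ext (ContinuousLinearMap.ext_on (hs.mono Submodule.subset_span) h)

theorem norm_le_of_forall {L : Adjointable A E} {c : ℝ} (hc : 0 ≤ c)
    (h : ∀ x, ‖L.1 x‖ ≤ c * ‖x‖) : ‖L‖ ≤ c :=
  L.1.opNorm_le_bound hc h

theorem le_norm (L : Adjointable A E) (x : E) : ‖L.1 x‖ ≤ ‖L‖ * ‖x‖ :=
  L.1.le_opNorm x

theorem le_of_norm_le {L : Adjointable A E} {c : ℝ} (h : ‖L‖ ≤ c) (x : E) :
    ‖L.1 x‖ ≤ c * ‖x‖ :=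
  (L.le_norm x).trans (by gcongr)

theorem tendsto_apply (L : Adjointable A E) {u : ℕ → E} {x : E} (h : Tendsto u atTop (𝓝 x)) :
    Tendsto (fun n => L.1 (u n)) atTop (𝓝 (L.1 x)) :=
  (L.1.continuous.tendsto x).comp h

/-- A uniformly bounded sequence that converges pointwise on a dense set to the identity converges
to the identity along convergent sequences. -/
theorem tendsto_self_of_dense {L : ℕ → Adjointable A E} (hL : ∀ n, ‖L n‖ ≤ 1) {s : Set E}
    (hs : Dense s) (h : ∀ x ∈ s, Tendsto (fun n => (L n).1 x) atTop (𝓝 x)) {u : ℕ → E} {x : E}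
    (hu : Tendsto u atTop (𝓝 x)) : Tendsto (fun n => (L n).1 (u n)) atTop (𝓝 x) := by
  rw [Metric.tendsto_atTop]
  intro ε hε
  obtain ⟨y, hy, hxy⟩ := Metric.dense_iff.1 hs x (ε / 4) (by positivity)
  obtain ⟨N₁, hN₁⟩ := Metric.tendsto_atTop.1 (h _ hxy) (ε / 4) (by positivity)
  obtain ⟨N₂, hN₂⟩ := Metric.tendsto_atTop.1 hu (ε / 4) (by positivity)
  refine ⟨max N₁ N₂, fun n hn => ?_⟩
  have h₁ := hN₁ n (le_trans (le_max_left _ _) hn)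
  have h₂ := hN₂ n (le_trans (le_max_right _ _) hn)
  have h₃ := le_of_norm_le (hL n) (u n - x)
  have h₄ := le_of_norm_le (hL n) (x - y)
  rw [Metric.mem_ball, dist_eq_norm, norm_sub_rev] at hy
  rw [dist_eq_norm] at h₁ h₂ ⊢
  have e : (L n).1 (u n) - x
      = (L n).1 (u n - x) + (L n).1 (x - y) + ((L n).1 y - y) - (x - y) := by
    simp only [map_sub]; abel
  rw [e]
  calc _ ≤ ‖(L n).1 (u n - x)‖ + ‖(L n).1 (x - y)‖ + ‖(L n).1 y - y‖ + ‖x - y‖ :=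
        (norm_sub_le _ _).trans (by gcongr; exact (norm_add₃_le))
    _ < ε := by linarith

/-- A bounded operator with a densely defined formal adjoint is adjointable. -/
theorem exists_of_dense [CompleteSpace E] (L : E →L[ℂ] E) {s : Set E} (hs : Dense s)
    (h : ∀ y ∈ s, ∃ z, ∀ x, inner A (L x) y = inner A x z) :
    ∃ M : Adjointable A E, M.1 = L := by
  -- The graph of the formal adjoint. The usual estimate bounds it by `‖L‖`, so it extends from the
  -- dense set to all of `E` by completeness.
  let V : Submodule ℂ (E × E) :=
    { carrier := {p | ∀ x, inner A (L x) p.1 = inner A x p.2}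
      zero_mem' := fun x => by simp
      add_mem' := fun {p q} hp hq x => by simp [hp x, hq x]
      smul_mem' := fun c p hp x => by simp [hp x] }
  have hbound : ∀ p ∈ V, ‖p.2‖ ≤ ‖L‖ * ‖p.1‖ := by
    intro p hp
    rcases (norm_nonneg p.2).eq_or_lt with h0 | h0
    · rw [← h0]; positivity
    refine le_of_mul_le_mul_left ?_ h0
    calc ‖p.2‖ * ‖p.2‖ = ‖inner A p.2 p.2‖ := by rw [← sq, CStarModule.norm_sq_eq A]
      _ = ‖inner A (L p.2) p.1‖ := by rw [hp p.2]
      _ ≤ ‖L p.2‖ * ‖p.1‖ := CStarModule.norm_inner_le E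
      _ ≤ ‖L‖ * ‖p.2‖ * ‖p.1‖ := by gcongr; exact L.le_opNorm _
      _ = ‖p.2‖ * (‖L‖ * ‖p.1‖) := by ring
  have hall : ∀ y, ∃ z, (y, z) ∈ V := by
    intro y
    obtain ⟨u, hu, huy⟩ := mem_closure_iff_seq_limit.1 (hs y)
    choose z hz using fun n => h (u n) (hu n)
    have hzV : ∀ n, (u n, z n) ∈ V := hz
    have hc : CauchySeq z := by
      rw [Metric.cauchySeq_iff]
      intro ε hε
      obtain ⟨N, hN⟩ := Metric.cauchySeq_iff.1 huy.cauchySeq (ε / (‖L‖ + 1)) (by positivity)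
      refine ⟨N, fun m hm n hn => ?_⟩
      have h1 := hN m hm n hn
      have h2 := hbound _ (V.sub_mem (hzV m) (hzV n))
      rw [dist_eq_norm] at h1 ⊢
      rw [lt_div_iff₀ (by positivity)] at h1
      have h3 : ‖z m - z n‖ ≤ ‖L‖ * ‖u m - u n‖ := h2
      nlinarith [norm_nonneg (u m - u n)]
    obtain ⟨w, hw⟩ := cauchySeq_tendsto_of_complete hc
    refine ⟨w, fun x => ?_⟩
    have h₁ : Tendsto (fun n => inner A (L x) (u n)) atTop (𝓝 (inner A (L x) y)) :=
      ((CStarModule.innerSL (A := A) (L x)).continuous.tendsto y).comp huy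
    have h₂ : Tendsto (fun n => inner A x (z n)) atTop (𝓝 (inner A x w)) :=
      ((CStarModule.innerSL (A := A) x).continuous.tendsto w).comp hw
    simp only [hz] at h₁
    exact tendsto_nhds_unique h₁ h₂
  choose f hf using hall
  have huniq : ∀ {y z z'}, (y, z) ∈ V → (y, z') ∈ V → z = z' := by
    intro y z z' h1 h2
    have := hbound _ (V.sub_mem h1 h2)
    simpa [sub_eq_zero] using this
  let g : E →ₗ[ℂ] E :=
    { toFun := f
      map_add' := fun x y => huniq (hf _) (V.add_mem (hf x) (hf y))
      map_smul' := fun c x => huniq (hf _) (V.smul_mem c (hf x)) }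
  let gc : E →L[ℂ] E := g.mkContinuous ‖L‖ fun x => hbound _ (hf x)
  exact ⟨⟨L, gc, fun x y => hf y x⟩, rfl⟩

section Order

variable [CompleteSpace E]

theorem inner_nonneg {L : Adjointable A E} (hL : 0 ≤ L) (x : E) : 0 ≤ inner A x (L.1 x) := by
  obtain ⟨M, rfl⟩ := CStarAlgebra.nonneg_iff_eq_star_mul_self.1 hL
  rw [mul_apply, inner_star_right]
  exact CStarModule.inner_self_nonneg

theorem inner_mono {L M : Adjointable A E} (h : L ≤ M) (x : E) :
    inner A x (L.1 x) ≤ inner A x (M.1 x) := by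
  have := inner_nonneg (sub_nonneg.2 h) x
  rw [sub_apply, CStarModule.inner_sub_right] at this
  exact sub_nonneg.1 this

theorem inner_apply_self_le {L : Adjointable A E} {c : ℝ} (hL : ‖L‖ ≤ c) (x : E) :
    inner A (L.1 x) (L.1 x) ≤ c ^ 2 • inner A x x := by
  have hc : 0 ≤ c := (norm_nonneg _).trans hL
  have h : star L * L ≤ algebraMap ℝ _ (c ^ 2) := by
    refine (CStarAlgebra.star_mul_le_algebraMap_norm_sq).trans ?_
    exact algebraMap_mono _ (by gcongr)
  have := inner_mono h x
  rw [mul_apply, inner_star_right] at this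
  refine this.trans_eq ?_
  rw [IsScalarTower.algebraMap_apply ℝ ℂ, Algebra.algebraMap_eq_smul_one, smul_apply, one_apply,
    CStarModule.inner_smul_right_complex]
  rfl

end Order

end Adjointable

end Module

/-- The imaginary number `i t`. -/
def imag (t : ℝ) : ℂ := (t : ℂ) * Complex.I

theorem imag_neg (t : ℝ) : imag (-t) = -imag t := by simp [imag]

theorem imag_sub (s t : ℝ) : imag (s - t) = imag s - imag t := by simp [imag, sub_mul]

theorem norm_imag (t : ℝ) : ‖imag t‖ = |t| := by simp [imag]

theorem star_imag (t : ℝ) : star (imag t) = imag (-t) := by simp [imag]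

theorem imag_mul_imag (s t : ℝ) : imag s * imag t = -((s * t : ℝ) : ℂ) := by
  simp only [imag, Complex.ofReal_mul]
  linear_combination (s : ℂ) * t * Complex.I_mul_I

theorem imag_ne_zero {t : ℝ} (ht : t ≠ 0) : imag t ≠ 0 := by simp [imag, ht]

/-! ### Symmetric operators and resolvents at imaginary points -/

section Module

variable {A E : Type*} [NonUnitalCStarAlgebra A] [PartialOrder A] [StarOrderedRing A]
  [SMul A E] [NormedAddCommGroup E] [NormedSpace ℂ E] [CStarModule A E]

variable (A) in
/-- `S` is symmetric: `⟪S x, y⟫ = ⟪x, S y⟫` on the domain of `S`. -/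
def IsSymm (S : E →ₗ.[ℂ] E) : Prop :=
  ∀ ⦃x y x' y' : E⦄, (x, y) ∈ S.graph → (x', y') ∈ S.graph → inner A y x' = inner A x y'

/-- `S + i t` is surjective. -/
def Onto (S : E →ₗ.[ℂ] E) (t : ℝ) : Prop :=
  ∀ w, ∃ x, (x, w - imag t • x) ∈ S.graph

variable {S : E →ₗ.[ℂ] E}

namespace IsSymm

/-- The cross terms cancel because `it` is imaginary and `⟨Sx, x⟩ = ⟨x, Sx⟩`. All norm bounds on
resolvents come from this identity. -/
theorem inner_shift (h : IsSymm A S) (t : ℝ) {x s : E} (hx : (x, s) ∈ S.graph) :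
    inner A (s + imag t • x) (s + imag t • x) = inner A s s + t ^ 2 • inner A x x := by
  simp only [CStarModule.inner_add_left, CStarModule.inner_add_right,
    CStarModule.inner_smul_left_complex, CStarModule.inner_smul_right_complex, h hx hx, star_imag,
    imag_neg, neg_smul, smul_add]
  rw [smul_neg, smul_smul, imag_mul_imag, neg_smul, neg_neg, Complex.coe_smul, ← sq]
  abel

theorem norm_le_shift (h : IsSymm A S) (t : ℝ) {x s : E} (hx : (x, s) ∈ S.graph) :
    |t| * ‖x‖ ≤ ‖s + imag t • x‖ := by
  have h1 : ‖imag t • x‖ ≤ ‖s + imag t • x‖ := by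
    apply norm_le_norm_of_inner_le A
    rw [h.inner_shift t hx, CStarModule.inner_smul_left_complex,
      CStarModule.inner_smul_right_complex, smul_smul, star_imag, imag_mul_imag, neg_mul,
      Complex.ofReal_neg, neg_neg, Complex.coe_smul, ← sq]
    exact le_add_of_nonneg_left CStarModule.inner_self_nonneg
  rwa [norm_smul, norm_imag] at h1

theorem norm_apply_le_shift (h : IsSymm A S) (t : ℝ) {x s : E} (hx : (x, s) ∈ S.graph) :
    ‖s‖ ≤ ‖s + imag t • x‖ := by
  apply norm_le_norm_of_inner_le A
  rw [h.inner_shift t hx]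
  exact le_add_of_nonneg_right (smul_nonneg (sq_nonneg t) CStarModule.inner_self_nonneg)

theorem shift_sub_le (h : IsSymm A S) (t : ℝ) {x w x' w' : E}
    (hx : (x, w - imag t • x) ∈ S.graph) (hx' : (x', w' - imag t • x') ∈ S.graph) :
    |t| * ‖x - x'‖ ≤ ‖w - w'‖ := by
  have := h.norm_le_shift t (graph_sub hx hx')
  rwa [show w - imag t • x - (w' - imag t • x') + imag t • (x - x') = w - w' by
    rw [smul_sub]; abel] at this

theorem shift_unique (h : IsSymm A S) {t : ℝ} (ht : t ≠ 0) {x w x' : E}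
    (hx : (x, w - imag t • x) ∈ S.graph) (hx' : (x', w - imag t • x') ∈ S.graph) : x = x' := by
  have := h.shift_sub_le t hx hx'
  rw [sub_self, norm_zero] at this
  have h2 : ‖x - x'‖ ≤ 0 := by
    by_contra! h3
    have := mul_pos (abs_pos.2 ht) h3
    linarith
  exact sub_eq_zero.1 (norm_le_zero_iff.1 h2)

theorem onto_of_close [CompleteSpace E] (h : IsSymm A S) {s t : ℝ} (ht : Onto S t)
    (hst : |s - t| < |t|) : Onto S s := by
  have h0 : 0 < |t| := (abs_nonneg _).trans_lt hst
  intro w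
  choose f hf using ht
  -- A solution of `(S + is)x = w` is a fixed point of `x ↦ (S + it)⁻¹(w + i(t - s)x)`, which
  -- contracts with ratio `|s - t|/|t|`.
  let g : E → E := fun x => f (w + imag (t - s) • x)
  obtain ⟨K, hK⟩ : ∃ K : NNReal, (K : ℝ) = |s - t| / |t| := ⟨⟨_, by positivity⟩, rfl⟩
  have hg : ContractingWith K g := by
    refine ⟨?_, LipschitzWith.of_dist_le_mul fun x y => ?_⟩
    · rw [← NNReal.coe_lt_coe, hK]
      exact (div_lt_one h0).2 hst
    · have h1 := h.shift_sub_le t (hf (w + imag (t - s) • x)) (hf (w + imag (t - s) • y))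
      rw [add_sub_add_left_eq_sub, ← smul_sub, norm_smul, norm_imag, abs_sub_comm] at h1
      rw [dist_eq_norm, dist_eq_norm, hK]
      rw [div_mul_eq_mul_div, le_div_iff₀ h0, mul_comm]
      exact h1
  refine ⟨hg.fixedPoint g, ?_⟩
  have h2 : f (w + imag (t - s) • hg.fixedPoint g) = hg.fixedPoint g := hg.fixedPoint_isFixedPt
  have h3 := hf (w + imag (t - s) • hg.fixedPoint g)
  rw [h2] at h3
  convert h3 using 2
  rw [imag_sub, sub_smul]
  abel

/-- From `t` one reaches every point of `(0, 2t)`. Steps of ratio `3/2` pass any bound, and a single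
further step comes back down to `s`. -/
theorem onto_pos [CompleteSpace E] (h : IsSymm A S) {t : ℝ} (h0 : 0 < t) (ht : Onto S t) {s : ℝ}
    (hs : 0 < s) : Onto S s := by
  have hn : ∀ n : ℕ, Onto S ((3 / 2 : ℝ) ^ n * t) := by
    intro n
    induction n with
    | zero => simpa using ht
    | succ n ih =>
      refine h.onto_of_close ih ?_
      have : 0 < (3 / 2 : ℝ) ^ n * t := by positivity
      rw [pow_succ, abs_of_pos this, abs_of_pos] <;> linarith
  obtain ⟨n, hn'⟩ := pow_unbounded_of_one_lt (s / t) (show (1 : ℝ) < 3 / 2 by norm_num)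
  rw [div_lt_iff₀ h0] at hn'
  refine h.onto_of_close (hn n) ?_
  rw [abs_of_pos (a := (3 / 2 : ℝ) ^ n * t) (by positivity), abs_lt]
  constructor <;> linarith

theorem onto_neg [CompleteSpace E] (h : IsSymm A S) {t : ℝ} (h0 : 0 < t) (ht : Onto S (-t)) {s : ℝ}
    (hs : 0 < s) : Onto S (-s) := by
  have hneg : IsSymm A ((-1 : ℂ) • S) := by
    intro x y x' y' hx hx'
    obtain ⟨a, ha, rfl⟩ := mem_graph_smul.1 hx
    obtain ⟨a', ha', rfl⟩ := mem_graph_smul.1 hx'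
    simp [h ha ha']
  have key : ∀ t, Onto S (-t) ↔ Onto ((-1 : ℂ) • S) t := by
    intro t
    constructor
    · intro ht w
      obtain ⟨x, hx⟩ := ht (-w)
      refine ⟨x, mem_graph_smul.2 ⟨_, hx, ?_⟩⟩
      rw [imag_neg, neg_smul, neg_smul, one_smul]; abel
    · intro ht w
      obtain ⟨x, hx⟩ := ht (-w)
      obtain ⟨a, ha, hxa⟩ := mem_graph_smul.1 hx
      refine ⟨x, ?_⟩
      convert ha using 2
      rw [imag_neg, neg_smul]
      rw [neg_smul, one_smul] at hxa
      rw [← neg_neg a, ← hxa]; abel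
  rw [key] at ht ⊢
  exact hneg.onto_pos h0 ht hs

theorem onto_of_onto [CompleteSpace E] (h : IsSymm A S) {t : ℝ} (h0 : 0 < t) (ht : Onto S t)
    (ht' : Onto S (-t)) {s : ℝ} (hs : s ≠ 0) : Onto S s := by
  rcases lt_or_gt_of_ne hs with h1 | h1
  · rw [← neg_neg s]
    exact h.onto_neg h0 ht' (neg_pos.2 h1)
  · exact h.onto_pos h0 ht h1

theorem exists_resolvent (h : IsSymm A S) {t : ℝ} (h0 : t ≠ 0) (ht : Onto S t)
    (ht' : Onto S (-t)) :
    ∃ R : Adjointable A E, ∀ w, (R.1 w, w - imag t • R.1 w) ∈ S.graph := by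
  have aux : ∀ s : ℝ, s ≠ 0 → Onto S s →
      ∃ R : E →L[ℂ] E, ∀ w, (R w, w - imag s • R w) ∈ S.graph := by
    intro s hs hS
    choose f hf using hS
    let g : E →ₗ[ℂ] E :=
      { toFun := f
        map_add' := fun x y => by
          refine h.shift_unique hs (hf _) ?_
          convert graph_add (hf x) (hf y) using 2
          rw [smul_add]; abel
        map_smul' := fun c x => by
          refine h.shift_unique hs (hf _) ?_
          have := graph_smul c (hf x)
          rwa [smul_sub, smul_comm] at this }
    refine ⟨g.mkContinuous |s|⁻¹ fun x => ?_, hf⟩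
    have := h.norm_le_shift s (hf x)
    rw [sub_add_cancel] at this
    rw [inv_mul_eq_div, le_div_iff₀ (abs_pos.2 hs), mul_comm]
    exact this
  obtain ⟨R, hR⟩ := aux t h0 ht
  obtain ⟨R', hR'⟩ := aux (-t) (neg_ne_zero.2 h0) ht'
  refine ⟨⟨R, R', fun x y => ?_⟩, hR⟩
  have h1 := h (hR x) (hR' y)
  simp only [CStarModule.inner_sub_left, CStarModule.inner_sub_right,
    CStarModule.inner_smul_left_complex, CStarModule.inner_smul_right_complex, star_imag] at h1
  exact (sub_left_inj.1 h1).symm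

/-- Surjectivity of `S - it` forces the adjoint to be no larger than `S`, and `1 + S² = (S + i)(S -
i)` is then onto. -/
theorem isSelfAdjointRegular [CompleteSpace E] (h : IsSymm A S)
    (hd : Dense (S.domain : Set E)) {t : ℝ} (h0 : 0 < t) (ht : Onto S t) (ht' : Onto S (-t)) :
    IsSelfAdjointRegular A S where
  dense_domain := hd
  eq_adjoint := by
    intro y z
    constructor
    · intro hyz x
      exact (h hyz (S.mem_graph x)).symm
    · intro hyz
      -- For `y` in the domain of the adjoint with value `z`, the vector `y - x₀` is orthogonal to
      -- the range of `S - it`, which is everything.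
      obtain ⟨x₀, hx₀⟩ := ht (z + imag t • y)
      have : y = x₀ := by
        apply eq_of_inner_right A
        intro w
        obtain ⟨x, hx⟩ := ht' w
        have hxd := LinearPMap.mem_domain_of_mem_graph hx
        have h1 := hyz ⟨x, hxd⟩
        rw [apply_eq_of_mem_graph hx hxd] at h1
        have h2 := h hx₀ hx
        simp only [CStarModule.inner_sub_left,
          CStarModule.inner_add_left, CStarModule.inner_add_right,
          CStarModule.inner_smul_left_complex, CStarModule.inner_smul_right_complex, star_imag, imag_neg, neg_smul,
          sub_neg_eq_add] at h1 h2
        rw [← h1] at h2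
        rw [add_neg_cancel_right] at h2
        exact add_right_cancel h2
      subst this
      simpa using hx₀
  dense_range := by
    have h1 := h.onto_of_onto h0 ht ht' one_ne_zero
    have h2 := h.onto_of_onto h0 ht ht' (neg_ne_zero.2 one_ne_zero)
    suffices Set.range (onePlusSq 1 S) = Set.univ by rw [this]; exact dense_univ
    refine Set.eq_univ_of_forall fun w => ?_
    rw [LinearPMap.mem_range_iff]
    obtain ⟨y, hy⟩ := h1 w
    obtain ⟨x, hx⟩ := h2 y
    refine ⟨x, mem_graph_onePlusSq.2 ⟨_, _, hx, graph_sub hy (graph_smul _ hx), ?_⟩⟩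
    have e : imag (-1) * imag (-1) = -1 := by rw [imag_mul_imag]; norm_num
    rw [one_pow, Complex.ofReal_one, one_smul, smul_sub, smul_smul, e, imag_neg, neg_smul,
      neg_smul, one_smul]
    abel

end IsSymm

namespace IsSelfAdjointRegular

theorem isSymm (hS : IsSelfAdjointRegular A S) : IsSymm A S := by
  intro x y x' y' hx hx'
  have hd := LinearPMap.mem_domain_of_mem_graph hx'
  rw [← apply_eq_of_mem_graph hx' hd]
  exact ((hS.eq_adjoint x y).1 hx ⟨x', hd⟩).symm

theorem graph_of_tendsto (hS : IsSelfAdjointRegular A S) {u v : ℕ → E} {x y : E}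
    (h : ∀ n, (u n, v n) ∈ S.graph) (hu : Tendsto u atTop (𝓝 x)) (hv : Tendsto v atTop (𝓝 y)) :
    (x, y) ∈ S.graph := by
  rw [hS.eq_adjoint]
  intro z
  have h₁ : Tendsto (fun n => inner A (S z) (u n)) atTop (𝓝 (inner A (S z) x)) :=
    ((CStarModule.innerSL (A := A) (S z)).continuous.tendsto x).comp hu
  have h₂ : Tendsto (fun n => inner A (z : E) (v n)) atTop (𝓝 (inner A (z : E) y)) :=
    ((CStarModule.innerSL (A := A) (z : E)).continuous.tendsto y).comp hv
  have h₃ : ∀ n, inner A (S z) (u n) = inner A (z : E) (v n) := fun n =>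
    hS.isSymm (S.mem_graph z) (h n)
  simp only [h₃] at h₁
  rw [← CStarModule.star_inner, ← CStarModule.star_inner (z : E),
    tendsto_nhds_unique h₁ h₂]

/-- The dense range of `1 + S² = (S ± i)(S ∓ i)` lies in the range of `S ± i`, which is closed
because `S` is closed and `S ± i` is bounded below. -/
theorem onto [CompleteSpace E] (hS : IsSelfAdjointRegular A S) {t : ℝ} (ht : t ≠ 0) :
    Onto S t := by
  have aux : ∀ e : ℝ, e * e = 1 → Onto S e := by
    intro e he w
    have he0 : |e| = 1 := by
      have := abs_mul_abs_self e
      rw [he] at this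
      nlinarith [abs_nonneg e]
    obtain ⟨u, hu, huw⟩ := mem_closure_iff_seq_limit.1 (hS.dense_range w)
    have : ∀ n, ∃ x, (x, u n - imag e • x) ∈ S.graph := by
      intro n
      obtain ⟨x, hx⟩ := LinearPMap.mem_range_iff.1 (hu n)
      obtain ⟨s, ss, hs, hss, hn⟩ := mem_graph_onePlusSq.1 hx
      refine ⟨s - imag e • x, ?_⟩
      convert graph_sub hss (graph_smul (imag e) hs) using 2
      rw [hn, smul_sub, smul_smul, imag_mul_imag, he]
      simp only [one_pow, Complex.ofReal_one, one_smul, neg_smul, sub_neg_eq_add]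
      abel
    choose x hx using this
    have hc : CauchySeq x := by
      rw [Metric.cauchySeq_iff]
      intro ε hε
      obtain ⟨N, hN⟩ := Metric.cauchySeq_iff.1 huw.cauchySeq ε hε
      refine ⟨N, fun m hm n hn => ?_⟩
      have h1 := hN m hm n hn
      have h2 := hS.isSymm.shift_sub_le e (hx m) (hx n)
      rw [he0, one_mul] at h2
      rw [dist_eq_norm] at h1 ⊢
      exact h2.trans_lt h1
    obtain ⟨z, hz⟩ := cauchySeq_tendsto_of_complete hc
    exact ⟨z, hS.graph_of_tendsto hx hz (huw.sub (hz.const_smul (imag e)))⟩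
  exact hS.isSymm.onto_of_onto one_pos (aux 1 (by norm_num)) (aux (-1) (by norm_num)) ht

end IsSelfAdjointRegular

open scoped Classical in
variable (A) in
/-- The resolvent `(S + i t)⁻¹` in `𝓛(E)` (`0` if there is none). -/
def res (S : E →ₗ.[ℂ] E) (t : ℝ) : Adjointable A E :=
  if h : ∃ R : Adjointable A E, ∀ w, (R.1 w, w - imag t • R.1 w) ∈ S.graph then h.choose else 0

namespace IsSelfAdjointRegular

variable [CompleteSpace E]

theorem res_mem (hS : IsSelfAdjointRegular A S) {t : ℝ} (ht : t ≠ 0) (w : E) :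
    ((res A S t).1 w, w - imag t • (res A S t).1 w) ∈ S.graph := by
  have h := hS.isSymm.exists_resolvent ht (hS.onto ht) (hS.onto (neg_ne_zero.2 ht))
  rw [res, dif_pos h]
  exact h.choose_spec w

theorem res_eq (hS : IsSelfAdjointRegular A S) {t : ℝ} (ht : t ≠ 0) {x w : E}
    (h : (x, w - imag t • x) ∈ S.graph) : (res A S t).1 w = x :=
  hS.isSymm.shift_unique ht (hS.res_mem ht w) h

theorem res_apply_shift (hS : IsSelfAdjointRegular A S) {t : ℝ} (ht : t ≠ 0) {x s : E}
    (h : (x, s) ∈ S.graph) : (res A S t).1 (s + imag t • x) = x :=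
  hS.res_eq ht (by rwa [add_sub_cancel_right])

theorem res_apply (hS : IsSelfAdjointRegular A S) {t : ℝ} (ht : t ≠ 0) {x s : E}
    (h : (x, s) ∈ S.graph) : (res A S t).1 s = x - imag t • (res A S t).1 x := by
  have := hS.res_apply_shift ht h
  rw [map_add, map_smul] at this
  exact eq_sub_of_add_eq this

theorem res_graph (hS : IsSelfAdjointRegular A S) {t : ℝ} (ht : t ≠ 0) {x s : E}
    (h : (x, s) ∈ S.graph) : ((res A S t).1 x, (res A S t).1 s) ∈ S.graph := by
  rw [hS.res_apply ht h]
  exact hS.res_mem ht x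

theorem norm_res_apply_le (hS : IsSelfAdjointRegular A S) {t : ℝ} (ht : t ≠ 0) (x : E) :
    |t| * ‖(res A S t).1 x‖ ≤ ‖x‖ := by
  simpa using hS.isSymm.norm_le_shift t (hS.res_mem ht x)

theorem norm_apply_res_le (hS : IsSelfAdjointRegular A S) {t : ℝ} (ht : t ≠ 0) (x : E) :
    ‖x - imag t • (res A S t).1 x‖ ≤ ‖x‖ := by
  simpa using hS.isSymm.norm_apply_le_shift t (hS.res_mem ht x)

theorem norm_res_le (hS : IsSelfAdjointRegular A S) {t : ℝ} (ht : t ≠ 0) :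
    ‖res A S t‖ ≤ |t|⁻¹ := by
  refine Adjointable.norm_le_of_forall (by positivity) fun x => ?_
  rw [inv_mul_eq_div, le_div_iff₀ (abs_pos.2 ht), mul_comm]
  exact hS.norm_res_apply_le ht x

theorem norm_imag_smul_res_le (hS : IsSelfAdjointRegular A S) {t : ℝ} (ht : t ≠ 0) :
    ‖imag t • res A S t‖ ≤ 1 := by
  rw [norm_smul, norm_imag]
  calc |t| * ‖res A S t‖ ≤ |t| * |t|⁻¹ := by gcongr; exact hS.norm_res_le ht
    _ = 1 := mul_inv_cancel₀ (abs_pos.2 ht).ne'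

theorem star_res (hS : IsSelfAdjointRegular A S) {t : ℝ} (ht : t ≠ 0) :
    star (res A S t) = res A S (-t) := by
  refine (eq_star fun x y => ?_).symm
  have h1 := hS.isSymm (hS.res_mem ht x) (hS.res_mem (neg_ne_zero.2 ht) y)
  simp only [CStarModule.inner_sub_left, CStarModule.inner_sub_right,
    CStarModule.inner_smul_left_complex, CStarModule.inner_smul_right_complex, star_imag] at h1
  exact sub_left_inj.1 h1

theorem res_sub_res (hS : IsSelfAdjointRegular A S) {s t : ℝ} (hs : s ≠ 0) (ht : t ≠ 0) :
    res A S s - res A S t = imag (t - s) • (res A S s * res A S t) := by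
  apply Adjointable.ext
  intro x
  have h := hS.res_apply hs (hS.res_mem ht x)
  rw [map_sub, map_smul] at h
  simp only [Adjointable.sub_apply, Adjointable.smul_apply, Adjointable.mul_apply, imag_sub,
    sub_smul]
  rw [sub_eq_iff_eq_add] at h
  rw [h]
  abel

theorem res_commute (hS : IsSelfAdjointRegular A S) {s t : ℝ} (hs : s ≠ 0) (ht : t ≠ 0) :
    Commute (res A S s) (res A S t) := by
  rcases eq_or_ne s t with rfl | hst
  · exact Commute.refl _
  have h1 := hS.res_sub_res hs ht
  have h2 := hS.res_sub_res ht hs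
  rw [← neg_sub, h1, ← neg_sub t s, imag_neg, neg_smul] at h2
  exact smul_right_injective _ (imag_ne_zero (sub_ne_zero.2 hst.symm)) (neg_injective h2)

/-- On `dom S` one has `x - ic(S + ic)⁻¹x = (S + ic)⁻¹Sx`, of norm at most `‖Sx‖/|c|`. The uniform
bound by `1` handles all other vectors. -/
theorem tendsto_imag_smul_res (hS : IsSelfAdjointRegular A S) {c : ℕ → ℝ} (hc0 : ∀ n, c n ≠ 0)
    (hc : Tendsto (fun n => |c n|) atTop atTop) {u : ℕ → E} {x : E}
    (hu : Tendsto u atTop (𝓝 x)) :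
    Tendsto (fun n => (imag (c n) • res A S (c n)).1 (u n)) atTop (𝓝 x) := by
  refine Adjointable.tendsto_self_of_dense (fun n => hS.norm_imag_smul_res_le (hc0 n))
    hS.dense_domain (fun y hy => ?_) hu
  obtain ⟨s, hs⟩ := exists_mem_graph hy
  rw [tendsto_iff_norm_sub_tendsto_zero]
  refine squeeze_zero (fun _ => norm_nonneg _) (fun n => ?_)
    (by simpa using (tendsto_inv_atTop_zero.comp hc).mul_const ‖s‖)
  have h1 := hS.res_apply (hc0 n) hs
  rw [Adjointable.smul_apply, norm_sub_rev, ← h1]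
  exact Adjointable.le_of_norm_le (hS.norm_res_le (hc0 n)) s

end IsSelfAdjointRegular

end Module

-- A density criterion by Hahn–Banach separation and localization

universe u in
/-- If a vector has positive distance from a subspace `L` for a positive semidefinite form, then in
the associated Hilbert space there is a nonzero vector orthogonal to the image of `L`. -/
theorem exists_orthogonal {V : Type u} [AddCommGroup V] [Module ℝ V]
    (c : PreInnerProductSpace.Core ℝ V) (L : Submodule ℝ V) (x₀ : V) {d : ℝ} (hd : 0 < d)
    (h : ∀ y ∈ L, d ≤ c.inner (x₀ - y) (x₀ - y)) :
    ∃ (H : Type u) (_ : NormedAddCommGroup H) (_ : InnerProductSpace ℝ H) (q : V →ₗ[ℝ] H),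
      (∀ x y, inner ℝ (q x) (q y) = c.inner x y) ∧ DenseRange q ∧
        ∃ ξ : H, ξ ≠ 0 ∧ ∀ y ∈ L, inner ℝ ξ (q y) = 0 := by
  let : SeminormedAddCommGroup V := @InnerProductSpace.Core.toSeminormedAddCommGroup ℝ V _ _ _ c
  let : InnerProductSpace ℝ V := InnerProductSpace.ofCore c
  let q : V →ₗ[ℝ] UniformSpace.Completion V :=
    (UniformSpace.Completion.toComplL : V →L[ℝ] UniformSpace.Completion V)
  have hq : ∀ x y, inner ℝ (q x) (q y) = c.inner x y := fun x y =>
    UniformSpace.Completion.inner_coe x y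
  refine ⟨UniformSpace.Completion V, inferInstance, inferInstance, q, hq,
    UniformSpace.Completion.denseRange_coe, ?_⟩
  let K := (L.map q).topologicalClosure
  have : CompleteSpace K := (L.map q).isClosed_topologicalClosure.completeSpace_coe
  refine ⟨q x₀ - K.starProjection (q x₀), fun h0 => ?_, fun y hy => ?_⟩
  · have hmem : q x₀ ∈ K := by
      rw [sub_eq_zero.1 h0]
      exact K.starProjection_apply_mem _
    obtain ⟨w, hw, hwx⟩ := Metric.mem_closure_iff.1 hmem (√d) (Real.sqrt_pos.2 hd)
    obtain ⟨y, hy, rfl⟩ := hw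
    rw [dist_eq_norm, ← map_sub] at hwx
    have h1 := h y hy
    rw [← hq, real_inner_self_eq_norm_sq] at h1
    have h2 := Real.sqrt_le_sqrt h1
    rw [Real.sqrt_sq (norm_nonneg _)] at h2
    linarith
  · have := K.starProjection_inner_eq_zero (q x₀) (q y)
      ((L.map q).le_topologicalClosure (Submodule.mem_map_of_mem hy))
    exact this

section Module

variable {A E : Type*} [NonUnitalCStarAlgebra A] [PartialOrder A] [StarOrderedRing A]
  [SMul A E] [NormedAddCommGroup E] [NormedSpace ℂ E] [CStarModule A E]

/-- The map `x ↦ ⟨x, x⟩` is convex in the order of `A`: the convexity defect is `st⟨z - y, z - y⟩ ≥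
0`. -/
theorem convex_inner_le (L : Submodule ℂ E) (x₀ : E) :
    Convex ℝ {a : A | ∃ y ∈ L, inner A (x₀ - y) (x₀ - y) ≤ a} := by
  rintro a ⟨y, hy, hya⟩ b ⟨z, hz, hzb⟩ s t hs ht hst
  refine ⟨(s : ℂ) • y + (t : ℂ) • z, L.add_mem (L.smul_mem _ hy) (L.smul_mem _ hz), ?_⟩
  refine le_trans ?_ (add_le_add (smul_le_smul_of_nonneg_left hya hs)
    (smul_le_smul_of_nonneg_left hzb ht))
  rw [← sub_nonneg]
  have h : (0 : A) ≤ (s * t) • inner A (z - y) (z - y) :=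
    smul_nonneg (mul_nonneg hs ht) CStarModule.inner_self_nonneg
  convert h using 1
  obtain rfl : t = 1 - s := by linarith
  have e : x₀ - ((s : ℂ) • y + ((1 - s : ℝ) : ℂ) • z)
      = s • (x₀ - y) + (1 - s) • (x₀ - z) := by
    rw [Complex.coe_smul, Complex.coe_smul]
    module
  have e' : z - y = (x₀ - y) - (x₀ - z) := by abel
  rw [e, e']
  generalize x₀ - y = u
  generalize x₀ - z = v
  simp only [CStarModule.inner_add_left, CStarModule.inner_add_right, CStarModule.inner_sub_left,
    CStarModule.inner_sub_right, CStarModule.inner_smul_left_real,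
    CStarModule.inner_smul_right_real]
  module

/-- A subspace at positive distance from `x₀` is separated from `x₀` by a positive functional
on `A`. -/
theorem exists_separating (L : Submodule ℂ E) (x₀ : E) {δ : ℝ} (hδ : 0 < δ)
    (h : ∀ y ∈ L, δ ≤ ‖x₀ - y‖) :
    ∃ (f : StrongDual ℝ A) (u : ℝ), 0 < u ∧ (∀ a, 0 ≤ a → 0 ≤ f a) ∧
      ∀ y ∈ L, u ≤ f (inner A (x₀ - y) (x₀ - y)) := by
  -- Every element of the convex set dominates some `⟨x₀ - y, x₀ - y⟩`, so it has norm at least `δ²`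
  -- and misses the open ball of that radius.
  obtain ⟨f, u, hf, hu⟩ := geometric_hahn_banach_open (convex_ball (0 : A) (δ ^ 2))
    Metric.isOpen_ball (convex_inner_le L x₀) (by
      rw [Set.disjoint_left]
      rintro a ha ⟨y, hy, hya⟩
      rw [mem_ball_zero_iff] at ha
      have h1 := norm_sq_le_of_inner_le A hya
      have h2 := h y hy
      nlinarith)
  refine ⟨f, u, ?_, fun a ha => ?_, fun y hy => hu _ ⟨y, hy, le_rfl⟩⟩
  · have := hf 0 (Metric.mem_ball_self (by positivity))
    rwa [map_zero] at this
  -- The convex set is stable under adding positive elements. A negative value `f a` would make `f`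
  -- unbounded below on it.
  · by_contra! hfa
    have h1 : ∀ s : ℝ, 0 ≤ s → u ≤ f (inner A x₀ x₀) + s * f a := by
      intro s hs
      have := hu (inner A x₀ x₀ + s • a) ⟨0, L.zero_mem, by
        rw [sub_zero]; exact le_add_of_nonneg_right (smul_nonneg hs ha)⟩
      rwa [map_add, map_smul, smul_eq_mul] at this
    have h2 := h1 0 le_rfl
    have h3 := h1 ((f (inner A x₀ x₀) - u + 1) / (-f a))
      (div_nonneg (by linarith) (by linarith))
    rw [div_mul_eq_mul_div, div_neg, mul_div_cancel_right₀ _ hfa.ne] at h3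
    linarith

/-- A criterion for density of a subspace `L` of a Hilbert module, by operators `Y` with range in
`L` that are bounded below by approximate identities. -/
theorem dense_of_approximate_bound [CompleteSpace E] (L : Submodule ℂ E)
    (h : ∀ (z : E) (η : ℝ), 0 < η → ∃ P Y : Adjointable A E, ‖P‖ ≤ 1 ∧ ‖P.1 z - z‖ ≤ η ∧
      (∀ x, Y.1 x ∈ L) ∧ ∀ x, inner A (P.1 x) (P.1 x) ≤
        (1 / 2 : ℝ) • inner A x x + (inner A x (Y.1 x) + inner A (Y.1 x) x)) :
    Dense (L : Set E) := by
  intro x₀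
  by_contra hx₀
  obtain ⟨δ, hδ, hball⟩ := Metric.nhds_basis_ball.mem_iff.1
    (isClosed_closure.isOpen_compl.mem_nhds hx₀)
  obtain ⟨f, u, hu, hpos, hsep⟩ := exists_separating (A := A) L x₀ hδ fun y hy => by
    by_contra! hlt
    refine hball ?_ (subset_closure hy)
    rwa [Metric.mem_ball, dist_eq_norm, norm_sub_rev]
  have hmono : ∀ {a b : A}, a ≤ b → f a ≤ f b := fun hab => by
    have := hpos _ (sub_nonneg.2 hab)
    rwa [map_sub, sub_nonneg] at this
  -- Since `f` is only real linear, the form is symmetrized to a real one, which doubles the values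
  -- of `f` on squares.
  let c : PreInnerProductSpace.Core ℝ E :=
    { inner := fun x y => f (inner A x y + inner A y x)
      conj_inner_symm := fun x y => by rw [add_comm]; rfl
      re_inner_nonneg := fun x =>
        hpos _ (add_nonneg CStarModule.inner_self_nonneg CStarModule.inner_self_nonneg)
      add_left := fun x y z => by
        rw [← map_add]
        congr 1
        simp only [CStarModule.inner_add_left, CStarModule.inner_add_right]
        abel
      smul_left := fun x y r => by
        rw [CStarModule.inner_smul_left_real, CStarModule.inner_smul_right_real, ← smul_add,
          map_smul]
        rfl }
  obtain ⟨H, _, _, q, hq, hqd, ξ, hξ, hξL⟩ := exists_orthogonal c (L.restrictScalars ℝ) x₀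
    (d := u + u) (by linarith) fun y hy => by
      change u + u ≤ f (_ + _)
      rw [map_add]
      exact add_le_add (hsep y hy) (hsep y hy)
  have hqn : ∀ x, ‖q x‖ ^ 2 = 2 * f (inner A x x) := fun x => by
    rw [← real_inner_self_eq_norm_sq, hq, two_mul, ← map_add]; rfl
  have hqB : ∀ (B : Adjointable A E) (b : ℝ), ‖B‖ ≤ b → ∀ x, ‖q (B.1 x)‖ ≤ b * ‖q x‖ := by
    intro B b hb x
    have hb0 : 0 ≤ b := (norm_nonneg _).trans hb
    rw [← sq_le_sq₀ (norm_nonneg _) (by positivity), mul_pow, hqn, hqn]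
    have := hmono (Adjointable.inner_apply_self_le hb x)
    rw [map_smul, smul_eq_mul] at this
    linarith
  obtain ⟨C, hC, hqC⟩ : ∃ C : ℝ, 0 < C ∧ ∀ x, ‖q x‖ ≤ C * ‖x‖ := by
    refine ⟨√(2 * ‖f‖ + 1), Real.sqrt_pos.2 (by positivity), fun x => ?_⟩
    rw [← sq_le_sq₀ (norm_nonneg _) (by positivity), mul_pow, hqn, Real.sq_sqrt (by positivity)]
    have h1 := (le_abs_self _).trans (f.le_opNorm (inner A x x))
    rw [← CStarModule.norm_sq_eq A] at h1
    nlinarith [sq_nonneg ‖x‖]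
  have ha : 0 < ‖ξ‖ := norm_pos_iff.2 hξ
  -- Order of choices: `P` and `Y` depend on `ζ`, and `‖Y‖` is not controlled in advance. A second
  -- approximant `ζ'` of `ξ` is therefore chosen with accuracy adapted to `‖Y‖`, and contractivity
  -- of `P` carries the bound from `ζ` over to `ζ'`.
  obtain ⟨ζ, hζ⟩ := Metric.denseRange_iff.1 hqd ξ (‖ξ‖ / 100) (by positivity)
  obtain ⟨P, Y, hP, hPζ, hYL, hPY⟩ := h ζ (‖ξ‖ / 100 / C) (by positivity)
  obtain ⟨ζ', hζ'⟩ := Metric.denseRange_iff.1 hqd ξ (‖ξ‖ / 100 / (‖Y‖ + 1)) (by positivity)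
  rw [dist_eq_norm] at hζ hζ'
  have hζ'' : ‖ξ - q ζ'‖ ≤ ‖ξ‖ / 100 :=
    hζ'.le.trans (div_le_self (by positivity) (by linarith [norm_nonneg Y]))
  have h1 : ‖q (P.1 ζ) - q ζ‖ ≤ ‖ξ‖ / 100 := by
    rw [← map_sub]
    refine (hqC _).trans ?_
    rw [le_div_iff₀ hC] at hPζ
    linarith
  have h2 : ‖q (P.1 ζ') - q (P.1 ζ)‖ ≤ ‖ξ‖ / 50 := by
    rw [← map_sub, ← map_sub]
    refine (hqB P 1 hP _).trans ?_
    rw [one_mul, map_sub, show q ζ' - q ζ = (ξ - q ζ) - (ξ - q ζ') by abel]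
    refine (norm_sub_le _ _).trans ?_
    linarith
  have h3 : 96 / 100 * ‖ξ‖ ≤ ‖q (P.1 ζ')‖ := by
    have e : ξ = (ξ - q ζ) - (q (P.1 ζ) - q ζ) - (q (P.1 ζ') - q (P.1 ζ)) + q (P.1 ζ') := by abel
    have := (norm_add_le ((ξ - q ζ) - (q (P.1 ζ) - q ζ) - (q (P.1 ζ') - q (P.1 ζ)))
      (q (P.1 ζ')))
    rw [← e] at this
    have h4 := norm_sub_le ((ξ - q ζ) - (q (P.1 ζ) - q ζ)) (q (P.1 ζ') - q (P.1 ζ))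
    have h5 := norm_sub_le (ξ - q ζ) (q (P.1 ζ) - q ζ)
    linarith
  have h4 : ‖q ζ'‖ ≤ 101 / 100 * ‖ξ‖ := by
    have := norm_sub_le ξ (ξ - q ζ')
    rw [sub_sub_cancel] at this
    linarith
  have h5 : ‖q (P.1 ζ')‖ ^ 2 ≤ 1 / 2 * ‖q ζ'‖ ^ 2 + 2 * inner ℝ (q ζ') (q (Y.1 ζ')) := by
    rw [hqn, hqn, hq]
    have := hmono (hPY ζ')
    rw [map_add, map_smul, smul_eq_mul] at this
    change _ ≤ _ + 2 * f _
    linarith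
  -- The range of `Y` lies in `L`, hence is orthogonal to `ξ`, so only the small difference `q ζ' -
  -- ξ` contributes.
  have h6 : inner ℝ (q ζ') (q (Y.1 ζ')) ≤ 2 / 100 * ‖ξ‖ ^ 2 := by
    have e : inner ℝ (q ζ') (q (Y.1 ζ')) = inner ℝ (-(ξ - q ζ')) (q (Y.1 ζ')) := by
      rw [neg_sub, inner_sub_left, hξL _ (hYL ζ'), sub_zero]
    rw [e]
    refine (real_inner_le_norm _ _).trans ?_
    rw [norm_neg]
    have h7 := hqB Y _ le_rfl ζ'
    rw [lt_div_iff₀ (by positivity)] at hζ'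
    have h8 := norm_nonneg (ξ - q ζ')
    have h9 := norm_nonneg Y
    calc ‖ξ - q ζ'‖ * ‖q (Y.1 ζ')‖ ≤ ‖ξ - q ζ'‖ * ((‖Y‖ + 1) * ‖q ζ'‖) := by
          gcongr
          exact h7.trans (by gcongr; linarith)
      _ = (‖ξ - q ζ'‖ * (‖Y‖ + 1)) * ‖q ζ'‖ := by ring
      _ ≤ (‖ξ‖ / 100) * (101 / 100 * ‖ξ‖) := by gcongr
      _ ≤ 2 / 100 * ‖ξ‖ ^ 2 := by nlinarith
  have h7 : (96 / 100 * ‖ξ‖) ^ 2 ≤ ‖q (P.1 ζ')‖ ^ 2 := by gcongr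
  have h8 : ‖q ζ'‖ ^ 2 ≤ (101 / 100 * ‖ξ‖) ^ 2 := by gcongr
  nlinarith [sq_pos_of_pos ha]

end Module

/-! ### Resolvent estimates and approximation for weakly anticommuting pairs -/

section Module

variable {A E : Type*} [NonUnitalCStarAlgebra A] [PartialOrder A] [StarOrderedRing A]
  [SMul A E] [NormedAddCommGroup E] [NormedSpace ℂ E] [CStarModule A E]

theorem tendsto_inner {u v : ℕ → E} {x y : E} (hu : Tendsto u atTop (𝓝 x))
    (hv : Tendsto v atTop (𝓝 y)) :
    Tendsto (fun n => inner A (u n) (v n)) atTop (𝓝 (inner A x y)) :=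
  ((CStarModule.continuous_inner (A := A) (E := E)).tendsto (x, y)).comp (hu.prodMk_nhds hv)

theorem IsSelfAdjointRegular.isClosed {T : E →ₗ.[ℂ] E} (hT : IsSelfAdjointRegular A T) :
    T.IsClosed := by
  refine IsSeqClosed.isClosed fun p q hp hq => ?_
  exact hT.graph_of_tendsto (u := fun n => (p n).1) (v := fun n => (p n).2) hp
    ((continuous_fst.tendsto q).comp hq) ((continuous_snd.tendsto q).comp hq)

theorem IsSelfAdjointRegular.exists_seq_of_hasCore {T : E →ₗ.[ℂ] E}
    (hT : IsSelfAdjointRegular A T) {V : Submodule ℂ E} (hV : T.HasCore V) {x t : E}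
    (hx : (x, t) ∈ T.graph) :
    ∃ u v : ℕ → E, (∀ n, u n ∈ V) ∧ (∀ n, (u n, v n) ∈ T.graph) ∧
      Tendsto u atTop (𝓝 x) ∧ Tendsto v atTop (𝓝 t) := by
  have hc : (T.domRestrict V).IsClosable :=
    hT.isClosed.isClosable.leIsClosable LinearPMap.domRestrict_le
  have hg := hc.graph_closure_eq_closure_graph
  rw [hV.closure_eq] at hg
  rw [← hg] at hx
  obtain ⟨p, hp, hpx⟩ := mem_closure_iff_seq_limit.1 hx
  refine ⟨fun n => (p n).1, fun n => (p n).2, fun n => ?_, fun n => ?_,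
    (continuous_fst.tendsto _).comp hpx, (continuous_snd.tendsto _).comp hpx⟩
  · exact (LinearPMap.mem_domain_of_mem_graph (hp n)).1
  · exact LinearPMap.le_graph_of_le LinearPMap.domRestrict_le (hp n)

variable (A) in
/-- Self-adjoint regular operators whose anticommutator satisfies a form bound relative to both. -/
structure AnticommBound (S T : E →ₗ.[ℂ] E) (κ : ℝ) : Prop where
  left : IsSelfAdjointRegular A S
  right : IsSelfAdjointRegular A T
  pos : 0 < κ
  bound : ∀ ⦃x s t k⦄, Anticomm S T x s t k →
    inner A k k ≤ κ • (inner A x x + inner A s s + inner A t t)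

variable {S T : E →ₗ.[ℂ] E} {κ : ℝ}

theorem norm_le_of_inner_le_smul {κ : ℝ} (hκ : 0 ≤ κ) {k x s t : E}
    (h : inner A k k ≤ κ • (inner A x x + inner A s s + inner A t t)) :
    ‖k‖ ≤ √κ * (‖x‖ + ‖s‖ + ‖t‖) := by
  have h1 := norm_sq_le_of_inner_le A h
  rw [norm_smul, Real.norm_of_nonneg hκ] at h1
  have h2 : ‖inner A x x + inner A s s + inner A t t‖ ≤ ‖x‖ ^ 2 + ‖s‖ ^ 2 + ‖t‖ ^ 2 := by
    rw [CStarModule.norm_sq_eq A, CStarModule.norm_sq_eq A, CStarModule.norm_sq_eq A]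
    exact norm_add₃_le
  rw [← sq_le_sq₀ (norm_nonneg _) (by positivity), mul_pow, Real.sq_sqrt hκ]
  refine h1.trans (mul_le_mul_of_nonneg_left (h2.trans ?_) hκ)
  nlinarith [mul_nonneg (norm_nonneg x) (norm_nonneg s), mul_nonneg (norm_nonneg x) (norm_nonneg t),
    mul_nonneg (norm_nonneg s) (norm_nonneg t)]

namespace AnticommBound

theorem norm_le (h : AnticommBound A S T κ) {x s t k : E} (hk : Anticomm S T x s t k) :
    ‖k‖ ≤ √κ * (‖x‖ + ‖s‖ + ‖t‖) :=
  norm_le_of_inner_le_smul h.pos.le (h.bound hk)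

theorem exists_tendsto [CompleteSpace E] (h : AnticommBound A S T κ) {u s t k : ℕ → E} {x y z : E}
    (hk : ∀ n, Anticomm S T (u n) (s n) (t n) (k n)) (hu : Tendsto u atTop (𝓝 x))
    (hs : Tendsto s atTop (𝓝 y)) (ht : Tendsto t atTop (𝓝 z)) : ∃ w, Tendsto k atTop (𝓝 w) := by
  apply cauchySeq_tendsto_of_complete
  rw [Metric.cauchySeq_iff]
  intro ε hε
  have hc : 0 < ε / (√κ + 1) / 3 := by positivity
  obtain ⟨N₁, h₁⟩ := Metric.cauchySeq_iff.1 hu.cauchySeq _ hc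
  obtain ⟨N₂, h₂⟩ := Metric.cauchySeq_iff.1 hs.cauchySeq _ hc
  obtain ⟨N₃, h₃⟩ := Metric.cauchySeq_iff.1 ht.cauchySeq _ hc
  refine ⟨max N₁ (max N₂ N₃), fun m hm n hn => ?_⟩
  simp only [ge_iff_le, max_le_iff] at hm hn
  have h1 := h₁ m hm.1 n hn.1
  have h2 := h₂ m hm.2.1 n hn.2.1
  have h3 := h₃ m hm.2.2 n hn.2.2
  rw [dist_eq_norm] at h1 h2 h3 ⊢
  have h5 := h.norm_le ((hk m).sub (hk n))
  have h6 : ‖u m - u n‖ + ‖s m - s n‖ + ‖t m - t n‖ < ε / (√κ + 1) := by linarith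
  rw [lt_div_iff₀ (by positivity)] at h6
  nlinarith [norm_nonneg (u m - u n), norm_nonneg (s m - s n), norm_nonneg (t m - t n)]

/-- With `y = (S + iτ)⁻¹x` and `k = [S, T]y`, applying `T` to `Sy = x - iτy` gives `(S - iτ)Ty = k -
Tx`: up to `k`, moving `T` past a resolvent of `S` flips the signs of `τ` and of the result. -/
theorem apply_res [CompleteSpace E] (h : AnticommBound A S T κ) {τ : ℝ} (hτ : τ ≠ 0)
    {x t s t' k : E} (hx : (x, t) ∈ T.graph) (hk : Anticomm S T ((res A S τ).1 x) s t' k) :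
    s = x - imag τ • (res A S τ).1 x ∧ t' = (res A S (-τ)).1 (k - t) := by
  obtain ⟨hs, ht, st, ts, hst, hts, rfl⟩ := hk
  obtain rfl := graph_unique hs (h.left.res_mem hτ x)
  refine ⟨rfl, ?_⟩
  obtain rfl := graph_unique hts (graph_sub hx (graph_smul (imag τ) ht))
  refine (h.left.res_eq (neg_ne_zero.2 hτ) ?_).symm
  convert hst using 2
  rw [imag_neg, neg_smul]
  abel

/-- The bound on `k` contains `√κ‖t'‖`, while `|τ|‖t'‖ ≤ ‖k‖ + ‖t‖`. The condition `2√κ ≤ |τ|` lets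
the former be absorbed. -/
theorem norm_apply_res_le [CompleteSpace E] (h : AnticommBound A S T κ) {τ : ℝ} (h1 : 1 ≤ |τ|)
    (h2 : 2 * √κ ≤ |τ|) {x t s t' k : E} (hx : (x, t) ∈ T.graph)
    (hk : Anticomm S T ((res A S τ).1 x) s t' k) :
    |τ| * ‖t'‖ ≤ 2 * ‖t‖ + 4 * √κ * ‖x‖ ∧ ‖k‖ ≤ √κ * (4 * ‖x‖ + 2 * ‖t‖ / |τ|) := by
  have hτ : τ ≠ 0 := abs_pos.1 (by linarith)
  have h0 : 0 < |τ| := by linarith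
  obtain ⟨hs, ht⟩ := h.apply_res hτ hx hk
  have h3 := h.norm_le hk
  have h4 : ‖s‖ ≤ ‖x‖ := by rw [hs]; exact h.left.norm_apply_res_le hτ x
  have h5 := h.left.norm_res_apply_le hτ x
  have h6 := h.left.norm_res_apply_le (neg_ne_zero.2 hτ) (k - t)
  rw [← ht, abs_neg] at h6
  have h7 := norm_sub_le k t
  have h8 : ‖(res A S τ).1 x‖ ≤ ‖x‖ := by nlinarith [norm_nonneg ((res A S τ).1 x)]
  have hκ := Real.sqrt_nonneg κ
  have h9 : ‖k‖ ≤ √κ * (2 * ‖x‖ + ‖t'‖) :=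
    h3.trans (mul_le_mul_of_nonneg_left (by linarith) hκ)
  have h10 : |τ| * ‖t'‖ ≤ 2 * ‖t‖ + 4 * √κ * ‖x‖ := by nlinarith [norm_nonneg t']
  refine ⟨h10, h9.trans (mul_le_mul_of_nonneg_left ?_ hκ)⟩
  rw [mul_comm, ← le_div_iff₀ h0, add_div] at h10
  have h11 : 4 * √κ * ‖x‖ / |τ| ≤ 2 * ‖x‖ := by
    rw [div_le_iff₀ h0]
    nlinarith [norm_nonneg x]
  linarith

/-- If the resolvent of `S` maps a core of `T` into the domain of the anticommutator, it maps
all of the domain of `T` there. -/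
theorem res_mem_of_hasCore [CompleteSpace E] (h : AnticommBound A S T κ) {τ : ℝ} (h1 : 1 ≤ |τ|)
    (h2 : 2 * √κ ≤ |τ|) {V : Submodule ℂ E} (hV : T.HasCore V)
    (hres : ∀ x ∈ V, ∃ s t k, Anticomm S T ((res A S τ).1 x) s t k) {x : E} (hx : x ∈ T.domain) :
    ∃ s t k, Anticomm S T ((res A S τ).1 x) s t k := by
  have hτ : τ ≠ 0 := abs_pos.1 (by linarith)
  obtain ⟨t, ht⟩ := exists_mem_graph hx
  obtain ⟨u, v, huV, huv, hu, hv⟩ := h.right.exists_seq_of_hasCore hV ht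
  choose s t' k hk using fun n => hres (u n) (huV n)
  have hy := (res A S τ).tendsto_apply hu
  have hs : ∀ n, s n = u n - imag τ • (res A S τ).1 (u n) := fun n =>
    (h.apply_res hτ (huv n) (hk n)).1
  have hs' : Tendsto s atTop (𝓝 (x - imag τ • (res A S τ).1 x)) := by
    rw [funext hs]
    exact hu.sub (hy.const_smul _)
  -- The estimate on `T(S + iτ)⁻¹` applies to differences, and `2 + 4√κ` is the sum of its two
  -- coefficients, with `|τ| ≥ 1` dropped.
  have ht' : CauchySeq t' := by
    rw [Metric.cauchySeq_iff]
    intro ε hε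
    have hc : 0 < ε / (2 + 4 * √κ) := by positivity
    obtain ⟨N₁, h₁⟩ := Metric.cauchySeq_iff.1 hu.cauchySeq _ hc
    obtain ⟨N₂, h₂⟩ := Metric.cauchySeq_iff.1 hv.cauchySeq _ hc
    refine ⟨max N₁ N₂, fun m hm n hn => ?_⟩
    simp only [ge_iff_le, max_le_iff] at hm hn
    have h3 := h₁ m hm.1 n hn.1
    have h4 := h₂ m hm.2 n hn.2
    rw [dist_eq_norm] at h3 h4 ⊢
    have h5 := (hk m).sub (hk n)
    rw [← map_sub] at h5
    have h6 := (h.norm_apply_res_le h1 h2 (graph_sub (huv m) (huv n)) h5).1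
    rw [lt_div_iff₀ (by positivity)] at h3 h4
    have hκ := Real.sqrt_nonneg κ
    have h7 : ‖t' m - t' n‖ ≤ |τ| * ‖t' m - t' n‖ := le_mul_of_one_le_left (norm_nonneg _) h1
    have h8 : 2 * ‖v m - v n‖ < 2 * (ε / (2 + 4 * √κ)) := by
      rw [← lt_div_iff₀ (by positivity)] at h4; linarith
    have h9 : 4 * √κ * ‖u m - u n‖ ≤ 4 * √κ * (ε / (2 + 4 * √κ)) := by
      rw [← lt_div_iff₀ (by positivity)] at h3
      exact mul_le_mul_of_nonneg_left h3.le (by positivity)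
    have h10 : 2 * (ε / (2 + 4 * √κ)) + 4 * √κ * (ε / (2 + 4 * √κ)) = ε := by
      field_simp
    linarith
  obtain ⟨w, hw⟩ := cauchySeq_tendsto_of_complete ht'
  obtain ⟨k₀, hk₀⟩ := h.exists_tendsto hk hy hs' hw
  have hts : ∀ n, (s n, v n - imag τ • t' n) ∈ T.graph := fun n => by
    rw [hs n]
    exact graph_sub (huv n) (graph_smul _ (hk n).2.1)
  have hst : ∀ n, (t' n, k n - (v n - imag τ • t' n)) ∈ S.graph := fun n => by
    obtain ⟨_, _, st, ts, h3, h4, h5⟩ := hk n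
    rw [h5, graph_unique (hts n) h4, add_sub_cancel_right]
    exact h3
  have hl := hv.sub (hw.const_smul (imag τ))
  exact ⟨_, w, k₀, h.left.res_mem hτ x, h.right.graph_of_tendsto (fun n => (hk n).2.1) hy hw,
    _, _, h.left.graph_of_tendsto hst hw (hk₀.sub hl), h.right.graph_of_tendsto hts hs' hl,
    (sub_add_cancel _ _).symm⟩

theorem inner_anticomm (h : AnticommBound A S T κ) {x s t k : E} (hk : Anticomm S T x s t k) :
    inner A x k = inner A s t + inner A t s ∧ inner A k x = inner A s t + inner A t s := by
  obtain ⟨hs, ht, st, ts, hst, hts, rfl⟩ := hk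
  have h1 := h.left.isSymm hs hst
  have h2 := h.right.isSymm ht hts
  have h3 := h.left.isSymm hst hs
  have h4 := h.right.isSymm hts ht
  rw [CStarModule.inner_add_right, CStarModule.inner_add_left, h3, h4, h1, h2]
  exact ⟨rfl, add_comm _ _⟩

/-- Here `⟨x, k⟩ + ⟨k, x⟩` is twice `⟨s, t⟩ + ⟨t, s⟩`. Young's inequality with weight `κ` together
with the form bound gives coefficient exactly `1` to `⟨s, s⟩ + ⟨t, t⟩`, half of what `2⟨s ± t, s ±
t⟩` supplies. -/
theorem inner_add_le_of_anticomm (h : AnticommBound A S T κ) {x s t k : E}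
    (hk : Anticomm S T x s t k) :
    inner A s s + inner A t t ≤ (2 : ℝ) • inner A (s + t) (s + t) + (κ + 1) • inner A x x ∧
    inner A s s + inner A t t ≤ (2 : ℝ) • inner A (s - t) (s - t) + (κ + 1) • inner A x x := by
  obtain ⟨h1, h2⟩ := h.inner_anticomm hk
  have h3 := inner_add_inner_le (A := A) x k h.pos
  have h4 := neg_inner_add_inner_le (A := A) x k h.pos
  have h5 : κ⁻¹ • inner A k k ≤ inner A x x + inner A s s + inner A t t := by
    have := smul_le_smul_of_nonneg_left (h.bound hk) (inv_nonneg.2 h.pos.le)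
    rwa [smul_smul, inv_mul_cancel₀ h.pos.ne', one_smul] at this
  rw [h1, h2] at h3 h4
  constructor
  · rw [← sub_nonneg]
    convert add_nonneg (sub_nonneg.2 h4) (sub_nonneg.2 h5) using 1
    simp only [CStarModule.inner_add_left, CStarModule.inner_add_right]
    module
  · rw [← sub_nonneg]
    convert add_nonneg (sub_nonneg.2 h3) (sub_nonneg.2 h5) using 1
    simp only [CStarModule.inner_sub_left, CStarModule.inner_sub_right]
    module

end AnticommBound

variable (A) in
/-- A weakly anticommuting pair with normalized constants, such that the resolvent of `S` maps the
domain of `T` into the domain of the anticommutator. -/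
structure AnticommPair (S T : E →ₗ.[ℂ] E) (κ t₀ : ℝ) : Prop extends AnticommBound A S T κ where
  one_le : 1 ≤ t₀
  sqrt_le : 2 * √κ ≤ t₀
  res_mem : ∀ ⦃τ⦄, t₀ ≤ |τ| → ∀ ⦃x⦄, x ∈ T.domain → ∃ s t k, Anticomm S T ((res A S τ).1 x) s t k

theorem WeaklyAnticommuting.exists_anticommPair [CompleteSpace E]
    (h : WeaklyAnticommuting A S T) : ∃ κ t₀, AnticommPair A S T κ t₀ := by
  obtain ⟨C₀, C₁, C₂, h0, h1, h2, hC⟩ := h.form_bound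
  obtain ⟨V, hV, t₀, -, ht₀⟩ := h.resolvent_core
  have hb : AnticommBound A S T (max C₀ (max C₁ C₂)) :=
    { left := h.left
      right := h.right
      pos := lt_max_of_lt_left h0
      bound := fun x s t k hk => by
        have hkg := mem_graph_anticomm.2 ⟨s, t, hk⟩
        have hx := LinearPMap.mem_domain_of_mem_graph hkg
        have hS := LinearPMap.mem_domain_of_mem_graph hk.1
        have hT := LinearPMap.mem_domain_of_mem_graph hk.2.1
        have := hC x hx hS hT
        rw [apply_eq_of_mem_graph hkg hx, apply_eq_of_mem_graph hk.1 hS,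
          apply_eq_of_mem_graph hk.2.1 hT] at this
        refine this.trans ?_
        rw [smul_add, smul_add]
        gcongr
        · exact CStarModule.inner_self_nonneg
        · exact le_max_left _ _
        · exact CStarModule.inner_self_nonneg
        · exact (le_max_left _ _).trans (le_max_right _ _)
        · exact CStarModule.inner_self_nonneg
        · exact (le_max_right _ _).trans (le_max_right _ _) }
  -- The threshold is raised to `1` and `2√κ` so that the absorption in `norm_apply_res_le` is
  -- available.
  refine ⟨_, max t₀ (max 1 (2 * √(max C₀ (max C₁ C₂)))), hb,
    (le_max_left _ _).trans (le_max_right _ _), (le_max_right _ _).trans (le_max_right _ _), ?_⟩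
  intro τ hτ x hx
  simp only [max_le_iff] at hτ
  refine hb.res_mem_of_hasCore hτ.2.1 hτ.2.2 hV (fun y hy => ?_) hx
  have hτ0 : τ ≠ 0 := abs_pos.1 (by linarith [hτ.2.1])
  have hm := h.left.res_mem hτ0 y
  have hd := LinearPMap.mem_domain_of_mem_graph hm
  have hF := ht₀ τ hτ.1 ⟨_, hd⟩ (by
    rw [apply_eq_of_mem_graph hm hd]
    simpa [imag] using hy)
  obtain ⟨k, hk⟩ := exists_mem_graph hF
  obtain ⟨s, t, hst⟩ := mem_graph_anticomm.1 hk
  exact ⟨s, t, k, hst⟩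

namespace AnticommPair

variable {t₀ : ℝ} [CompleteSpace E]

theorem ne_zero (h : AnticommPair A S T κ t₀) {τ : ℝ} (hτ : t₀ ≤ |τ|) : τ ≠ 0 :=
  abs_pos.1 (by linarith [h.one_le])

/-- Applying `i τ (S + i τ)⁻¹` with `τ → ∞` to a sequence in `dom S ∩ dom T` that converges for
the graph norms yields a sequence in the domain of `[S, T]` with the same limit. -/
theorem tendsto_smul_res (h : AnticommPair A S T κ t₀) {c : ℕ → ℝ} (hc₀ : ∀ n, t₀ ≤ |c n|)
    (hc : Tendsto (fun n => |c n|) atTop atTop) {u s t : ℕ → E} {x y z : E}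
    (hs : ∀ n, (u n, s n) ∈ S.graph) (ht : ∀ n, (u n, t n) ∈ T.graph)
    (hu : Tendsto u atTop (𝓝 x)) (hsy : Tendsto s atTop (𝓝 y)) (htz : Tendsto t atTop (𝓝 z)) :
    ∃ (t' k : ℕ → E) (w : E),
      (∀ n, Anticomm S T ((imag (c n) • res A S (c n)).1 (u n))
        ((imag (c n) • res A S (c n)).1 (s n)) (t' n) (k n)) ∧
      (∀ n, t' n = (imag (-c n) • res A S (-c n)).1 (t n) + (res A S (-c n)).1 (k n)) ∧
      Tendsto t' atTop (𝓝 z) ∧ Tendsto k atTop (𝓝 w) := by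
  choose s₀ t₁ k₁ hk₁ using fun n =>
    h.res_mem (hc₀ n) (LinearPMap.mem_domain_of_mem_graph (ht n))
  have hc0 : ∀ n, c n ≠ 0 := fun n => h.ne_zero (hc₀ n)
  have hk : ∀ n, Anticomm S T ((imag (c n) • res A S (c n)).1 (u n))
      ((imag (c n) • res A S (c n)).1 (s n)) (imag (c n) • t₁ n) (imag (c n) • k₁ n) := fun n => by
    have h1 := (hk₁ n).smul (imag (c n))
    rwa [graph_unique (hk₁ n).1 (h.left.res_graph (hc0 n) (hs n))] at h1
  have hf : ∀ n, imag (c n) • t₁ n = (imag (-c n) • res A S (-c n)).1 (t n)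
      + (res A S (-c n)).1 (imag (c n) • k₁ n) := fun n => by
    rw [(h.apply_res (hc0 n) (ht n) (hk₁ n)).2, map_sub, Adjointable.smul_apply, imag_neg, neg_smul,
      smul_sub, map_smul]
    abel
  -- The term `√κ‖(S - ic)⁻¹k‖` is at most `‖k‖/2` because `|c| ≥ 2√κ`. Absorbing it costs the
  -- factor `2`.
  have hn : ∀ n, ‖imag (c n) • k₁ n‖ ≤ 2 * √κ * (‖u n‖ + ‖s n‖ + ‖t n‖) := fun n => by
    have h1 := h.norm_le (hk n)
    have hκ := Real.sqrt_nonneg κ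
    have h2 := Adjointable.le_of_norm_le (h.left.norm_imag_smul_res_le (hc0 n)) (u n)
    have h3 := Adjointable.le_of_norm_le (h.left.norm_imag_smul_res_le (hc0 n)) (s n)
    have h4 := Adjointable.le_of_norm_le
      (h.left.norm_imag_smul_res_le (neg_ne_zero.2 (hc0 n))) (t n)
    have h5 := h.left.norm_res_apply_le (neg_ne_zero.2 (hc0 n)) (imag (c n) • k₁ n)
    rw [abs_neg] at h5
    have h6 : ‖imag (c n) • t₁ n‖ ≤ ‖t n‖ + ‖(res A S (-c n)).1 (imag (c n) • k₁ n)‖ := by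
      rw [hf n]
      exact (norm_add_le _ _).trans (by linarith)
    have h7 : 2 * √κ ≤ |c n| := h.sqrt_le.trans (hc₀ n)
    have h8 := mul_le_mul_of_nonneg_right h7
      (norm_nonneg ((res A S (-c n)).1 (imag (c n) • k₁ n)))
    have h9 := mul_le_mul_of_nonneg_left (add_le_add (add_le_add h2 h3) h6) hκ
    linarith
  have ht' : Tendsto (fun n => imag (c n) • t₁ n) atTop (𝓝 z) := by
    have hc' : Tendsto (fun n => |-c n|) atTop atTop := by simpa using hc
    have h1 := h.left.tendsto_imag_smul_res (fun n => neg_ne_zero.2 (hc0 n)) hc' htz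
    have h2 : Tendsto (fun n => (res A S (-c n)).1 (imag (c n) • k₁ n)) atTop (𝓝 0) := by
      have h3 : Tendsto (fun n => |c n|⁻¹ * (2 * √κ * (‖u n‖ + ‖s n‖ + ‖t n‖))) atTop
          (𝓝 (0 * (2 * √κ * (‖x‖ + ‖y‖ + ‖z‖)))) :=
        (tendsto_inv_atTop_zero.comp hc).mul (((hu.norm.add hsy.norm).add htz.norm).const_mul _)
      rw [zero_mul] at h3
      refine squeeze_zero_norm (fun n => ?_) h3
      have h4 := Adjointable.le_of_norm_le (h.left.norm_res_le (neg_ne_zero.2 (hc0 n)))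
        (imag (c n) • k₁ n)
      rw [abs_neg] at h4
      exact h4.trans (mul_le_mul_of_nonneg_left (hn n) (by positivity))
    rw [funext hf]
    simpa using h1.add h2
  obtain ⟨w, hw⟩ := h.exists_tendsto hk (h.left.tendsto_imag_smul_res hc0 hc hu)
    (h.left.tendsto_imag_smul_res hc0 hc hsy) ht'
  exact ⟨_, _, w, hk, hf, ht', hw⟩

/-- This transfers closed inequalities from `ℱ(S, T)` to `dom S ∩ dom T`. The convergence of `k`
also places the limit in the domain of the closure of the anticommutator. -/
theorem exists_seq (h : AnticommPair A S T κ t₀) {x y z : E} (hy : (x, y) ∈ S.graph)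
    (hz : (x, z) ∈ T.graph) : ∃ (u s t k : ℕ → E) (w : E),
      (∀ n, Anticomm S T (u n) (s n) (t n) (k n)) ∧ Tendsto u atTop (𝓝 x) ∧
      Tendsto s atTop (𝓝 y) ∧ Tendsto t atTop (𝓝 z) ∧ Tendsto k atTop (𝓝 w) := by
  have h0 : 0 < t₀ := by linarith [h.one_le]
  have hc₀ : ∀ n : ℕ, t₀ ≤ |t₀ + n| := fun n => by
    rw [abs_of_nonneg (by positivity)]; linarith [n.cast_nonneg (α := ℝ)]
  have hc : Tendsto (fun n : ℕ => |t₀ + n|) atTop atTop :=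
    tendsto_abs_atTop_atTop.comp (tendsto_atTop_add_const_left _ _ tendsto_natCast_atTop_atTop)
  obtain ⟨t, k, w, h1, -, h2, h3⟩ := h.tendsto_smul_res hc₀ hc (fun _ => hy) (fun _ => hz)
    tendsto_const_nhds tendsto_const_nhds tendsto_const_nhds
  exact ⟨_, _, t, k, w, h1,
    h.left.tendsto_imag_smul_res (fun n => h.ne_zero (hc₀ n)) hc tendsto_const_nhds,
    h.left.tendsto_imag_smul_res (fun n => h.ne_zero (hc₀ n)) hc tendsto_const_nhds, h2, h3⟩

theorem inner_add_le (h : AnticommPair A S T κ t₀) {x s t : E} (hs : (x, s) ∈ S.graph)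
    (ht : (x, t) ∈ T.graph) :
    inner A s s + inner A t t ≤ (2 : ℝ) • inner A (s + t) (s + t) + (κ + 1) • inner A x x ∧
    inner A s s + inner A t t ≤ (2 : ℝ) • inner A (s - t) (s - t) + (κ + 1) • inner A x x := by
  obtain ⟨u', s', t', k', w, hk, hu, hs, ht, -⟩ := h.exists_seq hs ht
  have hsum := (tendsto_inner (A := A) hs hs).add (tendsto_inner ht ht)
  have hx := (tendsto_inner (A := A) hu hu).const_smul (κ + 1)
  exact ⟨le_of_tendsto_of_tendsto' hsum
      (((tendsto_inner (hs.add ht) (hs.add ht)).const_smul (2 : ℝ)).add hx)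
      fun n => (h.inner_add_le_of_anticomm (hk n)).1,
    le_of_tendsto_of_tendsto' hsum
      (((tendsto_inner (hs.sub ht) (hs.sub ht)).const_smul (2 : ℝ)).add hx)
      fun n => (h.inner_add_le_of_anticomm (hk n)).2⟩

theorem dense_anticomm_domain (h : AnticommPair A S T κ t₀) :
    Dense ((anticomm S T).domain : Set E) := by
  have h0 : 0 < t₀ := by linarith [h.one_le]
  rw [← dense_closure]
  refine h.right.dense_domain.mono fun x hx => ?_
  have hc₀ : ∀ n : ℕ, t₀ ≤ |t₀ + n| := fun n => by
    rw [abs_of_nonneg (by positivity)]; linarith [n.cast_nonneg (α := ℝ)]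
  have hc : Tendsto (fun n : ℕ => |t₀ + n|) atTop atTop :=
    tendsto_abs_atTop_atTop.comp (tendsto_atTop_add_const_left _ _ tendsto_natCast_atTop_atTop)
  refine mem_closure_of_tendsto (h.left.tendsto_imag_smul_res (fun n => h.ne_zero (hc₀ n)) hc
    (tendsto_const_nhds (x := x))) (Eventually.of_forall fun n => ?_)
  obtain ⟨s, t, k, hk⟩ := h.res_mem (hc₀ n) hx
  exact LinearPMap.mem_domain_of_mem_graph
    (mem_graph_anticomm.2 ⟨_, _, hk.smul (imag (t₀ + n))⟩)

theorem isSymm_anticomm (h : AnticommPair A S T κ t₀) : IsSymm A (anticomm S T) := by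
  intro x k x' k' hk hk'
  obtain ⟨s, t, hs, ht, st, ts, hst, hts, rfl⟩ := mem_graph_anticomm.1 hk
  obtain ⟨s', t', hs', ht', st', ts', hst', hts', rfl⟩ := mem_graph_anticomm.1 hk'
  rw [CStarModule.inner_add_right, CStarModule.inner_add_left, h.left.isSymm hst hs',
    h.right.isSymm hts ht', ← h.left.isSymm hs hst', ← h.right.isSymm ht hts', add_comm]

end AnticommPair

end Module

/-- The hypothesis is the symmetry of `T` on the range of `R + Γ - a`, with `T(R + Γ - a)` written
out. Its imaginary part isolates `2mR²`, leaving terms with `Γ`, small in the application, and terms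
with a factor `a` or its adjoint. In `dense_range_add`, `Γ` and `a` are the adjoints of the
commutator `G` and of an operator `B` with values in the range of `S + T + im`. -/
theorem two_smul_sq_eq_of_star_mul_eq {V : Type*} [Ring V] [StarRing V] [Algebra ℂ V]
    [StarModule ℂ V] {R S' Γ a : V} {m n : ℝ} (hR : star R = R) (hS : star S' = S')
    (hRS : S' * R = R * S')
    (h : star (-S' + imag m • R + imag n • (Γ - a)) * (R + Γ - a)
      = star (R + Γ - a) * (-S' + imag m • R + imag n • (Γ - a))) :
    (2 * m : ℂ) • (R * R)
      = (imag 1 • (S' * Γ) - (m : ℂ) • (R * Γ) - (n : ℂ) • (star Γ * (R + Γ)))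
        + star (imag 1 • (S' * Γ) - (m : ℂ) • (R * Γ) - (n : ℂ) • (star Γ * (R + Γ)))
        + (star a * (imag 1 • S' + (m : ℂ) • R + (n : ℂ) • (R + Γ - a) + (n : ℂ) • Γ)
        + star (star a *
            (imag 1 • S' + (m : ℂ) • R + (n : ℂ) • (R + Γ - a) + (n : ℂ) • Γ))) := by
  have e : ∀ t : ℝ, imag t = t * imag 1 := fun t => by simp [imag]
  have e1 : imag 1 * imag 1 = -1 := by simp [imag_mul_imag]
  have e2 : star (imag 1) = -imag 1 := by simp [imag]
  have e3 : ∀ t : ℝ, star (t : ℂ) = t := fun t => Complex.conj_ofReal t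
  simp only [e m, e n, star_add, star_sub, star_neg, star_smul, star_mul, star_star, hR, hS, e2, e3,
    mul_add, add_mul, mul_sub, sub_mul, smul_mul_assoc, mul_smul_comm, smul_add,
    smul_sub, neg_mul, mul_neg, hRS] at h ⊢
  generalize imag 1 = i at *
  have e4 : ∀ b : ℂ, i * (i * b) = -b := fun b => by linear_combination b * e1
  have e5 : ∀ b : ℂ, i * (b * i) = -b := fun b => by linear_combination b * e1
  replace h := congrArg (fun z => i • z) h
  simp only [smul_add, smul_sub, smul_neg, smul_smul, e4, e5, neg_smul] at h
  linear_combination (norm := module) h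

/-! ### Regularization of S and density of the range of S + T + im -/

section Module

variable {A E : Type*} [NonUnitalCStarAlgebra A] [PartialOrder A] [StarOrderedRing A]
  [SMul A E] [NormedAddCommGroup E] [NormedSpace ℂ E] [CStarModule A E]
  {S T : E →ₗ.[ℂ] E} {κ t₀ : ℝ} [CompleteSpace E]

variable (A) in
/-- The regularization `(1 + S² / n²)⁻¹`. -/
def reg (S : E →ₗ.[ℂ] E) (n : ℝ) : Adjointable A E :=
  (imag n • res A S n) * (imag (-n) • res A S (-n))

variable (A) in
/-- The bounded operator `S (1 + S² / n²)⁻¹`. -/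
def mulReg (S : E →ₗ.[ℂ] E) (n : ℝ) : Adjointable A E :=
  ((n ^ 2 / 2 : ℝ) : ℂ) • (res A S n + res A S (-n))

theorem reg_eq (n : ℝ) :
    reg A S n = ((n ^ 2 : ℝ) : ℂ) • (res A S n * res A S (-n)) := by
  rw [reg, smul_mul_smul_comm, imag_mul_imag]
  congr 1
  push_cast
  ring

namespace IsSelfAdjointRegular

theorem star_reg (hS : IsSelfAdjointRegular A S) {n : ℝ} (hn : n ≠ 0) :
    star (reg A S n) = reg A S n := by
  rw [reg, star_mul, star_smul, star_smul, hS.star_res hn, hS.star_res (neg_ne_zero.2 hn),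
    star_imag, star_imag, neg_neg]

theorem norm_reg_le (hS : IsSelfAdjointRegular A S) {n : ℝ} (hn : n ≠ 0) : ‖reg A S n‖ ≤ 1 := by
  refine (norm_mul_le _ _).trans ?_
  exact mul_le_one₀ (hS.norm_imag_smul_res_le hn) (norm_nonneg _)
    (hS.norm_imag_smul_res_le (neg_ne_zero.2 hn))

theorem star_mulReg (hS : IsSelfAdjointRegular A S) {n : ℝ} (hn : n ≠ 0) :
    star (mulReg A S n) = mulReg A S n := by
  rw [mulReg, star_smul, star_add, hS.star_res hn, hS.star_res (neg_ne_zero.2 hn), neg_neg,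
    add_comm]
  congr 1
  exact Complex.conj_ofReal _

theorem norm_mulReg_le (hS : IsSelfAdjointRegular A S) {n : ℝ} (hn : 0 < n) :
    ‖mulReg A S n‖ ≤ n := by
  have h1 := hS.norm_res_le hn.ne'
  have h2 := hS.norm_res_le (neg_ne_zero.2 hn.ne')
  rw [abs_neg, abs_of_pos hn] at h2
  rw [abs_of_pos hn] at h1
  rw [mulReg, norm_smul, Complex.norm_real, Real.norm_of_nonneg (by positivity)]
  calc n ^ 2 / 2 * ‖res A S n + res A S (-n)‖ ≤ n ^ 2 / 2 * (n⁻¹ + n⁻¹) := by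
        gcongr
        exact (norm_add_le _ _).trans (add_le_add h1 h2)
    _ = n := by field_simp; ring

theorem mulReg_commute (hS : IsSelfAdjointRegular A S) {n : ℝ} (hn : n ≠ 0) :
    Commute (mulReg A S n) (reg A S n) := by
  have h := hS.res_commute hn (neg_ne_zero.2 hn)
  rw [reg_eq, mulReg]
  refine Commute.smul_right (Commute.smul_left ?_ _) _
  exact Commute.add_left ((Commute.refl _).mul_right h) (h.symm.mul_right (Commute.refl _))

theorem reg_graph (hS : IsSelfAdjointRegular A S) {n : ℝ} (hn : n ≠ 0) (x : E) :
    ((reg A S n).1 x, (mulReg A S n).1 x) ∈ S.graph := by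
  have h1 := hS.res_mem hn ((res A S (-n)).1 x)
  have h2 : (res A S n).1 x - (res A S (-n)).1 x
      = (imag (-n - n) • (res A S n * res A S (-n))).1 x := by
    rw [← hS.res_sub_res hn (neg_ne_zero.2 hn)]; rfl
  have h3 := graph_smul ((n ^ 2 : ℝ) : ℂ) h1
  rw [reg_eq]
  convert h3 using 2
  · rfl
  simp only [mulReg, Adjointable.smul_apply, Adjointable.add_apply, Adjointable.mul_apply] at h2 ⊢
  have h4 : imag (-n - n) = -2 * imag n := by simp only [imag]; push_cast; ring
  rw [h4, sub_eq_iff_eq_add] at h2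
  rw [h2]
  push_cast
  module

theorem tendsto_reg (hS : IsSelfAdjointRegular A S) {c : ℕ → ℝ} (hc0 : ∀ n, c n ≠ 0)
    (hc : Tendsto (fun n => |c n|) atTop atTop) (x : E) :
    Tendsto (fun n => (reg A S (c n)).1 x) atTop (𝓝 x) :=
  hS.tendsto_imag_smul_res hc0 hc (hS.tendsto_imag_smul_res (fun n => neg_ne_zero.2 (hc0 n))
    (by simpa using hc) tendsto_const_nhds)

end IsSelfAdjointRegular

namespace AnticommPair

/-- The commutator of `T` with the regularization of `S` is small relative to the resolvent
of `T`. -/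
theorem exists_commutator_apply (h : AnticommPair A S T κ t₀) {n : ℝ} (hn : t₀ ≤ n) (w : E) :
    ∃ g, ((reg A S n).1 ((res A T n).1 w),
        (reg A S n).1 (w - imag n • (res A T n).1 w) + g) ∈ T.graph ∧
      ‖g‖ ≤ 18 * √κ / n * ‖w‖ := by
  have hn1 : 1 ≤ n := h.one_le.trans hn
  have hn0 : 0 < n := by linarith
  have hn' : n ≠ 0 := hn0.ne'
  have hab : |n| = n := abs_of_pos hn0
  have hab' : |-n| = n := by rw [abs_neg, hab]
  have hκ := Real.sqrt_nonneg κ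
  have hκn : 2 * √κ ≤ n := h.sqrt_le.trans hn
  set x := (res A T n).1 w with hx
  have hxT : (x, w - imag n • x) ∈ T.graph := h.right.res_mem hn' w
  have hx1 : n * ‖x‖ ≤ ‖w‖ := by
    have := h.right.norm_res_apply_le hn' w
    rwa [hab] at this
  have hx2 : ‖w - imag n • x‖ ≤ ‖w‖ := h.right.norm_apply_res_le hn' w
  generalize w - imag n • x = tx at hxT hx2 ⊢
  -- Pass `T` through `(S - in)⁻¹`, then through `(S + in)⁻¹`. The two sign changes cancel, so `T`
  -- commutes with the product up to terms in `k₁` and `k₂`.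
  obtain ⟨s₁, t₁, k₁, hk₁⟩ := h.res_mem (τ := -n) (by rwa [hab'])
    (LinearPMap.mem_domain_of_mem_graph hxT)
  obtain ⟨s₂, t₂, k₂, hk₂⟩ := h.res_mem (τ := n) (by rwa [hab])
    (LinearPMap.mem_domain_of_mem_graph hk₁.2.1)
  have e₁ := (h.apply_res (neg_ne_zero.2 hn') hxT hk₁).2
  have e₂ := (h.apply_res hn' hk₁.2.1 hk₂).2
  have b₁ := h.norm_apply_res_le (τ := -n) (by rwa [hab']) (by rwa [hab']) hxT hk₁
  have b₂ := h.norm_apply_res_le (τ := n) (by rwa [hab]) (by rwa [hab]) hk₁.2.1 hk₂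
  have b₃ := h.left.norm_res_apply_le (neg_ne_zero.2 hn') x
  rw [hab'] at b₁ b₃
  rw [hab] at b₂
  rw [neg_neg] at e₁
  have hW := norm_nonneg w
  have hx0 := norm_nonneg x
  have c₁ : n * ‖t₁‖ ≤ 4 * ‖w‖ := by nlinarith [b₁.1]
  have c₂ : n * ‖k₁‖ ≤ 6 * √κ * ‖w‖ := by
    have h2 : n * (4 * ‖x‖ + 2 * ‖tx‖ / n) = 4 * (n * ‖x‖) + 2 * ‖tx‖ := by field_simp
    calc n * ‖k₁‖ ≤ n * (√κ * (4 * ‖x‖ + 2 * ‖tx‖ / n)) := by gcongr; exact b₁.2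
      _ = √κ * (4 * (n * ‖x‖) + 2 * ‖tx‖) := by rw [← h2]; ring
      _ ≤ √κ * (4 * ‖w‖ + 2 * ‖w‖) := by gcongr
      _ = 6 * √κ * ‖w‖ := by ring
  have c₃ : n * (n * ‖k₂‖) ≤ 12 * √κ * ‖w‖ := by
    have h2 : n * (4 * ‖(res A S (-n)).1 x‖ + 2 * ‖t₁‖ / n)
        = 4 * (n * ‖(res A S (-n)).1 x‖) + 2 * ‖t₁‖ := by field_simp
    calc n * (n * ‖k₂‖)
        ≤ n * (n * (√κ * (4 * ‖(res A S (-n)).1 x‖ + 2 * ‖t₁‖ / n))) := by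
          gcongr; exact b₂.2
      _ = √κ * (4 * (n * (n * ‖(res A S (-n)).1 x‖)) + 2 * (n * ‖t₁‖)) := by
          rw [show n * (n * (√κ * (4 * ‖(res A S (-n)).1 x‖ + 2 * ‖t₁‖ / n)))
            = √κ * (n * (n * (4 * ‖(res A S (-n)).1 x‖ + 2 * ‖t₁‖ / n))) by ring, h2]
          ring
      _ ≤ √κ * (4 * ‖w‖ + 2 * (4 * ‖w‖)) := by
          gcongr
          exact (mul_le_mul_of_nonneg_left b₃ hn0.le).trans hx1
      _ = 12 * √κ * ‖w‖ := by ring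
  -- The two terms contribute `12√κ/n` through `c₃` and `6√κ/n` through `c₂`, whence `18`.
  refine ⟨((n ^ 2 : ℝ) : ℂ) • ((res A S (-n)).1 k₂ - (res A S (-n)).1 ((res A S n).1 k₁)), ?_, ?_⟩
  · have := graph_smul ((n ^ 2 : ℝ) : ℂ) hk₂.2.1
    rw [reg_eq]
    convert this using 2
    · rfl
    have hcomm : (res A S n).1 ((res A S (-n)).1 tx) = (res A S (-n)).1 ((res A S n).1 tx) :=
      congrArg (fun L : Adjointable A E => L.1 tx)
        (h.left.res_commute hn' (neg_ne_zero.2 hn')).eq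
    rw [e₂, e₁]
    simp only [Adjointable.smul_apply, Adjointable.mul_apply, map_sub, hcomm]
    module
  · have d₁ := h.left.norm_res_apply_le (neg_ne_zero.2 hn') k₂
    have d₂ := h.left.norm_res_apply_le (neg_ne_zero.2 hn') ((res A S n).1 k₁)
    have d₃ := h.left.norm_res_apply_le hn' k₁
    rw [hab'] at d₁ d₂
    rw [hab] at d₃
    rw [norm_smul, Complex.norm_real, Real.norm_of_nonneg (by positivity), div_mul_eq_mul_div,
      le_div_iff₀ hn0]
    have d₄ := norm_sub_le ((res A S (-n)).1 k₂) ((res A S (-n)).1 ((res A S n).1 k₁))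
    calc n ^ 2 * ‖(res A S (-n)).1 k₂ - (res A S (-n)).1 ((res A S n).1 k₁)‖ * n
        ≤ n ^ 2 * (‖(res A S (-n)).1 k₂‖ + ‖(res A S (-n)).1 ((res A S n).1 k₁)‖) * n := by
          gcongr
      _ = n * (n * (n * ‖(res A S (-n)).1 k₂‖))
          + n * (n * (n * ‖(res A S (-n)).1 ((res A S n).1 k₁)‖)) := by ring
      _ ≤ n * (n * ‖k₂‖) + n * (n * ‖(res A S n).1 k₁‖) := by gcongr
      _ ≤ 12 * √κ * ‖w‖ + n * ‖k₁‖ := by gcongr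
      _ ≤ 18 * √κ * ‖w‖ := by linarith

/-- Uniqueness of values in the graph of `T` makes the error term linear. Symmetry of `T` supplies
its formal adjoint on the dense set `dom T`, hence adjointability. -/
theorem exists_commutator (h : AnticommPair A S T κ t₀) {n : ℝ} (hn : t₀ ≤ n) :
    ∃ G : Adjointable A E, ‖G‖ ≤ 18 * √κ / n ∧ ∀ w, ((reg A S n).1 ((res A T n).1 w),
      (reg A S n).1 (w - imag n • (res A T n).1 w) + G.1 w) ∈ T.graph := by
  have hn0 : 0 < n := by linarith [h.one_le]
  choose f hf hfn using h.exists_commutator_apply hn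
  have huniq : ∀ {x y g g' : E}, (x, y + g) ∈ T.graph → (x, y + g') ∈ T.graph → g = g' :=
    fun h1 h2 => add_left_cancel (graph_unique h1 h2)
  let g : E →ₗ[ℂ] E :=
    { toFun := f
      map_add' := fun x y => by
        refine huniq (hf (x + y)) ?_
        convert graph_add (hf x) (hf y) using 2
        · simp only [map_add]
        · simp only [map_add, map_sub, map_smul, smul_add]
          abel
      map_smul' := fun c x => by
        refine huniq (hf (c • x)) ?_
        convert graph_smul c (hf x) using 2
        · simp only [map_smul]
        · simp only [map_sub, map_smul, smul_add, smul_sub, RingHom.id_apply]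
          rw [smul_comm] }
  let gc : E →L[ℂ] E := g.mkContinuous (18 * √κ / n) hfn
  have hgc : ∀ w, gc w = f w := fun _ => rfl
  obtain ⟨G, hG⟩ := Adjointable.exists_of_dense (A := A) gc h.right.dense_domain fun y hy => by
    obtain ⟨ty, hty⟩ := exists_mem_graph hy
    refine ⟨(star (reg A S n * res A T n)).1 ty
      - (star (reg A S n * (1 - imag n • res A T n))).1 y, fun x => ?_⟩
    have h1 := h.right.isSymm (hf x) hty
    rw [CStarModule.inner_sub_right, inner_star_right, inner_star_right, hgc]
    rw [CStarModule.inner_add_left] at h1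
    rw [eq_sub_iff_add_eq, add_comm]
    exact h1
  refine ⟨G, ?_, fun w => ?_⟩
  · refine Adjointable.norm_le_of_forall (by positivity) fun w => ?_
    rw [hG]
    exact hfn w
  · rw [hG]
    exact hf w

/-- The range of `S + T + i m` is dense for large `m`. -/
theorem dense_range_add (h : AnticommPair A S T κ t₀) {m : ℝ} (hm : 144 * √κ ≤ m) :
    Dense {w : E | ∃ x, (x, w - imag m • x) ∈ (S + T).graph} := by
  let L : Submodule ℂ E :=
    { carrier := {w : E | ∃ x, (x, w - imag m • x) ∈ (S + T).graph}
      zero_mem' := ⟨0, by simp⟩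
      add_mem' := by
        rintro w w' ⟨x, hx⟩ ⟨x', hx'⟩
        refine ⟨x + x', ?_⟩
        convert graph_add hx hx' using 2
        module
      smul_mem' := by
        rintro c w ⟨x, hx⟩
        refine ⟨c • x, ?_⟩
        convert graph_smul c hx using 2
        module }
  have hκ : 0 < √κ := Real.sqrt_pos.2 h.pos
  have hm0 : 0 < m := by linarith
  refine dense_of_approximate_bound (A := A) L fun z η hη => ?_
  -- The commutator estimate needs `n ≥ t₀`. The bound on `U` uses `m ≤ n`, and `18√κ ≤ n` to get
  -- `‖G‖ ≤ 1`.
  set b := max t₀ (max m (18 * √κ)) with hb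
  have hb0 : 0 < b := lt_max_of_lt_right (lt_max_of_lt_left hm0)
  have hbn : ∀ n : ℕ, b ≤ b + n := fun n => by linarith [n.cast_nonneg (α := ℝ)]
  have hc : Tendsto (fun n : ℕ => |b + n|) atTop atTop :=
    tendsto_abs_atTop_atTop.comp (tendsto_atTop_add_const_left _ _ tendsto_natCast_atTop_atTop)
  obtain ⟨N, hN⟩ := Metric.tendsto_atTop.1
    (h.left.tendsto_reg (fun n => (hb0.trans_le (hbn n)).ne') hc z) η hη
  have hNη := hN N le_rfl
  have hnb := hbn N
  rw [dist_eq_norm] at hNη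
  generalize b + (N : ℝ) = n at hNη hnb
  clear hN hc hbn
  simp only [hb, max_le_iff] at hnb
  obtain ⟨hn, hnm, hnκ⟩ := hnb
  have hn0 : 0 < n := by linarith [h.one_le]
  have hn' := hn0.ne'
  obtain ⟨G, hG, hGT⟩ := h.exists_commutator hn
  have hR := h.left.star_reg hn'
  have hR1 := h.left.norm_reg_le hn'
  have hS' := h.left.star_mulReg hn'
  have hS1 := h.left.norm_mulReg_le hn0
  have hRS := h.left.mulReg_commute hn'
  have hRg := h.left.reg_graph hn'
  set R := reg A S n
  set S' := mulReg A S n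
  set σ := res A T n with hσ
  -- This is `(S + T + im)Rσ` with `σ = (T + in)⁻¹`, written with bounded operators by means of `TRσ
  -- = R(1 - inσ) + G`.
  set B : Adjointable A E := R * (1 - imag n • σ) + G + (S' + imag m • R) * σ with hB
  have hBL : ∀ w, B.1 w ∈ L := by
    intro w
    refine ⟨R.1 (σ.1 w), mem_graph_add.2 ⟨_, _, hRg (σ.1 w), hGT w, ?_⟩⟩
    simp only [hB, Adjointable.add_apply, Adjointable.mul_apply, Adjointable.smul_apply,
      Adjointable.sub_apply, Adjointable.one_apply]
    abel
  set g : Adjointable A E := imag (-n) • R - S' + imag m • R with hg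
  -- The terms `R` and `G⋆` cancel in `B⋆`, leaving `(T - in)⁻¹` on the left. So this operator maps
  -- into `dom T`, although `R` alone need not.
  have hv : R + star G - star B = res A T (-n) * g := by
    simp only [hB, star_add, star_mul, star_sub, star_one, star_smul, hR, hS', star_imag, hσ,
      h.right.star_res hn', hg, mul_add, mul_sub, add_mul, one_mul, smul_mul_assoc,
      mul_smul_comm, imag_neg, neg_smul, mul_neg]
    abel
  have hT : ∀ x, ((R + star G - star B).1 x,
      (-S' + imag m • R + imag n • (star G - star B)).1 x) ∈ T.graph := by
    intro x
    have h1 := h.right.res_mem (neg_ne_zero.2 hn') (g.1 x)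
    have h2 : (res A T (-n)).1 (g.1 x) = (R + star G - star B).1 x := by rw [hv]; rfl
    rw [h2] at h1
    convert h1 using 2
    simp only [hg, imag_neg, neg_smul, Adjointable.add_apply, Adjointable.sub_apply,
      Adjointable.neg_apply, Adjointable.smul_apply]
    module
  have hkey := two_smul_sq_eq_of_star_mul_eq hR hS' hRS (Γ := star G) (a := star B) (m := m)
    (n := n) (by
      apply Adjointable.ext
      intro y
      apply eq_of_inner_left A
      intro x
      simp only [Adjointable.mul_apply, inner_star_right]
      exact h.right.isSymm (hT x) (hT y))
  rw [star_star, star_star] at hkey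
  set U := imag 1 • (S' * star G) - (m : ℂ) • (R * star G) - (n : ℂ) • (G * (R + star G)) with hU
  set Y := B * (imag 1 • S' + (m : ℂ) • R + (n : ℂ) • (R + star G - star B)
    + (n : ℂ) • star G) with hY
  -- With `‖G‖ ≤ 18√κ/n` the three terms are at most `18√κ`, `18√κ` and `36√κ`. The real part of `U`
  -- doubles the total to `144√κ`, and dividing by `2m` yields the `1/2` of the density criterion.
  have hUn : ‖U‖ ≤ 72 * √κ := by
    have hG' : ‖star G‖ ≤ 18 * √κ / n := by rwa [norm_star]
    have hG1 : 18 * √κ / n ≤ 1 := (div_le_one hn0).2 hnκ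
    have h1 : ‖imag 1 • (S' * star G)‖ ≤ 1 * (n * (18 * √κ / n)) := by
      rw [norm_smul, norm_imag, abs_one]
      gcongr
      exact (norm_mul_le _ _).trans (mul_le_mul hS1 hG' (norm_nonneg _) hn0.le)
    have h2 : ‖(m : ℂ) • (R * star G)‖ ≤ n * (1 * (18 * √κ / n)) := by
      rw [norm_smul, Complex.norm_real, Real.norm_of_nonneg hm0.le]
      refine mul_le_mul hnm ?_ (norm_nonneg _) hn0.le
      exact (norm_mul_le _ _).trans (mul_le_mul hR1 hG' (norm_nonneg _) zero_le_one)
    have h3 : ‖(n : ℂ) • (G * (R + star G))‖ ≤ n * ((18 * √κ / n) * 2) := by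
      rw [norm_smul, Complex.norm_real, Real.norm_of_nonneg hn0.le]
      gcongr
      refine (norm_mul_le _ _).trans (mul_le_mul hG ?_ (norm_nonneg _) (by positivity))
      exact (norm_add_le _ _).trans (by linarith)
    have e : n * (18 * √κ / n) = 18 * √κ := by field_simp
    have h4 := norm_sub_le (imag 1 • (S' * star G) - (m : ℂ) • (R * star G))
      ((n : ℂ) • (G * (R + star G)))
    have h5 := norm_sub_le (imag 1 • (S' * star G)) ((m : ℂ) • (R * star G))
    nlinarith
  refine ⟨R, (((2 * m)⁻¹ : ℝ) : ℂ) • Y, hR1, hNη.le, fun x => L.smul_mem _ (hBL _), fun x => ?_⟩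
  have hx : (2 * m) • inner A (R.1 x) (R.1 x) = (inner A x (U.1 x) + inner A (U.1 x) x)
      + (inner A x (Y.1 x) + inner A (Y.1 x) x) := by
    have h1 := congrArg (fun Z : Adjointable A E => inner A x (Z.1 x)) hkey
    simp only [Adjointable.add_apply, Adjointable.smul_apply, Adjointable.mul_apply,
      CStarModule.inner_add_right, CStarModule.inner_smul_right_complex, inner_star_right] at h1
    rw [← inner_star_right R x, hR, ← Complex.coe_smul]
    push_cast
    exact h1
  have hUx : inner A x (U.1 x) + inner A (U.1 x) x ≤ (144 * √κ) • inner A x x := by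
    refine (inner_add_inner_le (A := A) x (U.1 x) (a := 72 * √κ) (by positivity)).trans ?_
    have h1 := smul_le_smul_of_nonneg_left (Adjointable.inner_apply_self_le hUn x)
      (inv_nonneg.2 (by positivity : 0 ≤ 72 * √κ))
    rw [smul_smul, sq, inv_mul_cancel_left₀ (by positivity)] at h1
    refine (add_le_add_right h1 _).trans_eq ?_
    rw [← add_smul]
    congr 1
    ring
  have h1 : inner A (R.1 x) (R.1 x) = (2 * m)⁻¹ • ((2 * m) • inner A (R.1 x) (R.1 x)) := by
    rw [smul_smul, inv_mul_cancel₀ (by positivity), one_smul]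
  rw [h1, hx, smul_add]
  refine add_le_add ?_ (le_of_eq ?_)
  · refine (smul_le_smul_of_nonneg_left hUx (by positivity)).trans ?_
    rw [smul_smul]
    refine smul_le_smul_of_nonneg_right ?_ CStarModule.inner_self_nonneg
    rw [inv_mul_le_iff₀ (by positivity)]
    linarith
  · rw [Adjointable.smul_apply, Complex.coe_smul, CStarModule.inner_smul_left_real,
      CStarModule.inner_smul_right_real, smul_add]

end AnticommPair

end Module

/-! ### Self-adjointness and regularity of S + T, and the domain of its square -/

section Module

variable {A E : Type*} [NonUnitalCStarAlgebra A] [PartialOrder A] [StarOrderedRing A]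
  [SMul A E] [NormedAddCommGroup E] [NormedSpace ℂ E] [CStarModule A E]
  {S T : E →ₗ.[ℂ] E} {κ t₀ : ℝ}

namespace IsSymm

theorem isClosable {K : E →ₗ.[ℂ] E} (hK : IsSymm A K) (hd : Dense (K.domain : Set E)) :
    K.IsClosable := by
  refine ⟨K.graph.topologicalClosure.toLinearPMap, (Submodule.toLinearPMap_graph_eq _ ?_).symm⟩
  rintro ⟨x, k⟩ hp hx
  obtain rfl : x = 0 := hx
  obtain ⟨p, hp, hpx⟩ := mem_closure_iff_seq_limit.1 hp
  have h1 := (continuous_fst.tendsto _).comp hpx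
  have h2 := (continuous_snd.tendsto _).comp hpx
  have h3 : ∀ y ∈ K.domain, inner A k y = 0 := by
    intro y hy
    obtain ⟨w, hw⟩ := exists_mem_graph hy
    have h4 := tendsto_inner (A := A) h1 (tendsto_const_nhds (x := w))
    have h5 := tendsto_inner (A := A) h2 (tendsto_const_nhds (x := y))
    have h6 : ∀ n, inner A (p n).2 y = inner A (p n).1 w := fun n => hK (hp n) hw
    simp only [Function.comp_apply] at h4 h5
    rw [funext h6] at h5
    rw [tendsto_nhds_unique h5 h4]
    exact CStarModule.inner_zero_left
  have h4 : k ∈ {y : E | inner A k y = 0} := by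
    have hc : IsClosed {y : E | inner A k y = 0} :=
      isClosed_eq (CStarModule.innerSL (A := A) k).continuous continuous_const
    exact hc.closure_subset_iff.2 h3 (hd k)
  exact CStarModule.inner_self.1 h4

theorem closure {K : E →ₗ.[ℂ] E} (hK : IsSymm A K) (hd : Dense (K.domain : Set E)) :
    IsSymm A K.closure := by
  intro x k x' k' hk hk'
  rw [← (hK.isClosable hd).graph_closure_eq_closure_graph] at hk hk'
  obtain ⟨p, hp, hpx⟩ := mem_closure_iff_seq_limit.1 hk
  obtain ⟨p', hp', hpx'⟩ := mem_closure_iff_seq_limit.1 hk'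
  have h1 := tendsto_inner (A := A) ((continuous_snd.tendsto _).comp hpx)
    ((continuous_fst.tendsto _).comp hpx')
  have h2 := tendsto_inner (A := A) ((continuous_fst.tendsto _).comp hpx)
    ((continuous_snd.tendsto _).comp hpx')
  have h3 : ∀ n, inner A (p n).2 (p' n).1 = inner A (p n).1 (p' n).2 := fun n => hK (hp n) (hp' n)
  simp only [Function.comp_apply] at h1 h2
  rw [funext h3] at h1
  exact tendsto_nhds_unique h1 h2

theorem add (hS : IsSymm A S) (hT : IsSymm A T) : IsSymm A (S + T) := by
  intro x y x' y' h h'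
  obtain ⟨a, b, ha, hb, rfl⟩ := mem_graph_add.1 h
  obtain ⟨a', b', ha', hb', rfl⟩ := mem_graph_add.1 h'
  rw [CStarModule.inner_add_left, CStarModule.inner_add_right, hS ha ha', hT hb hb']

end IsSymm

variable [CompleteSpace E]

theorem IsSelfAdjointRegular.smul (hS : IsSelfAdjointRegular A S) {r : ℝ} (hr : r ≠ 0) :
    IsSelfAdjointRegular A ((r : ℂ) • S) := by
  have hsymm : IsSymm A ((r : ℂ) • S) := by
    intro x y x' y' h h'
    obtain ⟨a, ha, rfl⟩ := mem_graph_smul.1 h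
    obtain ⟨a', ha', rfl⟩ := mem_graph_smul.1 h'
    rw [Complex.coe_smul, Complex.coe_smul, CStarModule.inner_smul_left_real,
      CStarModule.inner_smul_right_real, hS.isSymm ha ha']
  have honto : ∀ t : ℝ, t ≠ 0 → Onto ((r : ℂ) • S) t := by
    intro t ht w
    obtain ⟨x, hx⟩ := hS.onto (div_ne_zero ht hr) ((r⁻¹ : ℂ) • w)
    refine ⟨x, mem_graph_smul.2 ⟨_, hx, ?_⟩⟩
    have hr' : (r : ℂ) ≠ 0 := by exact_mod_cast hr
    rw [smul_sub, smul_smul, smul_smul, mul_inv_cancel₀ hr', one_smul]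
    congr 2
    simp only [imag]
    push_cast
    field_simp
  exact hsymm.isSelfAdjointRegular hS.dense_domain one_pos (honto 1 one_ne_zero)
    (honto (-1) (by norm_num))

theorem anticomm_smul_iff {r : ℝ} (hr : r ≠ 0) {x s t k : E} :
    Anticomm ((r : ℂ) • S) ((r : ℂ) • T) x s t k ↔
      ∃ s' t' k', Anticomm S T x s' t' k' ∧ s = (r : ℂ) • s' ∧ t = (r : ℂ) • t' ∧
        k = ((r ^ 2 : ℝ) : ℂ) • k' := by
  have hr' : (r : ℂ) ≠ 0 := by exact_mod_cast hr
  constructor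
  · rintro ⟨hs, ht, st, ts, hst, hts, rfl⟩
    obtain ⟨s', hs', rfl⟩ := mem_graph_smul.1 hs
    obtain ⟨t', ht', rfl⟩ := mem_graph_smul.1 ht
    obtain ⟨a, ha, rfl⟩ := mem_graph_smul.1 hst
    obtain ⟨b, hb, rfl⟩ := mem_graph_smul.1 hts
    have ha' := graph_smul (r⁻¹ : ℂ) ha
    have hb' := graph_smul (r⁻¹ : ℂ) hb
    rw [smul_smul, inv_mul_cancel₀ hr', one_smul] at ha' hb'
    refine ⟨s', t', _, ⟨hs', ht', _, _, ha', hb', rfl⟩, rfl, rfl, ?_⟩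
    rw [← smul_add, ← smul_add, smul_smul]
    congr 1
    push_cast
    field_simp
  · rintro ⟨s', t', k', ⟨hs, ht, st, ts, hst, hts, rfl⟩, rfl, rfl, rfl⟩
    refine ⟨mem_graph_smul.2 ⟨_, hs, rfl⟩, mem_graph_smul.2 ⟨_, ht, rfl⟩, (r : ℂ) • (r : ℂ) • st,
      (r : ℂ) • (r : ℂ) • ts, mem_graph_smul.2 ⟨_, graph_smul _ hst, rfl⟩,
      mem_graph_smul.2 ⟨_, graph_smul _ hts, rfl⟩, ?_⟩
    rw [← smul_add, ← smul_add, smul_smul]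
    congr 1
    push_cast
    ring

namespace AnticommPair

/-- Anticommutators scale by `r²`, and `|r| ≤ 1` absorbs the leftover factor `r²` on `⟨x, x⟩`. The
threshold is unchanged since `(rS + iτ)⁻¹ = r⁻¹(S + iτ/r)⁻¹` and `|τ/r| ≥ |τ|`. -/
theorem smul (h : AnticommPair A S T κ t₀) {r : ℝ} (hr : r ≠ 0) (hr1 : |r| ≤ 1) :
    AnticommPair A ((r : ℂ) • S) ((r : ℂ) • T) (r ^ 2 * κ) t₀ where
  left := h.left.smul hr
  right := h.right.smul hr
  pos := mul_pos (by positivity) h.pos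
  bound := by
    intro x s t k hk
    obtain ⟨s', t', k', hk', rfl, rfl, rfl⟩ := (anticomm_smul_iff hr).1 hk
    have hr2 : r ^ 2 ≤ 1 := (sq_le_one_iff_abs_le_one r).2 hr1
    simp only [Complex.coe_smul, CStarModule.inner_smul_left_real,
      CStarModule.inner_smul_right_real, smul_smul]
    refine (smul_le_smul_of_nonneg_left (h.bound hk') (by positivity)).trans ?_
    rw [smul_smul, smul_add, smul_add, smul_add, smul_add, smul_smul, smul_smul]
    refine add_le_add (add_le_add ?_ (le_of_eq ?_)) (le_of_eq ?_)
    · refine smul_le_smul_of_nonneg_right ?_ CStarModule.inner_self_nonneg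
      have := mul_nonneg (sq_nonneg r) h.pos.le
      nlinarith
    · congr 1; ring
    · congr 1; ring
  one_le := h.one_le
  sqrt_le := by
    refine le_trans ?_ h.sqrt_le
    have hr2 : r ^ 2 ≤ 1 := (sq_le_one_iff_abs_le_one r).2 hr1
    gcongr
    exact mul_le_of_le_one_left h.pos.le hr2
  res_mem := by
    intro τ hτ x hx
    have hτ0 := h.ne_zero hτ
    have h1 : t₀ ≤ |τ / r| := by
      rw [abs_div, le_div_iff₀ (abs_pos.2 hr)]
      exact (mul_le_of_le_one_right (by linarith [h.one_le]) hr1).trans hτ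
    obtain ⟨s, t, k, hk⟩ := h.res_mem h1 (x := x) hx
    have hr' : (r : ℂ) ≠ 0 := by exact_mod_cast hr
    have e : (res A ((r : ℂ) • S) τ).1 x = (r⁻¹ : ℂ) • (res A S (τ / r)).1 x := by
      refine (h.left.smul hr).res_eq hτ0 (mem_graph_smul.2
        ⟨_, graph_smul (r⁻¹ : ℂ) (h.left.res_mem (div_ne_zero hτ0 hr) x), ?_⟩)
      rw [smul_inv_smul₀ hr', smul_smul]
      congr 2
      simp only [imag]
      push_cast
      field_simp
    rw [e]
    exact ⟨_, _, _, (anticomm_smul_iff hr).2 ⟨_, _, _, hk.smul _, rfl, rfl, rfl⟩⟩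

theorem weaklyAnticommuting (h : AnticommPair A S T κ t₀) : WeaklyAnticommuting A S T where
  left := h.left
  right := h.right
  form_bound := by
    refine ⟨κ, κ, κ, h.pos, h.pos, h.pos, fun x hx hS hT => ?_⟩
    obtain ⟨k, hk⟩ := exists_mem_graph hx
    obtain ⟨s, t, hst⟩ := mem_graph_anticomm.1 hk
    rw [apply_eq_of_mem_graph hk hx, apply_eq_of_mem_graph hst.1 hS,
      apply_eq_of_mem_graph hst.2.1 hT, ← smul_add, ← smul_add]
    exact h.bound hst
  resolvent_core := by
    -- The whole of `dom T` serves as the core.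
    refine ⟨T.domain, ⟨le_rfl, ?_⟩, t₀, by linarith [h.one_le], fun t ht x hx => ?_⟩
    · have e : T.domRestrict T.domain = T :=
        LinearPMap.eq_of_le_of_domain_eq LinearPMap.domRestrict_le (inf_idem _)
      rw [e]
      apply LinearPMap.eq_of_eq_graph
      rw [← h.right.isClosed.isClosable.graph_closure_eq_closure_graph]
      exact h.right.isClosed.submodule_topologicalClosure_eq
    · obtain ⟨s, t', k, hk⟩ := h.res_mem ht hx
      have := h.left.res_apply_shift (h.ne_zero ht) (S.mem_graph x)
      rw [imag] at this
      rw [this] at hk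
      exact LinearPMap.mem_domain_of_mem_graph (mem_graph_anticomm.2 ⟨_, _, hk⟩)

/-- `S + T` and `S - T` are closed on `dom S ∩ dom T`. -/
theorem exists_limit (h : AnticommPair A S T κ t₀) {u s t : ℕ → E} {x w : E}
    (hs : ∀ n, (u n, s n) ∈ S.graph) (ht : ∀ n, (u n, t n) ∈ T.graph)
    (hu : Tendsto u atTop (𝓝 x))
    (hw : Tendsto (fun n => s n + t n) atTop (𝓝 w) ∨ Tendsto (fun n => s n - t n) atTop (𝓝 w)) :
    ∃ y z, (x, y) ∈ S.graph ∧ (x, z) ∈ T.graph ∧ Tendsto s atTop (𝓝 y) ∧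
      Tendsto t atTop (𝓝 z) := by
  have hκ := h.pos
  -- The zero vector fills the third slot of `norm_le_of_inner_le_smul`, and `κ + 3` dominates both
  -- `2` and `κ + 1`.
  have key : ∃ v : ℕ → E, CauchySeq v ∧ ∀ m n,
      inner A (s m - s n) (s m - s n) + inner A (t m - t n) (t m - t n) ≤
        (κ + 3) • (inner A (u m - u n) (u m - u n) + inner A (v m - v n) (v m - v n)
          + inner A (0 : E) 0) := by
    have hle : ∀ a b : E, (2 : ℝ) • inner A a a + (κ + 1) • inner A b b ≤
        (κ + 3) • (inner A b b + inner A a a + inner A (0 : E) 0) := by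
      intro a b
      rw [CStarModule.inner_zero_left, add_zero, smul_add, add_comm]
      refine add_le_add ?_ ?_
      · exact smul_le_smul_of_nonneg_right (by linarith) CStarModule.inner_self_nonneg
      · exact smul_le_smul_of_nonneg_right (by linarith) CStarModule.inner_self_nonneg
    rcases hw with hw | hw
    · refine ⟨_, hw.cauchySeq, fun m n => ?_⟩
      refine ((h.inner_add_le (graph_sub (hs m) (hs n)) (graph_sub (ht m) (ht n))).1).trans ?_
      rw [show s m - s n + (t m - t n) = s m + t m - (s n + t n) by abel]
      exact hle _ _
    · refine ⟨_, hw.cauchySeq, fun m n => ?_⟩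
      refine ((h.inner_add_le (graph_sub (hs m) (hs n)) (graph_sub (ht m) (ht n))).2).trans ?_
      rw [show s m - s n - (t m - t n) = s m - t m - (s n - t n) by abel]
      exact hle _ _
  obtain ⟨v, hv, hb⟩ := key
  have hcauchy : ∀ f : ℕ → E, (∀ m n, inner A (f m - f n) (f m - f n) ≤
      inner A (s m - s n) (s m - s n) + inner A (t m - t n) (t m - t n)) → CauchySeq f := by
    intro f hf
    rw [Metric.cauchySeq_iff]
    intro ε hε
    have hc : 0 < ε / √(κ + 3) / 2 := by positivity
    obtain ⟨N₁, h₁⟩ := Metric.cauchySeq_iff.1 hu.cauchySeq _ hc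
    obtain ⟨N₂, h₂⟩ := Metric.cauchySeq_iff.1 hv _ hc
    refine ⟨max N₁ N₂, fun m hm n hn => ?_⟩
    simp only [ge_iff_le, max_le_iff] at hm hn
    have h3 := h₁ m hm.1 n hn.1
    have h4 := h₂ m hm.2 n hn.2
    rw [dist_eq_norm] at h3 h4 ⊢
    have h5 := norm_le_of_inner_le_smul (by linarith) ((hf m n).trans (hb m n))
    rw [norm_zero, add_zero] at h5
    have h6 : ‖u m - u n‖ + ‖v m - v n‖ < ε / √(κ + 3) := by linarith
    rw [lt_div_iff₀ (by positivity)] at h6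
    linarith
  obtain ⟨y, hy⟩ := cauchySeq_tendsto_of_complete (hcauchy s fun m n =>
    le_add_of_nonneg_right CStarModule.inner_self_nonneg)
  obtain ⟨z, hz⟩ := cauchySeq_tendsto_of_complete (hcauchy t fun m n =>
    le_add_of_nonneg_left CStarModule.inner_self_nonneg)
  exact ⟨y, z, h.left.graph_of_tendsto hs hu hy, h.right.graph_of_tendsto ht hu hz, hy, hz⟩

/-- The range is dense. It is also closed, as `S + T` is closed and `S + T + im` is bounded below by
`|m|`. -/
theorem onto_add (h : AnticommPair A S T κ t₀) {m : ℝ} (hm : 144 * √κ ≤ m) : Onto (S + T) m := by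
  have hsymm := h.left.isSymm.add h.right.isSymm
  have hm0 : 0 < |m| := abs_pos.2 (by
    have := Real.sqrt_pos.2 h.pos
    intro h0
    linarith)
  intro w
  obtain ⟨v, hv, hvw⟩ := mem_closure_iff_seq_limit.1 (h.dense_range_add hm w)
  choose u hu using hv
  have hc : CauchySeq u := by
    rw [Metric.cauchySeq_iff]
    intro ε hε
    obtain ⟨N, hN⟩ := Metric.cauchySeq_iff.1 hvw.cauchySeq (|m| * ε) (by positivity)
    refine ⟨N, fun p hp q hq => ?_⟩
    have h1 := hN p hp q hq
    have h2 := hsymm.shift_sub_le m (hu p) (hu q)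
    rw [dist_eq_norm] at h1 ⊢
    exact lt_of_mul_lt_mul_left (h2.trans_lt h1) hm0.le
  obtain ⟨x, hx⟩ := cauchySeq_tendsto_of_complete hc
  choose s t hs ht hst using fun n => mem_graph_add.1 (hu n)
  have hlim : Tendsto (fun n => s n + t n) atTop (𝓝 (w - imag m • x)) := by
    rw [← funext hst]
    exact hvw.sub (hx.const_smul _)
  obtain ⟨y, z, hy, hz, hsy, htz⟩ := h.exists_limit hs ht hx (Or.inl hlim)
  exact ⟨x, mem_graph_add.2 ⟨y, z, hy, hz, tendsto_nhds_unique hlim (hsy.add htz)⟩⟩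

theorem isSelfAdjointRegular_add (h : AnticommPair A S T κ t₀) :
    IsSelfAdjointRegular A (S + T) := by
  have hκ := Real.sqrt_pos.2 h.pos
  refine (h.left.isSymm.add h.right.isSymm).isSelfAdjointRegular (t := 144 * √κ) ?_
    (by positivity) (h.onto_add le_rfl) ?_
  · refine h.dense_anticomm_domain.mono fun x hx => ?_
    obtain ⟨k, hk⟩ := exists_mem_graph hx
    obtain ⟨s, t, hst⟩ := mem_graph_anticomm.1 hk
    exact ⟨LinearPMap.mem_domain_of_mem_graph hst.1, LinearPMap.mem_domain_of_mem_graph hst.2.1⟩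
  · intro w
    -- The point `-im` is reached by applying `onto_add` to `(-S, -T)`, whose constant is again `κ`.
    have h1 := h.smul (r := -1) (by norm_num) (by norm_num)
    obtain ⟨x, hx⟩ := h1.onto_add (m := 144 * √κ) (by norm_num) (-w)
    obtain ⟨a, b, ha, hb, hab⟩ := mem_graph_add.1 hx
    obtain ⟨s, hs, rfl⟩ := mem_graph_smul.1 ha
    obtain ⟨t, ht, rfl⟩ := mem_graph_smul.1 hb
    refine ⟨x, mem_graph_add.2 ⟨s, t, hs, ht, ?_⟩⟩
    rw [← smul_add] at hab
    simp only [Complex.ofReal_neg, Complex.ofReal_one, neg_smul, one_smul] at hab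
    rw [imag_neg, neg_smul, ← neg_neg (s + t), ← hab]
    abel

/-- The closure of the anticommutator is defined on `dom S ∩ dom T` and bounded there relative
to `S + T`. -/
theorem exists_closure (h : AnticommPair A S T κ t₀) {x s t : E} (hs : (x, s) ∈ S.graph)
    (ht : (x, t) ∈ T.graph) : ∃ k, (x, k) ∈ (anticomm S T).closure.graph ∧
      inner A k k ≤ (κ * (κ + 2)) • (inner A x x + inner A (s + t) (s + t)) := by
  obtain ⟨u', s', t', k', w, hk, hu, hs', ht', hw⟩ := h.exists_seq hs ht
  refine ⟨w, ?_, ?_⟩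
  · rw [← (h.isSymm_anticomm.isClosable
      h.dense_anticomm_domain).graph_closure_eq_closure_graph]
    exact mem_closure_of_tendsto (hu.prodMk_nhds hw)
      (Eventually.of_forall fun n => mem_graph_anticomm.2 ⟨_, _, hk n⟩)
  · have h1 : inner A w w ≤ κ • (inner A x x + inner A s s + inner A t t) :=
      le_of_tendsto_of_tendsto' (tendsto_inner hw hw)
        ((((tendsto_inner hu hu).add (tendsto_inner hs' hs')).add
          (tendsto_inner ht' ht')).const_smul κ) fun n => h.bound (hk n)
    have h2 := smul_le_smul_of_nonneg_left (add_le_add_right (h.inner_add_le hs ht).1 (inner A x x))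
      h.pos.le
    rw [← add_assoc] at h2
    refine (h1.trans h2).trans ?_
    -- The direct bound is `κ(κ + 2)⟨x, x⟩ + 2κ⟨Dx, Dx⟩`. Adding `κ²⟨Dx, Dx⟩` equalizes the
    -- coefficients.
    have h3 : (0 : A) ≤ (κ ^ 2) • inner A (s + t) (s + t) :=
      smul_nonneg (sq_nonneg κ) CStarModule.inner_self_nonneg
    rw [← sub_nonneg]
    convert h3 using 1
    module

/-- The domain of `(S + T)²` is contained in the domain of the anticommutator. -/
theorem exists_anticomm (h : AnticommPair A S T κ t₀) {x d d' : E}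
    (hd : (x, d) ∈ (S + T).graph) (hd' : (d, d') ∈ (S + T).graph) :
    ∃ s t k, Anticomm S T x s t k := by
  obtain ⟨s, t, hs, ht, rfl⟩ := mem_graph_add.1 hd
  obtain ⟨s', t', hs', ht', rfl⟩ := mem_graph_add.1 hd'
  have h0 : 0 < t₀ := by linarith [h.one_le]
  set c : ℕ → ℝ := fun n => t₀ + n with hcdef
  have hc₀ : ∀ n : ℕ, t₀ ≤ |c n| := fun n => by
    rw [abs_of_nonneg (by positivity)]; linarith [n.cast_nonneg (α := ℝ)]
  have hc : Tendsto (fun n : ℕ => |c n|) atTop atTop :=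
    tendsto_abs_atTop_atTop.comp (tendsto_atTop_add_const_left _ _ tendsto_natCast_atTop_atTop)
  have hcn₀ : ∀ n : ℕ, t₀ ≤ |-c n| := fun n => by rw [abs_neg]; exact hc₀ n
  have hcn : Tendsto (fun n : ℕ => |-c n|) atTop atTop := by simpa using hc
  have hc0 : ∀ n, c n ≠ 0 := fun n => h.ne_zero (hc₀ n)
  have hcn0 : ∀ n, -c n ≠ 0 := fun n => h.ne_zero (hcn₀ n)
  -- With `P = ic(S + ic)⁻¹` and `Q = -ic(S - ic)⁻¹`, the vector `x` is regularized by `Q` and then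
  -- `P`. Then `T(PQx)` is `QPt` plus resolvents of `k₁` and `k₂`, so `PQs + T(PQx)` is `PQ(s + t)`
  -- plus vectors in `dom S`.
  obtain ⟨t₁, k₁, w₁, hk₁, ht₁, htt₁, hw₁⟩ := h.tendsto_smul_res hcn₀ hcn (fun _ => hs)
    (fun _ => ht) tendsto_const_nhds tendsto_const_nhds tendsto_const_nhds
  have hu₁ := h.left.tendsto_imag_smul_res hcn0 hcn (tendsto_const_nhds (x := x))
  have hs₁ := h.left.tendsto_imag_smul_res hcn0 hcn (tendsto_const_nhds (x := s))
  obtain ⟨t₂, k₂, w₂, hk₂, ht₂, htt₂, hw₂⟩ := h.tendsto_smul_res hc₀ hc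
    (fun n => (hk₁ n).1) (fun n => (hk₁ n).2.1) hu₁ hs₁ htt₁
  have hs₂ := h.left.tendsto_imag_smul_res hc0 hc hs₁
  simp only [neg_neg] at ht₁
  choose st ts hst hts hk₂' using fun n => (hk₂ n).2.2
  have hP : ∀ {τ : ℝ}, τ ≠ 0 → ∀ {y z : E}, (y, z) ∈ S.graph →
      ((imag τ • res A S τ).1 y, (imag τ • res A S τ).1 z) ∈ S.graph := fun hτ _ _ hyz =>
    graph_smul _ (h.left.res_graph hτ hyz)
  have hcomm : ∀ n y, (imag (-c n) • res A S (-c n)).1 ((imag (c n) • res A S (c n)).1 y)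
      = (imag (c n) • res A S (c n)).1 ((imag (-c n) • res A S (-c n)).1 y) := fun n y =>
    congrArg (fun L : Adjointable A E => L.1 y)
      (((h.left.res_commute (hcn0 n) (hc0 n)).smul_left (imag (-c n))).smul_right
        (imag (c n))).eq
  have hf : ∀ n, ((imag (c n) • res A S (c n)).1 ((imag (-c n) • res A S (-c n)).1 s) + t₂ n,
      (imag (c n) • res A S (c n)).1 ((imag (-c n) • res A S (-c n)).1 s')
        + (imag (-c n) • res A S (-c n)).1 (k₁ n - (imag (c n) • res A S (c n)).1 (k₁ n))
        + (k₂ n - (imag (-c n) • res A S (-c n)).1 (k₂ n))) ∈ S.graph := fun n => by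
    convert graph_add (graph_add (hP (hc0 n) (hP (hcn0 n) hs'))
      (hP (hcn0 n) (h.left.res_mem (hc0 n) (k₁ n)))) (h.left.res_mem (hcn0 n) (k₂ n)) using 2
    · rw [ht₂ n, ht₁ n, map_add, map_add, map_add, hcomm]
      abel
    · rfl
  have hlim := ((h.left.tendsto_imag_smul_res hc0 hc
      (h.left.tendsto_imag_smul_res hcn0 hcn (tendsto_const_nhds (x := s')))).add
    (h.left.tendsto_imag_smul_res hcn0 hcn
      (hw₁.sub (h.left.tendsto_imag_smul_res hc0 hc hw₁)))).add
    (hw₂.sub (h.left.tendsto_imag_smul_res hcn0 hcn hw₂))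
  have hg : ∀ n, ((imag (c n) • res A S (c n)).1 ((imag (-c n) • res A S (-c n)).1 s),
      (imag (c n) • res A S (c n)).1 ((imag (-c n) • res A S (-c n)).1 s')
        + (imag (-c n) • res A S (-c n)).1 (k₁ n - (imag (c n) • res A S (c n)).1 (k₁ n))
        + (k₂ n - (imag (-c n) • res A S (-c n)).1 (k₂ n)) - st n) ∈ S.graph := fun n => by
    have := graph_sub (hf n) (hst n)
    rwa [add_sub_cancel_right] at this
  -- Subtracting `k₂ = S(T(PQx)) + T(PQs)` from `S(PQs + T(PQx))` leaves `(S - T)(PQs)`, which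
  -- therefore converges. As `S - T` is closed on `dom S ∩ dom T`, the limit `s` lies there, and
  -- then `t = (s + t) - s` lies in `dom S`.
  obtain ⟨y, z, hy, hz, -, -⟩ := h.exists_limit hg hts hs₂ (Or.inr ((hlim.sub hw₂).congr fun n => by
    rw [hk₂' n]
    abel))
  have hty := graph_sub hs' hy
  rw [add_sub_cancel_left] at hty
  exact ⟨s, t, _, hs, ht, _, _, hty, hz, rfl⟩

end AnticommPair

end Module

/-! ### Order inequalities in C⋆-algebras -/

section CStar

variable {V : Type*} [CStarAlgebra V] [PartialOrder V] [StarOrderedRing V]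

theorem cfc_sqrt_mul_self {a : V} (ha : 0 ≤ a) : cfc Real.sqrt a * cfc Real.sqrt a = a := by
  have hsa : IsSelfAdjoint a := IsSelfAdjoint.of_nonneg ha
  rw [← cfc_mul Real.sqrt Real.sqrt a (by fun_prop) (by fun_prop)]
  conv_rhs => rw [← cfc_id ℝ a]
  refine cfc_congr fun t ht => ?_
  exact Real.mul_self_sqrt (spectrum_nonneg_of_nonneg ha ht)

theorem cfc_abs_mul_self {a : V} (ha : IsSelfAdjoint a) :
    cfc (fun t : ℝ => |t|) a * cfc (fun t : ℝ => |t|) a = a * a := by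
  rw [← cfc_mul (fun t : ℝ => |t|) (fun t : ℝ => |t|) a (by fun_prop) (by fun_prop)]
  conv_rhs => rw [← cfc_id ℝ a, ← cfc_mul id id a (by fun_prop) (by fun_prop)]
  exact cfc_congr fun t _ => abs_mul_abs_self t

theorem mul_self_le_self {a : V} (ha : 0 ≤ a) (ha1 : a ≤ 1) : a * a ≤ a := by
  have h := Commute.mul_nonneg ha (sub_nonneg.2 ha1) ((Commute.one_right a).sub_right (.refl a))
  rwa [mul_sub, mul_one, sub_nonneg] at h

theorem le_one_of_mul_self_add {a b : V} (ha : 0 ≤ a) (hb : 0 ≤ b)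
    (h : a * a + b * b = 1) : a ≤ 1 := by
  have hsa : IsSelfAdjoint a := IsSelfAdjoint.of_nonneg ha
  have hsb : IsSelfAdjoint b := IsSelfAdjoint.of_nonneg hb
  rw [← CStarAlgebra.norm_le_one_iff_of_nonneg a ha]
  have h1 : star a * a ≤ 1 := by
    rw [hsa.star_eq, ← h]
    refine le_add_of_nonneg_right ?_
    have := star_mul_self_nonneg b
    rwa [hsb.star_eq] at this
  have h2 := (CStarAlgebra.norm_le_one_iff_of_nonneg _ (star_mul_self_nonneg a)).2 h1
  rw [CStarRing.norm_star_mul_self] at h2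
  nlinarith [norm_nonneg a]

/-- Both elements are at most `1`, so each dominates its square. -/
theorem one_le_add_of_mul_self_add {a b : V} (ha : 0 ≤ a) (hb : 0 ≤ b)
    (h : a * a + b * b = 1) : 1 ≤ a + b := by
  rw [← h]
  exact add_le_add (mul_self_le_self ha (le_one_of_mul_self_add ha hb h))
    (mul_self_le_self hb (le_one_of_mul_self_add hb ha (by rw [add_comm, h])))

theorem le_mul_self_add_mul {a b : V} (ha : 0 ≤ a) (hb : 0 ≤ b) (hab : Commute a b)
    (h : a * a + b * b = 1) : a ≤ a * a + a * b := by
  have h1 := Commute.mul_nonneg ha (sub_nonneg.2 (one_le_add_of_mul_self_add ha hb h))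
    (((Commute.refl a).add_right hab).sub_right (Commute.one_right a))
  rwa [mul_sub, mul_one, mul_add, sub_nonneg] at h1

/-- Operator monotonicity of the square root bounds `|H|` by `cr`, and both `H` and `-H` are at most
`|H|`. No commutation of `H` with `r` is needed. -/
theorem le_of_mul_self_le {H r : V} {c : ℝ} (hc : 0 ≤ c) (hH : IsSelfAdjoint H) (hr : 0 ≤ r)
    (h : H * H ≤ (c ^ 2) • (r * r)) : H ≤ c • r ∧ -H ≤ c • r := by
  have hcr : 0 ≤ c • r := smul_nonneg hc hr
  have habs : CFC.abs H ≤ c • r := by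
    have e : CFC.sqrt ((c • r) * (c • r)) = c • r := CFC.sqrt_mul_self _
    rw [← e, CFC.abs]
    refine CFC.sqrt_le_sqrt _ _ ?_
    rw [hH.star_eq, smul_mul_smul_comm, ← sq c]
    exact h
  have key : ∀ K : V, IsSelfAdjoint K → K ≤ CFC.abs K := by
    intro K hK
    rw [← sub_nonneg, CFC.abs_sub_self K]
    exact smul_nonneg (by norm_num) (CFC.negPart_nonneg K)
  refine ⟨(key H hH).trans habs, (key (-H) hH.neg).trans ?_⟩
  rwa [CFC.abs_neg]

end CStar

/-! ### The resolvent of D² and its square root -/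

section Module

variable {A E : Type*} [NonUnitalCStarAlgebra A] [PartialOrder A] [StarOrderedRing A]
  [SMul A E] [NormedAddCommGroup E] [NormedSpace ℂ E] [CStarModule A E] [CompleteSpace E]
  {D : E →ₗ.[ℂ] E}

theorem IsBddInverse.unique {P : E →ₗ.[ℂ] E} {R R' : Adjointable A E} (h : IsBddInverse P R)
    (h' : IsBddInverse P R') : R = R' := by
  refine Adjointable.ext fun x => ?_
  obtain ⟨y, hy, hy'⟩ := mem_graph_pcomp.1 (ofBdd_eq_iff.1 h.1.symm x)
  rw [mem_graph_ofBdd] at hy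
  subst hy
  have := h'.2 ⟨_, LinearPMap.mem_domain_of_mem_graph hy'⟩
  rw [apply_eq_of_mem_graph hy'] at this
  exact this.symm

theorem bddInv_eq {P : E →ₗ.[ℂ] E} {R : Adjointable A E} (h : IsBddInverse P R) :
    bddInv A P = R := by
  have hex : ∃ R : Adjointable A E, IsBddInverse P R := ⟨R, h⟩
  rw [bddInv, dif_pos hex]
  exact hex.choose_spec.unique h

variable (A D) in
theorem sqrtResolvent_nonneg : 0 ≤ sqrtResolvent A D :=
  cfc_nonneg fun t _ => Real.sqrt_nonneg t

variable (A D) in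
theorem star_sqrtResolvent :
    star (sqrtResolvent A D) = sqrtResolvent A D :=
  (IsSelfAdjoint.of_nonneg (sqrtResolvent_nonneg A D)).star_eq

namespace IsSelfAdjointRegular

/-- This is `D²(1 + D²/n²)⁻¹ = n²(1 - (1 + D²/n²)⁻¹)`, obtained from resolvents at `±in`. -/
theorem mulReg_graph (hD : IsSelfAdjointRegular A D) {n : ℝ} (hn : n ≠ 0) (x : E) :
    ((mulReg A D n).1 x, ((n ^ 2 : ℝ) : ℂ) • (x - (reg A D n).1 x)) ∈ D.graph := by
  have h1 := graph_smul ((n ^ 2 / 2 : ℝ) : ℂ)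
    (graph_add (hD.res_mem hn x) (hD.res_mem (neg_ne_zero.2 hn) x))
  have h2 : (res A D n).1 x - (res A D (-n)).1 x
      = (imag (-n - n) • (res A D n * res A D (-n))).1 x := by
    rw [← hD.res_sub_res hn (neg_ne_zero.2 hn)]; rfl
  convert h1 using 2
  · rfl
  · rw [reg_eq]
    simp only [Adjointable.smul_apply, Adjointable.mul_apply, imag_neg] at h2 ⊢
    have h4 : imag (-n - n) = -2 * imag n := by simp only [imag]; push_cast; ring
    have h5 : imag n * imag n = -((n : ℂ) ^ 2) := by
      simp only [imag]; linear_combination (n : ℂ) ^ 2 * Complex.I_sq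
    rw [h4, sub_eq_iff_eq_add] at h2
    rw [h2]
    generalize (res A D n).1 ((res A D (-n)).1 x) = w
    generalize (res A D (-n)).1 x = v
    have h6 : imag n • imag n • w = -(((n : ℂ) ^ 2) • w) := by rw [smul_smul, h5, neg_smul]
    push_cast
    linear_combination (norm := module) (-(n : ℂ) ^ 2) • h6

theorem eq_zero_of_onePlusSq (hD : IsSelfAdjointRegular A D) {μ : ℝ} {z : E}
    (h : (z, (0 : E)) ∈ (onePlusSq μ D).graph) : z = 0 := by
  obtain ⟨a, b, hza, hab, h0⟩ := mem_graph_onePlusSq.1 h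
  have h1 : inner A z z + (μ ^ 2) • inner A a a = 0 := by
    rw [hD.isSymm hza hab, ← CStarModule.inner_smul_right_real, ← CStarModule.inner_add_right,
      ← Complex.coe_smul, ← h0, CStarModule.inner_zero_right]
  have h2 : 0 ≤ (μ ^ 2) • inner A a a := smul_nonneg (sq_nonneg μ) CStarModule.inner_self_nonneg
  exact CStarModule.inner_self.1 (le_antisymm (h1 ▸ le_add_of_nonneg_right h2)
    CStarModule.inner_self_nonneg)

theorem isBddInverse_reg (hD : IsSelfAdjointRegular A D) {μ : ℝ} (hμ : μ ≠ 0) :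
    IsBddInverse (onePlusSq μ D) (reg A D μ⁻¹) := by
  have hn := inv_ne_zero hμ
  have key : ∀ x, ((reg A D μ⁻¹).1 x, x) ∈ (onePlusSq μ D).graph := fun x => by
    refine mem_graph_onePlusSq.2 ⟨_, _, hD.reg_graph hn x, hD.mulReg_graph hn x, ?_⟩
    rw [smul_smul, ← Complex.ofReal_mul, inv_pow, mul_inv_cancel₀ (pow_ne_zero 2 hμ),
      Complex.ofReal_one, one_smul]
    abel
  refine ⟨(ofBdd_eq_iff.2 fun x => mem_graph_pcomp.2 ⟨_, mem_graph_ofBdd.2 rfl, key x⟩).symm,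
    fun x => ?_⟩
  have h := graph_sub (key (onePlusSq μ D x)) ((onePlusSq μ D).mem_graph x)
  rw [sub_self] at h
  exact sub_eq_zero.1 (hD.eq_zero_of_onePlusSq h)

theorem resolventSq_eq (hD : IsSelfAdjointRegular A D) {μ : ℝ} (hμ : μ ≠ 0) :
    resolventSq A μ D = reg A D μ⁻¹ :=
  bddInv_eq (hD.isBddInverse_reg hμ)

theorem resolventSq_one (hD : IsSelfAdjointRegular A D) :
    resolventSq A 1 D = reg A D 1 := by
  rw [hD.resolventSq_eq one_ne_zero, inv_one]

theorem reg_nonneg (hD : IsSelfAdjointRegular A D) {n : ℝ} (hn : n ≠ 0) : 0 ≤ reg A D n := by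
  have h := star_mul_self_nonneg (imag (-n) • res A D (-n))
  rwa [star_smul, hD.star_res (neg_ne_zero.2 hn), star_imag, neg_neg] at h

theorem sqrtResolvent_mul_self (hD : IsSelfAdjointRegular A D) :
    sqrtResolvent A D * sqrtResolvent A D = reg A D 1 := by
  rw [sqrtResolvent, hD.resolventSq_one]
  exact cfc_sqrt_mul_self (hD.reg_nonneg one_ne_zero)

theorem sqrtResolvent_commute (hD : IsSelfAdjointRegular A D) {X : Adjointable A E}
    (h : Commute (reg A D 1) X) : Commute (sqrtResolvent A D) X := by
  rw [sqrtResolvent, hD.resolventSq_one]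
  exact h.cfc_real _

theorem reg_injective (hD : IsSelfAdjointRegular A D) {n : ℝ} (hn : n ≠ 0) :
    Function.Injective (reg A D n).1 := by
  refine (injective_iff_map_eq_zero _).2 fun x hx => ?_
  have h := hD.reg_graph hn x
  have h2 := hD.mulReg_graph hn x
  have h0 : ((0 : E), (0 : E)) ∈ D.graph := D.graph.zero_mem
  rw [hx] at h
  have h3 := graph_unique h h0
  rw [h3, hx, sub_zero] at h2
  have h4 := graph_unique h2 h0
  exact (smul_eq_zero_iff_right (by exact_mod_cast pow_ne_zero 2 hn)).1 h4

theorem sqrtResolvent_injective (hD : IsSelfAdjointRegular A D) :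
    Function.Injective (sqrtResolvent A D).1 := by
  intro x y h
  refine hD.reg_injective one_ne_zero ?_
  rw [← hD.sqrtResolvent_mul_self]
  exact congrArg (sqrtResolvent A D).1 h

theorem dense_range_res (hD : IsSelfAdjointRegular A D) {t : ℝ} (ht : t ≠ 0) :
    DenseRange (res A D t).1 :=
  hD.dense_domain.mono fun x hx => ⟨_, hD.res_apply_shift ht (D.mem_graph ⟨x, hx⟩)⟩

theorem dense_range_sqrtResolvent (hD : IsSelfAdjointRegular A D) :
    DenseRange (sqrtResolvent A D).1 := by
  have h : DenseRange (reg A D 1).1 := by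
    have h1 := (hD.dense_range_res one_ne_zero).comp
      (hD.dense_range_res (neg_ne_zero.2 one_ne_zero)) (res A D 1).1.continuous
    rw [reg_eq]
    have e : ((1 ^ 2 : ℝ) : ℂ) = 1 := by norm_num
    rw [e, one_smul]
    exact h1
  refine h.mono ?_
  rintro _ ⟨x, rfl⟩
  exact ⟨(sqrtResolvent A D).1 x, congrArg (fun L : Adjointable A E => L.1 x)
    hD.sqrtResolvent_mul_self⟩

end IsSelfAdjointRegular

end Module

/-! ### The bounded transform and the absolute value -/

section Module

variable {A E : Type*} [NonUnitalCStarAlgebra A] [PartialOrder A] [StarOrderedRing A]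
  [SMul A E] [NormedAddCommGroup E] [NormedSpace ℂ E] [CStarModule A E] [CompleteSpace E]
  {D : E →ₗ.[ℂ] E}

/-- A pointwise given family of values `(r x, y)` in the graph of a symmetric operator, with `r`
bounded, comes from a bounded adjointable operator. -/
theorem IsSymm.exists_adjointable {K : E →ₗ.[ℂ] E} (hK : IsSymm A K)
    (hd : Dense (K.domain : Set E)) {r : Adjointable A E} (hr : star r = r) {c : ℝ}
    (h : ∀ x, ∃ y, (r.1 x, y) ∈ K.graph ∧ ‖y‖ ≤ c * ‖x‖) :
    ∃ B : Adjointable A E, ∀ x, (r.1 x, B.1 x) ∈ K.graph := by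
  choose b hb hbc using h
  let L : E →ₗ[ℂ] E :=
    { toFun := b
      map_add' := fun x y => graph_unique (hb (x + y))
        (by rw [map_add]; exact graph_add (hb x) (hb y))
      map_smul' := fun c x => graph_unique (hb (c • x))
        (by rw [map_smul]; exact graph_smul c (hb x)) }
  obtain ⟨B, hB⟩ := Adjointable.exists_of_dense (A := A) (L.mkContinuous c hbc) hd (fun y hy => by
    obtain ⟨z, hz⟩ := exists_mem_graph hy
    refine ⟨r.1 z, fun x => ?_⟩
    have h1 := hK (hb x) hz
    rw [← inner_star_right, hr] at h1
    exact h1)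
  exact ⟨B, fun x => by rw [hB]; exact hb x⟩

theorem commute_reg {X : Adjointable A E} {n : ℝ}
    (h1 : Commute (res A D n) X) (h2 : Commute (res A D (-n)) X) : Commute (reg A D n) X := by
  rw [reg_eq]
  exact (h1.mul_left h2).smul_left _

variable (A D) in
/-- The absolute value of the bounded transform. -/
abbrev absTransform : Adjointable A E :=
  cfc (fun t : ℝ => |t|) (boundedTransform A D)

variable (A D) in
theorem absTransform_nonneg : 0 ≤ absTransform A D :=
  cfc_nonneg fun t _ => abs_nonneg t

namespace IsSelfAdjointRegular

theorem mulReg_one_mul_self (hD : IsSelfAdjointRegular A D) :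
    mulReg A D 1 * mulReg A D 1 = reg A D 1 - reg A D 1 * reg A D 1 := by
  refine Adjointable.ext fun x => ?_
  have h1 := hD.reg_graph one_ne_zero ((mulReg A D 1).1 x)
  have h2 := hD.mulReg_graph one_ne_zero ((reg A D 1).1 x)
  have e : ((1 ^ 2 : ℝ) : ℂ) = 1 := by norm_num
  rw [e, one_smul] at h2
  have h3 : (mulReg A D 1).1 ((reg A D 1).1 x) = (reg A D 1).1 ((mulReg A D 1).1 x) :=
    congrArg (fun L : Adjointable A E => L.1 x) (hD.mulReg_commute one_ne_zero).eq
  rw [h3] at h2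
  exact graph_unique h1 h2

/-- With `ρ = (1 + D²)⁻¹`, the square of `Dρ` is `ρ - ρ² ≤ ρ`. This says that `D(1 + D²)^(-1/2)` is
contractive on the range of `(1 + D²)^(-1/2)`. -/
theorem norm_mulReg_one_le (hD : IsSelfAdjointRegular A D) (z : E) :
    ‖(mulReg A D 1).1 z‖ ≤ ‖(sqrtResolvent A D).1 z‖ := by
  refine norm_le_norm_of_inner_le A ?_
  have h1 : inner A ((mulReg A D 1).1 z) ((mulReg A D 1).1 z)
      = inner A ((sqrtResolvent A D).1 z) ((sqrtResolvent A D).1 z)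
        - inner A ((reg A D 1).1 z) ((reg A D 1).1 z) := by
    rw [← inner_star_right, ← inner_star_right, ← inner_star_right, hD.star_mulReg one_ne_zero,
      hD.star_reg one_ne_zero, star_sqrtResolvent, ← CStarModule.inner_sub_right]
    congr 1
    have h2 := hD.mulReg_one_mul_self
    rw [← hD.sqrtResolvent_mul_self] at h2
    rw [← hD.sqrtResolvent_mul_self]
    exact congrArg (fun L : Adjointable A E => L.1 z) h2
  rw [h1]
  exact sub_le_self _ CStarModule.inner_self_nonneg

/-- The claim holds for `x` in the dense range of `(1 + D²)^(-1/2)`, and closedness of `D` extends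
it to all `x`. -/
theorem exists_apply_sqrtResolvent (hD : IsSelfAdjointRegular A D) (x : E) :
    ∃ y, ((sqrtResolvent A D).1 x, y) ∈ D.graph ∧ ‖y‖ ≤ 1 * ‖x‖ := by
  obtain ⟨v, hv, hvx⟩ := mem_closure_iff_seq_limit.1 (hD.dense_range_sqrtResolvent x)
  choose z hz using hv
  obtain rfl : (fun n => (sqrtResolvent A D).1 (z n)) = v := funext hz
  have hc : CauchySeq fun n => (mulReg A D 1).1 (z n) := by
    rw [Metric.cauchySeq_iff]
    intro ε hε
    obtain ⟨N, hN⟩ := Metric.cauchySeq_iff.1 hvx.cauchySeq ε hε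
    refine ⟨N, fun p hp q hq => ?_⟩
    have h1 := hN p hp q hq
    rw [dist_eq_norm, ← map_sub] at h1 ⊢
    exact (hD.norm_mulReg_one_le _).trans_lt h1
  obtain ⟨y, hy⟩ := cauchySeq_tendsto_of_complete hc
  refine ⟨y, hD.graph_of_tendsto (fun n => hD.reg_graph one_ne_zero (z n)) ?_ hy, ?_⟩
  · rw [← hD.sqrtResolvent_mul_self]
    exact (sqrtResolvent A D).tendsto_apply hvx
  · rw [one_mul]
    exact le_of_tendsto_of_tendsto' hy.norm hvx.norm fun n => hD.norm_mulReg_one_le _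

theorem boundedTransform_graph (hD : IsSelfAdjointRegular A D) (x : E) :
    ((sqrtResolvent A D).1 x, (boundedTransform A D).1 x) ∈ D.graph := by
  obtain ⟨F, hF⟩ := hD.isSymm.exists_adjointable hD.dense_domain (star_sqrtResolvent A D)
    hD.exists_apply_sqrtResolvent
  have hex : ∃ F : Adjointable A E, ofBdd F = pcomp D (ofBdd (sqrtResolvent A D)) :=
    ⟨F, ofBdd_eq_iff.2 fun x => mem_graph_pcomp.2 ⟨_, mem_graph_ofBdd.2 rfl, hF x⟩⟩
  have h := ofBdd_eq_iff.1 hex.choose_spec x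
  rw [boundedTransform, dif_pos hex]
  obtain ⟨y, hy, hxy⟩ := mem_graph_pcomp.1 h
  rw [mem_graph_ofBdd] at hy
  rwa [hy] at hxy

theorem boundedTransform_mul_sqrtResolvent (hD : IsSelfAdjointRegular A D) :
    boundedTransform A D * sqrtResolvent A D = mulReg A D 1 := by
  refine Adjointable.ext fun x => ?_
  have h1 := hD.boundedTransform_graph ((sqrtResolvent A D).1 x)
  have h2 := hD.reg_graph one_ne_zero x
  rw [← hD.sqrtResolvent_mul_self] at h2
  exact graph_unique h1 h2

theorem graph_of_commute (hD : IsSelfAdjointRegular A D) {X : Adjointable A E}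
    (hX : Commute (res A D 1) X) {x y : E} (h : (x, y) ∈ D.graph) :
    (X.1 x, X.1 y) ∈ D.graph := by
  have h1 := hD.res_mem one_ne_zero (X.1 (y + imag 1 • x))
  have h2 : (res A D 1).1 (X.1 (y + imag 1 • x)) = X.1 x := by
    have h3 : (res A D 1).1 (X.1 (y + imag 1 • x)) = X.1 ((res A D 1).1 (y + imag 1 • x)) :=
      congrArg (fun L : Adjointable A E => L.1 (y + imag 1 • x)) hX.eq
    rw [h3, hD.res_apply_shift one_ne_zero h]
  rw [h2, map_add, map_smul, add_sub_cancel_right] at h1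
  exact h1

theorem commute_sqrtResolvent (hD : IsSelfAdjointRegular A D) {X : Adjointable A E}
    (h1 : Commute (res A D 1) X) (h2 : Commute (res A D (-1)) X) :
    Commute (sqrtResolvent A D) X :=
  hD.sqrtResolvent_commute (commute_reg h1 h2)

theorem commute_boundedTransform (hD : IsSelfAdjointRegular A D) {X : Adjointable A E}
    (h1 : Commute (res A D 1) X) (h2 : Commute (res A D (-1)) X) :
    Commute (boundedTransform A D) X := by
  refine Adjointable.ext fun x => ?_
  have h3 := hD.graph_of_commute h1 (hD.boundedTransform_graph x)
  have h4 := hD.boundedTransform_graph (X.1 x)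
  have h5 : (sqrtResolvent A D).1 (X.1 x) = X.1 ((sqrtResolvent A D).1 x) :=
    congrArg (fun L : Adjointable A E => L.1 x) (hD.commute_sqrtResolvent h1 h2).eq
  rw [h5] at h4
  exact graph_unique h4 h3

theorem sqrtResolvent_commute_res (hD : IsSelfAdjointRegular A D) {t : ℝ} (ht : t ≠ 0) :
    Commute (sqrtResolvent A D) (res A D t) :=
  hD.commute_sqrtResolvent (hD.res_commute one_ne_zero ht) (hD.res_commute (by norm_num) ht)

theorem boundedTransform_commute_res (hD : IsSelfAdjointRegular A D) {t : ℝ} (ht : t ≠ 0) :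
    Commute (boundedTransform A D) (res A D t) :=
  hD.commute_boundedTransform (hD.res_commute one_ne_zero ht) (hD.res_commute (by norm_num) ht)

theorem boundedTransform_commute (hD : IsSelfAdjointRegular A D) :
    Commute (boundedTransform A D) (sqrtResolvent A D) :=
  hD.commute_boundedTransform (hD.sqrtResolvent_commute_res one_ne_zero).symm
    (hD.sqrtResolvent_commute_res (by norm_num)).symm

theorem star_boundedTransform (hD : IsSelfAdjointRegular A D) :
    star (boundedTransform A D) = boundedTransform A D := by
  refine Adjointable.ext_on_dense hD.dense_domain fun x hx => ?_
  obtain ⟨y, hy⟩ := exists_mem_graph hx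
  have h1 := hD.graph_of_commute (hD.sqrtResolvent_commute_res one_ne_zero).symm hy
  rw [graph_unique (hD.boundedTransform_graph x) h1]
  refine eq_of_inner_left A fun z => ?_
  rw [inner_star_right, hD.isSymm (hD.boundedTransform_graph z) hy, ← inner_star_right,
    star_sqrtResolvent]

/-- Compare `rF²r = (Fr)²` with `r(1 - r²)r`, then cancel `r` on the left by injectivity and on the
right by density of its range. -/
theorem boundedTransform_mul_self (hD : IsSelfAdjointRegular A D) :
    boundedTransform A D * boundedTransform A D
      = 1 - sqrtResolvent A D * sqrtResolvent A D := by
  have hc := hD.boundedTransform_commute.eq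
  have h1 := hD.mulReg_one_mul_self
  rw [← hD.sqrtResolvent_mul_self, ← hD.boundedTransform_mul_sqrtResolvent] at h1
  refine Adjointable.ext_on_dense hD.dense_range_sqrtResolvent ?_
  rintro _ ⟨x, rfl⟩
  apply hD.sqrtResolvent_injective
  generalize boundedTransform A D = F at *
  generalize sqrtResolvent A D = r at *
  have h2 : r * (F * F) * r = r * (1 - r * r) * r := by
    calc r * (F * F) * r = (r * F) * (F * r) := by simp only [mul_assoc]
      _ = (F * r) * (F * r) := by rw [hc]
      _ = r * (1 - r * r) * r := by rw [h1]; noncomm_ring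
  exact congrArg (fun L : Adjointable A E => L.1 x) h2

/-- This is `(D + i)⁻¹ = (D - i)(1 + D²)⁻¹`. It shows that `dom D` is the range of `(1 +
D²)^(-1/2)`. -/
theorem res_one_eq (hD : IsSelfAdjointRegular A D) :
    res A D 1 = sqrtResolvent A D * (boundedTransform A D - imag 1 • sqrtResolvent A D) := by
  rw [mul_sub, ← hD.boundedTransform_commute.eq, hD.boundedTransform_mul_sqrtResolvent,
    mul_smul_comm, hD.sqrtResolvent_mul_self, mulReg, reg_eq]
  have h := hD.res_sub_res one_ne_zero (neg_ne_zero.2 one_ne_zero)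
  have e : imag (-1 - 1) = -2 * imag 1 := by simp only [imag]; push_cast; ring
  rw [e] at h
  push_cast
  linear_combination (norm := module) (1 / 2 : ℂ) • h

theorem exists_eq_sqrtResolvent (hD : IsSelfAdjointRegular A D) {x y : E}
    (h : (x, y) ∈ D.graph) :
    ∃ z, x = (sqrtResolvent A D).1 z ∧ y = (boundedTransform A D).1 z := by
  have h1 := hD.res_apply_shift one_ne_zero h
  rw [hD.res_one_eq] at h1
  refine ⟨(boundedTransform A D - imag 1 • sqrtResolvent A D).1 (y + imag 1 • x), h1.symm, ?_⟩
  have h2 := hD.boundedTransform_graph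
    ((boundedTransform A D - imag 1 • sqrtResolvent A D).1 (y + imag 1 • x))
  rw [show (sqrtResolvent A D).1
    ((boundedTransform A D - imag 1 • sqrtResolvent A D).1 (y + imag 1 • x)) = x from h1] at h2
  exact graph_unique h h2

theorem mul_self_add_absTransform_mul_self (hD : IsSelfAdjointRegular A D) :
    sqrtResolvent A D * sqrtResolvent A D + absTransform A D * absTransform A D = 1 := by
  rw [absTransform, cfc_abs_mul_self hD.star_boundedTransform, hD.boundedTransform_mul_self]
  abel

theorem sqrtResolvent_le (hD : IsSelfAdjointRegular A D) :
    sqrtResolvent A D ≤ sqrtResolvent A D * sqrtResolvent A D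
      + sqrtResolvent A D * absTransform A D :=
  le_mul_self_add_mul (sqrtResolvent_nonneg A D) (absTransform_nonneg A D)
    (hD.boundedTransform_commute.cfc_real _).symm hD.mul_self_add_absTransform_mul_self

theorem mem_graph_absOp (hD : IsSelfAdjointRegular A D) {x z : E} :
    (x, z) ∈ (absOp A D).graph ↔
      ∃ y, x = (sqrtResolvent A D).1 y ∧ z = (absTransform A D).1 y := by
  have hker : (ofBdd (sqrtResolvent A D)).toFun.ker = ⊥ := by
    refine LinearMap.ker_eq_bot'.2 fun y hy => ?_
    apply Subtype.ext
    exact hD.sqrtResolvent_injective (hy.trans (map_zero _).symm)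
  have h : ∀ y, (x, y) ∈ (ofBdd (sqrtResolvent A D)).inverse.graph ↔
      x = (sqrtResolvent A D).1 y := by
    intro y
    rw [LinearPMap.inverse_graph hker, ← mem_graph_ofBdd]
    constructor
    · rintro ⟨⟨a, b⟩, hab, e⟩
      obtain ⟨rfl, rfl⟩ := Prod.mk.inj e
      exact hab
    · intro hyx
      exact ⟨(y, x), hyx, rfl⟩
  rw [absOp, mem_graph_pcomp]
  simp only [h, mem_graph_ofBdd]

/-- The regularization factors through `(1 + D²)^(-1/2)`. -/
theorem exists_reg_eq (hD : IsSelfAdjointRegular A D) {n : ℝ} (hn : n ≠ 0) :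
    ∃ N : Adjointable A E, reg A D n = sqrtResolvent A D * N ∧ star N = N ∧
      Commute (sqrtResolvent A D) N ∧ Commute (absTransform A D) N := by
  have hn' := neg_ne_zero.2 hn
  -- In `n²(D + in)⁻¹(D - in)⁻¹` write `(D + in)⁻¹ = (D + i)⁻¹(1 + i(1 - n)(D + in)⁻¹)` and split
  -- off `r` by `res_one_eq`.
  set N : Adjointable A E := ((n ^ 2 : ℝ) : ℂ) •
    ((boundedTransform A D - imag 1 • sqrtResolvent A D) * (1 + imag (1 - n) • res A D n)
      * res A D (-n)) with hN
  have hc : ∀ X : Adjointable A E, Commute X (boundedTransform A D) →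
      Commute X (sqrtResolvent A D) → (∀ t : ℝ, t ≠ 0 → Commute X (res A D t)) →
      Commute X N := by
    intro X h1 h2 h3
    refine Commute.smul_right ((Commute.mul_right ?_ ?_).mul_right (h3 _ hn')) _
    · exact h1.sub_right (h2.smul_right _)
    · exact (Commute.one_right X).add_right ((h3 n hn).smul_right _)
  have hr : Commute (sqrtResolvent A D) N := hc _ hD.boundedTransform_commute.symm (.refl _)
    fun t ht => hD.sqrtResolvent_commute_res ht
  have hF : Commute (boundedTransform A D) N := hc _ (.refl _) hD.boundedTransform_commute
    fun t ht => hD.boundedTransform_commute_res ht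
  have hR : reg A D n = sqrtResolvent A D * N := by
    rw [hN, mul_smul_comm, ← mul_assoc, ← mul_assoc, ← hD.res_one_eq, reg_eq]
    congr 2
    have h := hD.res_sub_res one_ne_zero hn
    have e : imag (1 - n) = - imag (n - 1) := by rw [← imag_neg, neg_sub]
    rw [mul_add, mul_one, mul_smul_comm, e, neg_smul, ← h]
    abel
  refine ⟨N, hR, ?_, hr, hF.cfc_real _⟩
  refine Adjointable.ext_on_dense hD.dense_range_sqrtResolvent ?_
  rintro _ ⟨x, rfl⟩
  have h1 : star N * sqrtResolvent A D = N * sqrtResolvent A D := by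
    rw [← hr.eq, ← hR, ← hD.star_reg hn, hR, star_mul, star_sqrtResolvent]
  exact congrArg (fun L : Adjointable A E => L.1 x) h1

end IsSelfAdjointRegular

end Module

/-! ### The form estimate and the operator estimate -/

section Module

variable {A E : Type*} [NonUnitalCStarAlgebra A] [PartialOrder A] [StarOrderedRing A]
  [SMul A E] [NormedAddCommGroup E] [NormedSpace ℂ E] [CStarModule A E] [CompleteSpace E]
  {S T : E →ₗ.[ℂ] E} {κ t₀ : ℝ}

namespace AnticommPair

/-- The closure of the anticommutator composed with `(1 + (S + T)²)^(-1/2)` is a bounded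
adjointable operator. -/
theorem exists_anticomm_sqrtResolvent (h : AnticommPair A S T κ t₀) :
    ∃ B : Adjointable A E, ‖B‖ ≤ √(κ * (κ + 2)) ∧
      ∀ x, ((sqrtResolvent A (S + T)).1 x, B.1 x) ∈ (anticomm S T).closure.graph := by
  have hD := h.isSelfAdjointRegular_add
  have hκ := h.pos
  have hsymm := h.isSymm_anticomm.closure h.dense_anticomm_domain
  have hex : ∀ x, ∃ y, ((sqrtResolvent A (S + T)).1 x, y) ∈ (anticomm S T).closure.graph ∧
      ‖y‖ ≤ √(κ * (κ + 2)) * ‖x‖ := by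
    intro x
    obtain ⟨s, t, hs, ht, hst⟩ := mem_graph_add.1 (hD.boundedTransform_graph x)
    obtain ⟨k, hk, hle⟩ := h.exists_closure hs ht
    refine ⟨k, hk, ?_⟩
    -- Since `r² + F² = 1`, the graph norm of `D` at `rx` is the norm of `x`. The relative bound on
    -- the closed anticommutator thus becomes an operator norm bound.
    have e : inner A ((sqrtResolvent A (S + T)).1 x) ((sqrtResolvent A (S + T)).1 x)
        + inner A ((boundedTransform A (S + T)).1 x) ((boundedTransform A (S + T)).1 x)
        = inner A x x := by
      rw [← inner_star_right, ← inner_star_right, star_sqrtResolvent, hD.star_boundedTransform,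
        ← CStarModule.inner_add_right]
      congr 1
      have h1 := hD.boundedTransform_mul_self
      rw [eq_sub_iff_add_eq, add_comm] at h1
      exact congrArg (fun L : Adjointable A E => L.1 x) h1
    rw [← hst, e, ← Real.sq_sqrt (show 0 ≤ κ * (κ + 2) by positivity),
      ← CStarModule.inner_smul_right_real] at hle
    have hle' : inner A k k ≤
        inner A (√(κ * (κ + 2)) • x) (√(κ * (κ + 2)) • x) := by
      rw [CStarModule.inner_smul_left_real, CStarModule.inner_smul_right_real, smul_smul, ← sq,
        ← CStarModule.inner_smul_right_real]
      exact hle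
    have := norm_le_norm_of_inner_le A hle'
    rwa [norm_smul, Real.norm_of_nonneg (Real.sqrt_nonneg _)] at this
  obtain ⟨B, hB⟩ := hsymm.exists_adjointable
    (h.dense_anticomm_domain.mono (LinearPMap.le_closure _).1) (star_sqrtResolvent A (S + T)) hex
  refine ⟨B, Adjointable.norm_le_of_forall (Real.sqrt_nonneg _) fun x => ?_, hB⟩
  obtain ⟨y, hy, hyx⟩ := hex x
  rwa [graph_unique (hB x) hy]

/-- Symmetry of the closed anticommutator makes `rB` self-adjoint, so `(rB)² = rBB⋆r ≤ ‖B‖²r²` and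
`le_of_mul_self_le` applies. The result is the form estimate conjugated by `r`. -/
theorem exists_form (h : AnticommPair A S T κ t₀) :
    ∃ B : Adjointable A E,
      (∀ x, ((sqrtResolvent A (S + T)).1 x, B.1 x) ∈ (anticomm S T).closure.graph) ∧
      sqrtResolvent A (S + T) * B ≤ √(κ * (κ + 2)) •
        (sqrtResolvent A (S + T) * sqrtResolvent A (S + T)
          + sqrtResolvent A (S + T) * absTransform A (S + T)) ∧
      -(sqrtResolvent A (S + T) * B) ≤ √(κ * (κ + 2)) •
        (sqrtResolvent A (S + T) * sqrtResolvent A (S + T)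
          + sqrtResolvent A (S + T) * absTransform A (S + T)) := by
  have hD := h.isSelfAdjointRegular_add
  have hsymm := h.isSymm_anticomm.closure h.dense_anticomm_domain
  obtain ⟨B, hBn, hB⟩ := h.exists_anticomm_sqrtResolvent
  have hr := star_sqrtResolvent A (S + T)
  have hH : star (sqrtResolvent A (S + T) * B) = sqrtResolvent A (S + T) * B := by
    refine (eq_star fun x y => ?_).symm
    change inner A x ((sqrtResolvent A (S + T)).1 (B.1 y))
      = inner A ((sqrtResolvent A (S + T)).1 (B.1 x)) y
    nth_rewrite 1 [← hr]
    rw [inner_star_right, ← hsymm (hB x) (hB y)]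
    have h1 := inner_star_right (sqrtResolvent A (S + T)) (B.1 x) y
    rwa [hr] at h1
  have hsq : (sqrtResolvent A (S + T) * B) * (sqrtResolvent A (S + T) * B)
      ≤ (√(κ * (κ + 2)) ^ 2) • (sqrtResolvent A (S + T) * sqrtResolvent A (S + T)) := by
    have h1 : B * star B ≤ algebraMap ℝ (Adjointable A E) (√(κ * (κ + 2)) ^ 2) :=
      CStarAlgebra.mul_star_le_algebraMap_norm_sq.trans
        (algebraMap_mono _ (pow_le_pow_left₀ (norm_nonneg _) hBn 2))
    have h2 := star_left_conjugate_le_conjugate h1 (sqrtResolvent A (S + T))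
    nth_rewrite 2 [← hH]
    rw [star_mul, hr]
    rw [hr, Algebra.algebraMap_eq_smul_one, mul_smul_comm, smul_mul_assoc, mul_one] at h2
    simpa only [mul_assoc] using h2
  obtain ⟨h1, h2⟩ := le_of_mul_self_le (Real.sqrt_nonneg _) hH (sqrtResolvent_nonneg A (S + T)) hsq
  have h3 := smul_le_smul_of_nonneg_left hD.sqrtResolvent_le (Real.sqrt_nonneg (κ * (κ + 2)))
  exact ⟨B, hB, h1.trans h3, h2.trans h3⟩

theorem formEstimate (h : AnticommPair A S T κ t₀) :
    FormEstimate A S T √(κ * (κ + 2)) := by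
  intro x hS hT
  have hD := h.isSelfAdjointRegular_add
  obtain ⟨B, hB, hle, -⟩ := h.exists_form
  have hr := star_sqrtResolvent A (S + T)
  obtain ⟨d, hd⟩ := exists_mem_graph (P := S + T) (x := x) ⟨hS, hT⟩
  obtain ⟨y, rfl, -⟩ := hD.exists_eq_sqrtResolvent hd
  have habs := hD.mem_graph_absOp.2 ⟨y, rfl, rfl⟩
  refine ⟨LinearPMap.mem_domain_of_mem_graph (hB y), LinearPMap.mem_domain_of_mem_graph habs, ?_⟩
  rw [apply_eq_of_mem_graph (hB y), apply_eq_of_mem_graph habs]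
  have hsa : IsSelfAdjoint (absTransform A (S + T)) :=
    IsSelfAdjoint.of_nonneg (absTransform_nonneg A (S + T))
  have h1 := Adjointable.inner_mono hle y
  rw [← Complex.coe_smul, Adjointable.smul_apply, Complex.coe_smul,
    CStarModule.inner_smul_right_real, Adjointable.add_apply,
    CStarModule.inner_add_right] at h1
  have h2 : ∀ X : Adjointable A E, inner A y ((sqrtResolvent A (S + T) * X).1 y)
      = inner A ((sqrtResolvent A (S + T)).1 y) (X.1 y) := fun X => by
    rw [Adjointable.mul_apply, ← inner_star_left, hr]
  rw [h2, h2, h2] at h1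
  have h3 : inner A (B.1 y) ((sqrtResolvent A (S + T)).1 y)
      = inner A ((sqrtResolvent A (S + T)).1 y) (B.1 y) :=
    (h.isSymm_anticomm.closure h.dense_anticomm_domain) (hB y) (hB y)
  have h4 : inner A ((absTransform A (S + T)).1 y) ((sqrtResolvent A (S + T)).1 y)
      = inner A ((sqrtResolvent A (S + T)).1 y) ((absTransform A (S + T)).1 y) := by
    rw [← inner_star_right, hsa.star_eq]
    have hc : Commute (absTransform A (S + T)) (sqrtResolvent A (S + T)) :=
      hD.boundedTransform_commute.cfc_real _
    have h5 : (absTransform A (S + T)).1 ((sqrtResolvent A (S + T)).1 y)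
        = (sqrtResolvent A (S + T)).1 ((absTransform A (S + T)).1 y) :=
      congrArg (fun L : Adjointable A E => L.1 y) hc.eq
    rw [h5, ← inner_star_left, hr]
  rw [h3, h4]
  exact h1

theorem operatorEstimate (h : AnticommPair A S T κ t₀) {μ : ℝ} (hμ : μ ≠ 0) :
    OperatorEstimate A S T √(κ * (κ + 2)) μ := by
  have hD := h.isSelfAdjointRegular_add
  have hn := inv_ne_zero hμ
  obtain ⟨B, hB, hle, hle'⟩ := h.exists_form
  obtain ⟨N, hRN, hN, hrN, hfN⟩ := hD.exists_reg_eq hn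
  have hRN' : reg A (S + T) μ⁻¹ = N * sqrtResolvent A (S + T) := hRN.trans hrN.eq
  -- Conjugation by the self-adjoint `N` turns the inequality for `rB` into (b), because `rN = Nr`
  -- is the resolvent of `D²`.
  have hL : star N * (sqrtResolvent A (S + T) * B) * N = reg A (S + T) μ⁻¹ * (B * N) := by
    rw [hN, hRN']
    simp only [mul_assoc]
  have hM : star N * (√(κ * (κ + 2)) • (sqrtResolvent A (S + T) * sqrtResolvent A (S + T)
      + sqrtResolvent A (S + T) * absTransform A (S + T))) * N
      = ((√(κ * (κ + 2)) : ℝ) : ℂ) • (reg A (S + T) μ⁻¹ * reg A (S + T) μ⁻¹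
        + absTransform A (S + T) * (N * reg A (S + T) μ⁻¹)) := by
    rw [hN, Complex.coe_smul, mul_smul_comm, smul_mul_assoc]
    congr 1
    have hc : Commute (absTransform A (S + T)) (sqrtResolvent A (S + T)) :=
      hD.boundedTransform_commute.cfc_real _
    rw [mul_add, add_mul]
    congr 1
    · nth_rewrite 1 [hRN']
      rw [hRN]
      simp only [mul_assoc]
    · rw [hRN, ← hc.eq, ← mul_assoc, ← hfN.eq]
      simp only [mul_assoc]
  rw [OperatorEstimate, hD.resolventSq_eq hμ]
  refine ⟨hD.isBddInverse_reg hμ, reg A (S + T) μ⁻¹ * (B * N), reg A (S + T) μ⁻¹ *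
    reg A (S + T) μ⁻¹ + absTransform A (S + T) * (N * reg A (S + T) μ⁻¹), ?_, ?_, ?_, ?_⟩
  · refine ofBdd_eq_iff.2 fun x => mem_graph_pcomp.2 ⟨B.1 (N.1 x), mem_graph_pcomp.2
      ⟨_, mem_graph_ofBdd.2 rfl, ?_⟩, mem_graph_ofBdd.2 rfl⟩
    -- The resolvent maps into `dom D²`, hence into `ℱ(S, T)`, so the closed anticommutator agrees
    -- there with `[S, T]`.
    obtain ⟨s, t, k, hk⟩ := h.exists_anticomm (hD.reg_graph hn x) (hD.mulReg_graph hn x)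
    have h1 := mem_graph_anticomm.2 ⟨s, t, hk⟩
    have h2 := LinearPMap.le_graph_of_le (LinearPMap.le_closure _) h1
    have h3 := hB (N.1 x)
    have h4 : (sqrtResolvent A (S + T)).1 (N.1 x) = (reg A (S + T) μ⁻¹).1 x :=
      congrArg (fun L : Adjointable A E => L.1 x) hRN.symm
    rw [h4] at h3
    rwa [graph_unique h3 h2]
  · refine ofBdd_eq_iff.2 fun x => mem_graph_pcomp.2 ⟨_, mem_graph_ofBdd.2 rfl,
      mem_graph_onePlus.2 ⟨_, hD.mem_graph_absOp.2 ⟨N.1 ((reg A (S + T) μ⁻¹).1 x), ?_, rfl⟩, ?_⟩⟩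
    · rw [sq]
      nth_rewrite 1 [hRN]
      rfl
    · rw [sq]
      rfl
  · have := star_left_conjugate_le_conjugate hle N
    rwa [hL, hM] at this
  · have := star_left_conjugate_le_conjugate hle' N
    rwa [mul_neg, neg_mul, hL, hM] at this

end AnticommPair

end Module

end

end HilbertModule

theorem proposition7p6 {A E : Type*} [NonUnitalCStarAlgebra A] [PartialOrder A]
    [StarOrderedRing A] [SMul A E] [NormedAddCommGroup E] [NormedSpace ℂ E] [CStarModule A E]
    [CompleteSpace E] (S T : E →ₗ.[ℂ] E) (hST : HilbertModule.WeaklyAnticommuting A S T) :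
    HilbertModule.IsSelfAdjointRegular A (S + T) ∧
    (∃ C : ℝ, 0 < C ∧ HilbertModule.FormEstimate A S T C ∧
      ∀ μ : ℝ, 0 < μ → HilbertModule.OperatorEstimate A S T C μ) ∧
    (∀ ε : ℝ, 0 < ε → ∃ r : ℝ, 0 < r ∧
      HilbertModule.WeaklyAnticommuting A ((r : ℂ) • S) ((r : ℂ) • T) ∧
      ∃ C : ℝ, 0 < C ∧ C < ε ∧
        HilbertModule.FormEstimate A ((r : ℂ) • S) ((r : ℂ) • T) C ∧
        ∀ μ : ℝ, 0 < μ → HilbertModule.OperatorEstimate A ((r : ℂ) • S) ((r : ℂ) • T) C μ) := by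
  obtain ⟨κ, t₀, h⟩ := hST.exists_anticommPair
  have hκ := h.pos
  refine ⟨h.isSelfAdjointRegular_add, ⟨√(κ * (κ + 2)), Real.sqrt_pos.2 (by positivity),
    h.formEstimate, fun μ hμ => h.operatorEstimate hμ.ne'⟩, fun ε hε => ?_⟩
  -- The constant for the pair scaled by `r` is the earlier one with `κ` replaced by `r²κ`, and it
  -- tends to `0` with `r`.
  have hlim : Filter.Tendsto (fun r : ℝ => √(r ^ 2 * κ * (r ^ 2 * κ + 2)))
      (nhdsWithin 0 (Set.Ioi 0)) (nhds 0) := by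
    have hc : Continuous fun r : ℝ => √(r ^ 2 * κ * (r ^ 2 * κ + 2)) := by fun_prop
    have := hc.tendsto 0
    simp only [ne_eq, OfNat.ofNat_ne_zero, not_false_eq_true, zero_pow, zero_mul,
      Real.sqrt_zero] at this
    exact this.mono_left nhdsWithin_le_nhds
  obtain ⟨r, hrε, hr0, hr1⟩ := ((hlim.eventually (gt_mem_nhds hε)).and
    (Ioc_mem_nhdsGT (zero_lt_one' ℝ))).exists
  have h' := h.smul hr0.ne' (by rwa [abs_of_pos hr0])
  exact ⟨r, hr0, h'.weaklyAnticommuting, _, Real.sqrt_pos.2 (by positivity), hrε,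
    h'.formEstimate, fun μ hμ => h'.operatorEstimate hμ.ne'⟩
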